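/- Let $M,N$ be smooth manifolds (Hausdorff, $\sigma$-compact, finite-dimensional, without boundary). Write $\mathbb TM=TM\oplus T^*M$, with pairing $\langle X+\alpha,Y+\beta\rangle_+=\tfrac12(\beta(X)+\alpha(Y))$ and Courant bracket $[\![X+\alpha,Y+\beta]\!]=[X,Y]+\mathcal L_X\beta-\mathcal L_Y\alpha+\tfrac12 d(\alpha(Y)-\beta(X))$. A Dirac structure on $M$ is a maximal isotropic smooth subbundle $L\subset\mathbb TM$ whose space of sections is closed under the Courant bracket; it is a Lie algebroid with this bracket and with anchor the projection to $TM$. Let $L$, $K$ be Dirac structures on $M$, $N$. A smooth map $\phi:M\to N$ is a Dirac map if either $L_x=\{X+\phi^*\alpha:\phi_*X+\alpha\in K_{\phi(x)}\}$ for all $x\in M$ (backward), or $K_{\phi(x)}=\{\phi_*X+\alpha: X+\phi^*\alpha\in L_x\}$ for all $x\in M$ (forward). It is admissible if, moreover, $$\mathcal R_{(x,\phi(x))}=\{(X+\phi^*\alpha,\phi_*X+\alpha): X+\phi^*\alpha\in L_x,\ \phi_*X+\alpha\in K_{\phi(x)}\}$$ is a smooth vector subbundle of $\mathbb TM\times\mathbb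 TN$ over $\operatorname{graph}\phi\cong M$. Thus $\mathcal R=\Gamma^\phi\cap(L\times K)$, where $\Gamma^\phi=\{(v+\phi^*\alpha,\phi_*v+\alpha)\}$. Identify $\mathbb TM\times\mathbb TN$ with $\mathbb T(M\times N)$ by $(X+\alpha,Y+\beta)\mapsto(X,Y)+(\alpha,-\beta)$. **Proposition.** Let $\phi:(M,L)\to(N,K)$ be an admissible Dirac map. 1. $\Gamma^\phi$ is closed under the Courant bracket: if two sections of $\mathbb T(M\times N)$ restrict on $\operatorname{graph}\phi$ to sections of $\Gamma^\phi$, so does their Courant bracket. There is a unique pair consisting of an anchor and a bracket on $\mathcal R$ such that the anchor is $(X+\phi^*\alpha,\phi_*X+\alpha)\mapsto(X,\phi_*X)\in T\operatorname{graph}\phi$ and, whenever sections $S,T$ of $L\times K\to M\times N$ restrict on $\operatorname{graph}\phi$ to sections $s,t$ of $\mathcal R$, the Courant bracket $[\![S,T]\!]$ restricts to $[s,t]$. With these, $\mathcal R$ is a Lie algebroid over $\operatorname{graph}\phi$. 2. $L$ and $K$ are Lie algebroids, and the projections $i:\mathcal R\to L$ (covering $\operatorname{graph}\phi\to M$) and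 $j:\mathcal R\to K$ (covering $\operatorname{graph}\phi\to N$) are Lie algebroid morphisms. 3. Consequently the modular class of $\phi$ is well defined: pullback of forms induces linear maps $i^*:H^1(L)\to H^1(\mathcal R)$ and $j^*:H^1(K)\to H^1(\mathcal R)$; the modular classes $\operatorname{mod}L\in H^1(L)$ and $\operatorname{mod}K\in H^1(K)$ exist and are unique; hence $\operatorname{mod}\phi=i^*\operatorname{mod}L-j^*\operatorname{mod}K$ is a well-defined class in $H^1(\mathcal R)$. Here $H^1(A)$ is the first Lie algebroid cohomology of $A$ with trivial coefficients, and the modular class of a Lie algebroid $A\to M$ with anchor $\rho$ is the class $[\alpha]\in H^1(A)$ such that $\nabla_s\sigma=2\alpha(s)\,\sigma$ for all $s\in\Gamma(A)$, for some nowhere vanishing smooth section $\sigma$ of $L_A\otimes L_A$, where $L_A=\wedge^{\rm top}A\otimes\wedge^{\rm top}T^*M$ has the flat $A$-connection $\nabla_s(\omega\otimes\mu)=\mathcal L_s\omega\otimes\mu+\omega\otimes\mathcal L_{\rho(s)}\mu$. (If $L_A$ has a nowhere vanishing section $\tau$, this is the class $[\alpha]$ with $\nabla_s\tau=\alpha(s)\tau$.)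 -/

import Mathlib

set_option maxSynthPendingDepth 3

open scoped Manifold ContDiff Bundle TensorProduct
open Bundle VectorField

noncomputable section

section Generic

variable {E : Type*} [NormedAddCommGroup E] [NormedSpace ℝ E]
  {H : Type*} [TopologicalSpace H] (I : ModelWithCorners ℝ E H)
  {M : Type*} [TopologicalSpace M] [ChartedSpace H M] [IsManifold I ∞ M]

/-! ### One-forms and the generalized tangent bundle -/

/-- The cotangent space `T*_x M`. -/
abbrev Cotan (x : M) : Type _ := TangentSpace I x →L[ℝ] ℝ

/-- The generalized tangent space `T_x M ⊕ T*_x M`. -/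
abbrev GTan (x : M) : Type _ := TangentSpace I x × Cotan I x

/-- The typical fiber of the generalized tangent bundle. -/
abbrev GModel (E : Type*) [NormedAddCommGroup E] [NormedSpace ℝ E] : Type _ := E × (E →L[ℝ] ℝ)

/-- The Lie derivative `L_X β` of a one-form. It is computed in the preferred chart at `x₀`, where
`(L_X β)_z (v) = (Dβ_z (X_z)) v + β_z (DX_z v)`, and then pulled back to `T_{x₀} M`. -/
def lieDerivForm (X : ∀ x : M, TangentSpace I x) (β : ∀ x : M, Cotan I x) (x₀ : M) :
    Cotan I x₀ :=
  let c := extChartAt I x₀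
  let X' : E → E := mpullbackWithin 𝓘(ℝ, E) I c.symm X (Set.range I)
  let β' : E → (E →L[ℝ] ℝ) := fun z =>
    (β (c.symm z)).comp (mfderivWithin 𝓘(ℝ, E) I c.symm (Set.range I) z)
  (fderivWithin ℝ β' (Set.range I) (c x₀) (X' (c x₀)) +
    (β' (c x₀)).comp (fderivWithin ℝ X' (Set.range I) (c x₀))).comp (mfderiv I 𝓘(ℝ, E) c x₀)

/-- The (skew-symmetric) Courant bracket
`[X + α, Y + β] = [X, Y] + L_X β - L_Y α + ½ d(⟨α, Y⟩ - ⟨β, X⟩)`. -/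
def courantBracket (s t : ∀ x : M, GTan I x) (x : M) : GTan I x :=
  (mlieBracket I (fun y => (s y).1) (fun y => (t y).1) x,
    lieDerivForm I (fun y => (s y).1) (fun y => (t y).2) x
      - lieDerivForm I (fun y => (t y).1) (fun y => (s y).2) x
      + (1 / 2 : ℝ) • mvfderiv I (fun y => (s y).2 (t y).1 - (t y).2 (s y).1) x)

/-- The symmetric pairing `⟨X + α, Y + β⟩₊ = ½ (⟨β, X⟩ + ⟨α, Y⟩)`. -/
def symPairing {x : M} (u w : GTan I x) : ℝ := (1 / 2 : ℝ) * (w.2 u.1 + u.2 w.1)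

/-! ### Vector subbundles and their sections

A vector bundle `A → M` is presented as a smooth subbundle of a smooth vector bundle `V → M`
with typical fiber `F`, that is, as a family of subspaces of the fibers of `V`. -/

variable (F : Type*) [NormedAddCommGroup F] [NormedSpace ℝ F] {V : M → Type*}
  [∀ x, AddCommGroup (V x)] [∀ x, Module ℝ (V x)] [∀ x, TopologicalSpace (V x)]
  [TopologicalSpace (TotalSpace F V)] [FiberBundle F V] [VectorBundle ℝ F V]

/-- The family `A` is a smooth vector subbundle: near each point it has a smooth frame. -/
def IsSubbundle (A : ∀ x : M, Submodule ℝ (V x)) : Prop :=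
  ∀ x₀ : M, ∃ (k : ℕ) (U : Set M) (e : Fin k → ∀ x, V x), IsOpen U ∧ x₀ ∈ U ∧
    (∀ i, ContMDiffOn I (I.prod 𝓘(ℝ, F)) ∞ (fun x => TotalSpace.mk' F x (e i x)) U) ∧
    ∀ x ∈ U, LinearIndependent ℝ (fun i => e i x) ∧
      Submodule.span ℝ (Set.range fun i => e i x) = A x

/-- The space `Γ(A)` of smooth sections of `A`. -/
def smoothSections (A : ∀ x : M, Submodule ℝ (V x)) : Submodule ℝ (∀ x, V x) where
  carrier := {s | ContMDiff I (I.prod 𝓘(ℝ, F)) ∞ (fun x => TotalSpace.mk' F x (s x)) ∧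
    ∀ x, s x ∈ A x}
  add_mem' := fun hs ht => ⟨hs.1.add_section ht.1, fun x => (A x).add_mem (hs.2 x) (ht.2 x)⟩
  zero_mem' := ⟨contMDiff_zeroSection ℝ V, fun x => (A x).zero_mem⟩
  smul_mem' := fun c _ hs => ⟨hs.1.const_smul_section, fun x => (A x).smul_mem c (hs.2 x)⟩

variable {I F} {A : ∀ x : M, Submodule ℝ (V x)}

/-- The value `s(x) ∈ A_x` of a section. -/
def secVal (s : smoothSections I F A) (x : M) : A x := ⟨s.1 x, s.2.2 x⟩

/-! ### Lie algebroids -/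

variable (I F A) in
/-- The data of a Lie algebroid structure on `A`: an anchor and a bracket on `Γ(A)`. -/
@[ext] structure AlgebroidData where
  /-- the anchor `A → TM` -/
  anchor : ∀ x : M, A x →ₗ[ℝ] TangentSpace I x
  /-- the bracket on `Γ(A)` -/
  bracket : smoothSections I F A → smoothSections I F A → smoothSections I F A

/-- The vector field `ρ(s)`. -/
def AlgebroidData.anchorField (P : AlgebroidData I F A) (s : smoothSections I F A) (x : M) :
    TangentSpace I x := P.anchor x (secVal s x)

/-- The derivative `ρ(s)(f)` of a function along the anchor of a section, at `x`. -/
def AlgebroidData.act (P : AlgebroidData I F A) (s : smoothSections I F A) (f : M → ℝ) (x : M) :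
    ℝ := mvfderiv I f x (P.anchorField s x)

/-- `A`, with the given anchor and bracket, is a Lie algebroid. -/
structure IsLieAlgebroid (P : AlgebroidData I F A) : Prop where
  subbundle : IsSubbundle I F A
  anchor_smooth : ∀ s, ContMDiff I (I.prod 𝓘(ℝ, E)) ∞
    (fun x => TotalSpace.mk' E (E := TangentSpace I (M := M)) x (P.anchorField s x))
  add_bracket : ∀ s s' t, P.bracket (s + s') t = P.bracket s t + P.bracket s' t
  smul_bracket : ∀ (c : ℝ) s t, P.bracket (c • s) t = c • P.bracket s t
  skew : ∀ s t, P.bracket s t = -P.bracket t s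
  jacobi : ∀ s t u, P.bracket s (P.bracket t u) + P.bracket t (P.bracket u s)
    + P.bracket u (P.bracket s t) = 0
  /-- `[s, f t] = f [s, t] + ρ(s)(f) t` -/
  leibniz : ∀ (s t ft : smoothSections I F A) (f : M → ℝ), ContMDiff I 𝓘(ℝ, ℝ) ∞ f →
    (∀ x, ft.1 x = f x • t.1 x) →
    ∀ x, (P.bracket s ft).1 x = f x • (P.bracket s t).1 x + P.act s f x • t.1 x
  anchor_bracket : ∀ s t x, P.anchorField (P.bracket s t) x =
    mlieBracket I (P.anchorField s) (P.anchorField t) x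

/-! ### Lie algebroid cohomology in degree one -/

set_option linter.unusedSectionVars false in
theorem mvfderiv_const_smul_fun (c : ℝ) {f : M → ℝ} {x : M}
    (hf : MDifferentiableAt I 𝓘(ℝ, ℝ) f x) :
    mvfderiv I (c • f) x = c • mvfderiv I f x := by
  have h := mvfderiv_smul (I := I) (a := fun _ : M => c) (x := x) mdifferentiableAt_const hf
  rw [mvfderiv_const] at h
  refine Eq.trans h ?_
  ext v
  simp

variable (I F A) in
/-- The space `Ω¹(A)` of smooth sections of `A*`. -/
def aForms : Submodule ℝ (∀ x : M, A x →ₗ[ℝ] ℝ) where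
  carrier := {α | ∀ s : smoothSections I F A, ContMDiff I 𝓘(ℝ, ℝ) ∞ fun x => α x (secVal s x)}
  add_mem' := fun ha hb s => (ha s).add (hb s)
  zero_mem' := fun _ => contMDiff_const
  smul_mem' := fun _ _ ha s => contMDiff_const.mul (ha s)

/-- `(d_A α)(s, t) = ρ(s)(α(t)) - ρ(t)(α(s)) - α([s, t])`. -/
def AlgebroidData.dOne (P : AlgebroidData I F A) (α : ∀ x : M, A x →ₗ[ℝ] ℝ)
    (s t : smoothSections I F A) (x : M) : ℝ :=
  P.act s (fun y => α y (secVal t y)) x - P.act t (fun y => α y (secVal s y)) x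
    - α x (secVal (P.bracket s t) x)

/-- The closed one-forms of `A`. -/
def AlgebroidData.closedForms (P : AlgebroidData I F A) :
    Submodule ℝ (∀ x : M, A x →ₗ[ℝ] ℝ) where
  carrier := {α | α ∈ aForms I F A ∧ ∀ s t x, P.dOne α s t x = 0}
  add_mem' := by
    rintro α β ⟨ha, ha'⟩ ⟨hb, hb'⟩
    refine ⟨Submodule.add_mem _ ha hb, fun s t x => ?_⟩
    have h1 := ha' s t x
    have h2 := hb' s t x
    have key : ∀ u : smoothSections I F A,
        mvfderiv I (fun y => (α + β) y (secVal u y)) x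
          = mvfderiv I (fun y => α y (secVal u y)) x
            + mvfderiv I (fun y => β y (secVal u y)) x := fun u =>
      mvfderiv_add ((ha u).mdifferentiable (by simp) x) ((hb u).mdifferentiable (by simp) x)
    simp only [AlgebroidData.dOne, AlgebroidData.act] at h1 h2 ⊢
    rw [key, key]
    simp only [Pi.add_apply, LinearMap.add_apply, add_apply]
    linarith
  zero_mem' := by
    refine ⟨Submodule.zero_mem _, fun s t x => ?_⟩
    simp [AlgebroidData.dOne, AlgebroidData.act, mvfderiv_const]
  smul_mem' := by
    rintro c α ⟨ha, ha'⟩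
    refine ⟨Submodule.smul_mem _ c ha, fun s t x => ?_⟩
    have h1 := ha' s t x
    have key : ∀ u : smoothSections I F A,
        mvfderiv I (fun y => (c • α) y (secVal u y)) x
          = c • mvfderiv I (fun y => α y (secVal u y)) x := fun u =>
      mvfderiv_const_smul_fun c ((ha u).mdifferentiable (by simp) x)
    simp only [AlgebroidData.dOne, AlgebroidData.act] at h1 ⊢
    rw [key, key]
    simp only [Pi.smul_apply, LinearMap.smul_apply, smul_apply, smul_eq_mul]
    linear_combination c * h1

/-- The exact one-forms `d_A f`, where `(d_A f)(a) = ρ(a)(f)`. -/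
def AlgebroidData.exactForms (P : AlgebroidData I F A) :
    Submodule ℝ (∀ x : M, A x →ₗ[ℝ] ℝ) where
  carrier := {α | ∃ f : M → ℝ, ContMDiff I 𝓘(ℝ, ℝ) ∞ f ∧
    ∀ x a, α x a = mvfderiv I f x (P.anchor x a)}
  add_mem' := by
    rintro α β ⟨f, hf, ha⟩ ⟨g, hg, hb⟩
    refine ⟨f + g, hf.add hg, fun x a => ?_⟩
    rw [mvfderiv_add (hf.mdifferentiable (by simp) x) (hg.mdifferentiable (by simp) x)]
    simp [ha, hb]
  zero_mem' := ⟨fun _ => 0, contMDiff_const, fun x a => by simp [mvfderiv_const]⟩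
  smul_mem' := by
    rintro c α ⟨f, hf, ha⟩
    refine ⟨c • f, contMDiff_const.mul hf, fun x a => ?_⟩
    rw [mvfderiv_const_smul_fun c (hf.mdifferentiable (by simp) x)]
    simp [ha]

/-- The Lie algebroid cohomology `H¹(A)`: closed one-forms modulo exact ones. -/
abbrev AlgebroidData.H1 (P : AlgebroidData I F A) : Type _ :=
  P.closedForms ⧸ P.exactForms.submoduleOf P.closedForms

/-- The class in `H¹(A)` of a closed one-form. -/
def AlgebroidData.classOf (P : AlgebroidData I F A) (α : P.closedForms) : P.H1 :=
  Submodule.Quotient.mk α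

/-! ### The modular class

The line bundle is `L_A = ⋀^top A ⊗ ⋀^top T*M` with the flat `A`-connection
`∇_s (ω ⊗ μ) = L_s ω ⊗ μ + ω ⊗ L_{ρ(s)} μ`. As `L_A` need not be orientable, its characteristic
class is defined to be one half of that of `L_A ⊗ L_A`. Here `r` is the rank of `A`. -/

variable (I A) in
/-- The fiber at `x` of `L_A = ⋀^top A ⊗ ⋀^top T*M`. -/
abbrev CanLine (r : ℕ) (x : M) : Type _ :=
  (⋀[ℝ]^r (A x)) ⊗[ℝ] (⋀[ℝ]^(Module.finrank ℝ E) (Cotan I x))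

/-- The element `(e₁ ∧ … ∧ e_r) ⊗ (θ₁ ∧ … ∧ θ_n)` of `L_A` at `x`. -/
def frameElt {r : ℕ} (e : Fin r → smoothSections I F A)
    (θ : Fin (Module.finrank ℝ E) → ∀ x : M, Cotan I x) (x : M) : CanLine I A r x :=
  exteriorPower.ιMulti ℝ r (fun i => secVal (e i) x) ⊗ₜ[ℝ]
    exteriorPower.ιMulti ℝ (Module.finrank ℝ E) (fun i => θ i x)

/-- The covariant derivative of the local section `(e₁ ∧ … ∧ e_r) ⊗ (θ₁ ∧ … ∧ θ_n)` of `L_A` along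
`s`, both Lie derivatives being expanded as derivations of the exterior product. -/
def AlgebroidData.nablaFrame (P : AlgebroidData I F A) {r : ℕ} (s : smoothSections I F A)
    (e : Fin r → smoothSections I F A)
    (θ : Fin (Module.finrank ℝ E) → ∀ x : M, Cotan I x) (x : M) : CanLine I A r x :=
  (∑ i, exteriorPower.ιMulti ℝ r
      (Function.update (fun k => secVal (e k) x) i (secVal (P.bracket s (e i)) x))) ⊗ₜ[ℝ]
    exteriorPower.ιMulti ℝ (Module.finrank ℝ E) (fun i => θ i x)
  + exteriorPower.ιMulti ℝ r (fun i => secVal (e i) x) ⊗ₜ[ℝ]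
    (∑ i, exteriorPower.ιMulti ℝ (Module.finrank ℝ E)
      (Function.update (fun k => θ k x) i (lieDerivForm I (P.anchorField s) (θ i) x)))

/-- `e` and `θ` are frames of `A` and of `T*M` over `U`. -/
structure IsFramePair {r : ℕ} (e : Fin r → smoothSections I F A)
    (θ : Fin (Module.finrank ℝ E) → ∀ x : M, Cotan I x) (U : Set M) : Prop where
  smooth : ∀ i, ContMDiff I (I.prod 𝓘(ℝ, E →L[ℝ] ℝ)) ∞
    (fun x => TotalSpace.mk' (E →L[ℝ] ℝ) (E := fun x : M => Cotan I x) x (θ i x))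
  indep_e : ∀ x ∈ U, LinearIndependent ℝ (fun i => secVal (e i) x)
  span_e : ∀ x ∈ U, Submodule.span ℝ (Set.range fun i => secVal (e i) x) = ⊤
  indep_θ : ∀ x ∈ U, LinearIndependent ℝ (fun i => θ i x)
  span_θ : ∀ x ∈ U, Submodule.span ℝ (Set.range fun i => θ i x) = ⊤

/-- The closed form `α` is a modular cocycle of the rank `r` Lie algebroid `A`: there is a smooth
nowhere vanishing section `σ` of `L_A ⊗ L_A` with `∇_s σ = 2 α(s) σ` for all `s ∈ Γ(A)`. Over an
open set with frames `e`, `θ` one has `σ = h · t ⊗ t`, with `t` the section of `L_A` given by the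
frames, and `∇_s σ = ρ(s)(h) t ⊗ t + h (∇_s t ⊗ t + t ⊗ ∇_s t)`. -/
def AlgebroidData.IsModularCocycle (P : AlgebroidData I F A) (r : ℕ) (α : P.closedForms) : Prop :=
  ∃ σ : ∀ x : M, CanLine I A r x ⊗[ℝ] CanLine I A r x, (∀ x, σ x ≠ 0) ∧
    ∀ (U : Set M) (e : Fin r → smoothSections I F A)
      (θ : Fin (Module.finrank ℝ E) → ∀ x : M, Cotan I x), IsOpen U → IsFramePair e θ U →
      ∃ h : M → ℝ, ContMDiffOn I 𝓘(ℝ, ℝ) ∞ h U ∧ ∀ x ∈ U,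
        σ x = h x • (frameElt e θ x ⊗ₜ[ℝ] frameElt e θ x) ∧
        ∀ s : smoothSections I F A,
          P.act s h x • (frameElt e θ x ⊗ₜ[ℝ] frameElt e θ x)
            + h x • (P.nablaFrame s e θ x ⊗ₜ[ℝ] frameElt e θ x
              + frameElt e θ x ⊗ₜ[ℝ] P.nablaFrame s e θ x)
          = (2 * α.1 x (secVal s x)) • σ x

/-- `c ∈ H¹(A)` is the modular class of the rank `r` Lie algebroid `A`. -/
def AlgebroidData.IsModularClass (P : AlgebroidData I F A) (r : ℕ) (c : P.H1) : Prop :=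
  ∃ α : P.closedForms, P.IsModularCocycle r α ∧ c = P.classOf α

/-! ### Dirac structures -/

variable (I M) in
/-- A Dirac structure on `M`: a smooth subbundle `L` of `TM ⊕ T*M` that is maximal isotropic
(it is its own orthogonal for the symmetric pairing) and integrable (`Γ(L)` is closed under the
Courant bracket). -/
structure DiracStructure where
  /-- the fibers of the subbundle -/
  fiber : ∀ x : M, Submodule ℝ (GTan I x)
  subbundle : IsSubbundle I (GModel E) fiber
  maximal_isotropic : ∀ x (u : GTan I x), u ∈ fiber x ↔ ∀ w ∈ fiber x, symPairing I u w = 0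
  integrable : ∀ s ∈ smoothSections I (GModel E) fiber, ∀ t ∈ smoothSections I (GModel E) fiber,
    courantBracket I s t ∈ smoothSections I (GModel E) fiber

/-- The Lie algebroid of a Dirac structure: the anchor is the projection to `TM` and the bracket is
the Courant bracket. -/
def DiracStructure.algebroid (L : DiracStructure I M) :
    AlgebroidData I (GModel E) L.fiber where
  anchor := fun x => (LinearMap.fst ℝ (TangentSpace I x) (Cotan I x)).comp (L.fiber x).subtype
  bracket := fun s t => ⟨courantBracket I s.1 t.1, L.integrable s.1 s.2 t.1 t.2⟩

end Generic

section TwoManifolds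

variable {E : Type*} [NormedAddCommGroup E] [NormedSpace ℝ E]
  {H : Type*} [TopologicalSpace H] {I : ModelWithCorners ℝ E H}
  {M : Type*} [TopologicalSpace M] [ChartedSpace H M] [IsManifold I ∞ M]
  {E' : Type*} [NormedAddCommGroup E'] [NormedSpace ℝ E']
  {H' : Type*} [TopologicalSpace H'] {J : ModelWithCorners ℝ E' H'}
  {N : Type*} [TopologicalSpace N] [ChartedSpace H' N] [IsManifold J ∞ N]

/-! ### Lie algebroid morphisms -/

section Morphism

variable {F : Type*} [NormedAddCommGroup F] [NormedSpace ℝ F] {V : M → Type*}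
  [∀ x, AddCommGroup (V x)] [∀ x, Module ℝ (V x)] [∀ x, TopologicalSpace (V x)]
  [TopologicalSpace (TotalSpace F V)] [FiberBundle F V] [VectorBundle ℝ F V]
  {A : ∀ x : M, Submodule ℝ (V x)}
  {F' : Type*} [NormedAddCommGroup F'] [NormedSpace ℝ F'] {V' : N → Type*}
  [∀ y, AddCommGroup (V' y)] [∀ y, Module ℝ (V' y)] [∀ y, TopologicalSpace (V' y)]
  [TopologicalSpace (TotalSpace F' V')] [FiberBundle F' V'] [VectorBundle ℝ F' V']
  {B : ∀ y : N, Submodule ℝ (V' y)}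

/-- `Φ : A → B`, covering the smooth map `φ : M → N`, is a Lie algebroid morphism: it is a smooth
bundle map between Lie algebroids, it commutes with the anchors, and whenever
`Φ ∘ s = ∑ f_i (σ_i ∘ φ)` and `Φ ∘ t = ∑ g_j (τ_j ∘ φ)` over an open set `U`, with `f_i, g_j`
smooth functions and `σ_i, τ_j ∈ Γ(B)`, then over `U`
`Φ ∘ [s, t] = ∑ f_i g_j ([σ_i, τ_j] ∘ φ) + ∑ ρ(s)(g_j) (τ_j ∘ φ) - ∑ ρ(t)(f_i) (σ_i ∘ φ)`. -/
structure IsLieAlgebroidMorphism (P : AlgebroidData I F A) (Q : AlgebroidData J F' B)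
    (φ : M → N) (Φ : ∀ x : M, A x →ₗ[ℝ] B (φ x)) : Prop where
  source : IsLieAlgebroid P
  target : IsLieAlgebroid Q
  base_smooth : ContMDiff I J ∞ φ
  smooth : ∀ s : smoothSections I F A, ContMDiff I (J.prod 𝓘(ℝ, F')) ∞
    (fun x => TotalSpace.mk' F' (φ x) (Φ x (secVal s x) : V' (φ x)))
  anchor : ∀ x a, Q.anchor (φ x) (Φ x a) = mfderiv I J φ x (P.anchor x a)
  bracket : ∀ (s t : smoothSections I F A) (U : Set M) (k l : ℕ)
    (f : Fin k → M → ℝ) (σ : Fin k → smoothSections J F' B)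
    (g : Fin l → M → ℝ) (τ : Fin l → smoothSections J F' B), IsOpen U →
    (∀ i, ContMDiffOn I 𝓘(ℝ, ℝ) ∞ (f i) U) → (∀ j, ContMDiffOn I 𝓘(ℝ, ℝ) ∞ (g j) U) →
    (∀ x ∈ U, Φ x (secVal s x) = ∑ i, f i x • secVal (σ i) (φ x)) →
    (∀ x ∈ U, Φ x (secVal t x) = ∑ j, g j x • secVal (τ j) (φ x)) →
    ∀ x ∈ U, Φ x (secVal (P.bracket s t) x) =
      ∑ i, ∑ j, (f i x * g j x) • secVal (Q.bracket (σ i) (τ j)) (φ x)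
      + ∑ j, P.act s (g j) x • secVal (τ j) (φ x)
      - ∑ i, P.act t (f i) x • secVal (σ i) (φ x)

/-- The pullback `Φ*α` of a one-form of `B` along a bundle map. -/
def pullbackForm (φ : M → N) (Φ : ∀ x : M, A x →ₗ[ℝ] B (φ x)) (α : ∀ y : N, B y →ₗ[ℝ] ℝ) (x : M) :
    A x →ₗ[ℝ] ℝ := (α (φ x)).comp (Φ x)

/-- The linear map `T` is the map `Φ* : H¹(B) → H¹(A)`, `[α] ↦ [Φ*α]`. -/
def IsCohomologyPullback (P : AlgebroidData I F A) (Q : AlgebroidData J F' B)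
    (φ : M → N) (Φ : ∀ x : M, A x →ₗ[ℝ] B (φ x)) (T : Q.H1 →ₗ[ℝ] P.H1) : Prop :=
  ∀ α : Q.closedForms, ∃ h : pullbackForm φ Φ α.1 ∈ P.closedForms,
    T (Q.classOf α) = P.classOf ⟨pullbackForm φ Φ α.1, h⟩

end Morphism

/-! ### The bundles `Γ^φ` and `R`

The graph of `φ` is identified with `M` through the diffeomorphism `x ↦ (x, φ x)`. Bundles over the
graph are bundles over `M`, and the tangent vector `(X, φ_* X)` of the graph is `X ∈ TM`. -/

/-- The vector bundle `φ^!(TN ⊕ T*N)` over `M`. -/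
abbrev GTanPull (φ : C^∞⟮I, M; J, N⟯) : M → Type _ := (φ : M → N) *ᵖ (GTan J (M := N))

instance GTanPull.instAddCommGroup (φ : C^∞⟮I, M; J, N⟯) (x : M) :
    AddCommGroup (GTanPull φ x) := inferInstanceAs (AddCommGroup (GTan J (φ x)))

/-- The fiber `(T_x M ⊕ T*_x M) × (T_{φ x} N ⊕ T*_{φ x} N)` over the graph of `φ`. -/
abbrev GTanGraph (φ : C^∞⟮I, M; J, N⟯) (x : M) : Type _ := GTan I x × GTanPull φ x

/-- The pullback `φ^*α` of a covector. -/
def coPull (φ : C^∞⟮I, M; J, N⟯) (x : M) (α : Cotan J (φ x)) : Cotan I x :=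
  α.comp (mfderiv I J φ x)

/-- `Γ^φ_x = {(v + φ^*α, φ_* v + α)}`. -/
def gammaGraph (φ : C^∞⟮I, M; J, N⟯) (x : M) : Submodule ℝ (GTanGraph φ x) where
  carrier := {p | ∃ (v : TangentSpace I x) (α : Cotan J (φ x)),
    p = ((v, coPull φ x α), ((mfderiv I J φ x v, α) : GTan J (φ x)))}
  add_mem' := by
    rintro _ _ ⟨v, α, rfl⟩ ⟨w, β, rfl⟩
    refine ⟨v + w, α + β, ?_⟩
    rw [map_add]
    rfl
  zero_mem' := by
    refine ⟨0, 0, ?_⟩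
    rw [map_zero]
    rfl
  smul_mem' := by
    rintro c _ ⟨v, α, rfl⟩
    refine ⟨c • v, c • α, ?_⟩
    rw [map_smul]
    rfl

/-- `R_x = {(X + φ^*α, φ_* X + α) : X + φ^*α ∈ L_x, φ_* X + α ∈ K_{φ x}}`. -/
def diracR (L : DiracStructure I M) (K : DiracStructure J N) (φ : C^∞⟮I, M; J, N⟯) (x : M) :
    Submodule ℝ (GTanGraph φ x) :=
  gammaGraph φ x ⊓ (L.fiber x).prod (K.fiber (φ x))

/-- The backward image of `K` at `x`. -/
def backwardImage (K : DiracStructure J N) (φ : C^∞⟮I, M; J, N⟯) (x : M) : Set (GTan I x) :=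
  {u | ∃ (X : TangentSpace I x) (α : Cotan J (φ x)),
    u = (X, coPull φ x α) ∧ ((mfderiv I J φ x X, α) : GTan J (φ x)) ∈ K.fiber (φ x)}

/-- The forward image of `L` at `x`. -/
def forwardImage (L : DiracStructure I M) (φ : C^∞⟮I, M; J, N⟯) (x : M) : Set (GTan J (φ x)) :=
  {w | ∃ (X : TangentSpace I x) (α : Cotan J (φ x)),
    w = (mfderiv I J φ x X, α) ∧ ((X, coPull φ x α) : GTan I x) ∈ L.fiber x}

/-- An admissible Dirac map: a backward or forward Dirac map for which `R` is a smooth vector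
bundle over the graph. -/
structure IsAdmissibleDiracMap (L : DiracStructure I M) (K : DiracStructure J N)
    (φ : C^∞⟮I, M; J, N⟯) : Prop where
  dirac : (∀ x, (L.fiber x : Set (GTan I x)) = backwardImage K φ x) ∨
    (∀ x, (K.fiber (φ x) : Set (GTan J (φ x))) = forwardImage L φ x)
  subbundle : IsSubbundle I (GModel E × GModel E') (diracR L K φ)

/-- The identification of `(TM ⊕ T*M)_x × (TN ⊕ T*N)_y` with `(T(M × N) ⊕ T*(M × N))_{(x, y)}`,
`(X + α, Y + β) ↦ (X, Y) + (α, -β)`. The sign is the one for which the image of `Γ^φ` is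
isotropic. -/
def toProdGTan {x : M} {y : N} (u : GTan I x) (w : GTan J y) :
    GTan (I.prod J) ((x, y) : M × N) :=
  (show TangentSpace (I.prod J) ((x, y) : M × N) from (u.1, w.1),
    u.2.comp (mfderiv (I.prod J) I Prod.fst ((x, y) : M × N))
      - w.2.comp (mfderiv (I.prod J) J Prod.snd ((x, y) : M × N)))

/-- `S` is a smooth section of the generalized tangent bundle of `M × N`. -/
def IsProdSection (S : ∀ p : M × N, GTan (I.prod J) p) : Prop :=
  ContMDiff (I.prod J) ((I.prod J).prod 𝓘(ℝ, GModel (E × E'))) ∞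
    (fun p => TotalSpace.mk' (GModel (E × E')) p (S p))

/-- `S` takes its values in the product Dirac structure `L × K` over `M × N`. -/
def InProdDirac (L : DiracStructure I M) (K : DiracStructure J N)
    (S : ∀ p : M × N, GTan (I.prod J) p) : Prop :=
  ∀ (x : M) (y : N), ∃ u ∈ L.fiber x, ∃ w ∈ K.fiber y, S (x, y) = toProdGTan u w

/-- `S` restricts over the graph of `φ` to the section `s`. -/
def RestrictsTo (φ : C^∞⟮I, M; J, N⟯) (S : ∀ p : M × N, GTan (I.prod J) p)
    (s : ∀ x : M, GTanGraph φ x) : Prop :=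
  ∀ x : M, S (x, φ x) = toProdGTan (s x).1 (s x).2

/-- `Γ^φ` is closed under the Courant bracket of `T(M × N) ⊕ T*(M × N)`: if two sections of the
latter restrict over the graph to sections of `Γ^φ`, then so does their bracket. -/
def GammaInvolutive (φ : C^∞⟮I, M; J, N⟯) : Prop :=
  ∀ S₁ S₂ : ∀ p : M × N, GTan (I.prod J) p, IsProdSection S₁ → IsProdSection S₂ →
    (∃ s₁ : ∀ x, GTanGraph φ x, (∀ x, s₁ x ∈ gammaGraph φ x) ∧ RestrictsTo φ S₁ s₁) →
    (∃ s₂ : ∀ x, GTanGraph φ x, (∀ x, s₂ x ∈ gammaGraph φ x) ∧ RestrictsTo φ S₂ s₂) →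
    ∃ s : ∀ x, GTanGraph φ x, (∀ x, s x ∈ gammaGraph φ x) ∧
      RestrictsTo φ (courantBracket (I.prod J) S₁ S₂) s

/-- The anchor and bracket on `R` are those induced from `Γ^φ`: the anchor is
`(X + φ^*α, φ_* X + α) ↦ (X, φ_* X)`, and the bracket is the restriction to the graph of the Courant
bracket on `M × N` of extensions to sections of `L × K`. -/
structure IsInducedOnR (L : DiracStructure I M) (K : DiracStructure J N) (φ : C^∞⟮I, M; J, N⟯)
    (P : AlgebroidData I (GModel E × GModel E') (diracR L K φ)) : Prop where
  anchor : ∀ x (a : diracR L K φ x), P.anchor x a = a.1.1.1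
  bracket : ∀ (s t : smoothSections I (GModel E × GModel E') (diracR L K φ))
    (S T : ∀ p : M × N, GTan (I.prod J) p), IsProdSection S → IsProdSection T →
    InProdDirac L K S → InProdDirac L K T → RestrictsTo φ S s.1 → RestrictsTo φ T t.1 →
    RestrictsTo φ (courantBracket (I.prod J) S T) (P.bracket s t).1

/-- The projection `i : R → L`, covering the identity of `M` (the projection of the graph). -/
def projL (L : DiracStructure I M) (K : DiracStructure J N) (φ : C^∞⟮I, M; J, N⟯) (x : M) :
    diracR L K φ x →ₗ[ℝ] L.fiber (id x) where
  toFun := fun a => ⟨a.1.1, a.2.2.1⟩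
  map_add' := fun _ _ => rfl
  map_smul' := fun _ _ => rfl

/-- The projection `j : R → K`, covering `φ`. -/
def projK (L : DiracStructure I M) (K : DiracStructure J N) (φ : C^∞⟮I, M; J, N⟯) (x : M) :
    diracR L K φ x →ₗ[ℝ] K.fiber (φ x) where
  toFun := fun a => ⟨a.1.2, a.2.2.2⟩
  map_add' := fun _ _ => rfl
  map_smul' := fun _ _ => rfl

/-- `c ∈ H¹(R)` is the modular class `i^* mod L - j^* mod K` of the Dirac map. -/
def IsModularClassOfDiracMap (L : DiracStructure I M) (K : DiracStructure J N)
    (φ : C^∞⟮I, M; J, N⟯) (P : AlgebroidData I (GModel E × GModel E') (diracR L K φ))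
    (c : P.H1) : Prop :=
  ∃ (iT : L.algebroid.H1 →ₗ[ℝ] P.H1) (jT : K.algebroid.H1 →ₗ[ℝ] P.H1)
    (cL : L.algebroid.H1) (cK : K.algebroid.H1),
    IsCohomologyPullback P L.algebroid id (projL L K φ) iT ∧
    IsCohomologyPullback P K.algebroid φ (projK L K φ) jT ∧
    L.algebroid.IsModularClass (Module.finrank ℝ E) cL ∧
    K.algebroid.IsModularClass (Module.finrank ℝ E') cK ∧
    c = iT cL - jT cK

end TwoManifolds

end

/-! Under the identification of `𝕋M × 𝕋N` with `𝕋(M × N)`, which reverses the pairing on the second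
factor, two bundles meet over the graph of `φ`. The first is `Γ^φ`: it becomes the tangent bundle of
the graph plus its annihilator (`graphTangent_iff`). Vector fields tangent to the graph have tangent
brackets, and Lie derivatives along them preserve one-forms that pull back to zero on the graph, so
`Γ^φ` is involutive (`GraphTangent.courantBracket`). The second is the product Dirac structure `L ×
K` (`DiracStructure.prod`). The bracket of two sections of `L × K` that restrict to sections of `R`
therefore restricts to a section of the intersection, which is `R`.

The result depends on the restrictions only. A section of `L × K` that vanishes on the graph has
frame coefficients vanishing there; in the Leibniz rule these are either evaluated at a point of the
graph or differentiated along a tangent direction, and both give zero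
(`courantBracket_eq_zero_of_graph`). Extensions exist by a partition of unity (`exists_extension`).
The axioms for `R` are then those of `L × K` read on the graph. For a Dirac structure the one hard
axiom is Jacobi: the cotangent part of the Jacobiator is the differential of a function that
isotropy makes zero (`courantBracket_jacobi`).

The projections of `R` are morphisms because every section of `R` is locally a combination, with
coefficients from `M`, of sections `(σ, 0)` and `(0, τ)` of the product, and brackets of those are
componentwise (`graphAlgebroid_bracket_expand`). A morphism pulls closed forms back to closed forms
and exact ones to exact ones, which gives the maps on `H¹`.

For the modular class, a local frame of `L_A` turns the flat connection into a local form: the trace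
of `[s, ·]` on `A` plus the trace of the Lie derivative on `T*M`. It is linear over functions in `s`
(`IsLieAlgebroid.connForm_eq_zero`), closed (`IsLieAlgebroid.connForm_bracket`), and changes with
the frame by the logarithmic derivative of a determinant (`IsLieAlgebroid.connForm_change`).
Averaging logarithms of absolute values of these determinants by a partition of unity gives a global
nowhere vanishing section of `L_A ⊗ L_A` and a closed form. Two such sections differ by a nowhere
zero function `G`, and their forms differ by the differential of `½ log |G|`.

All the calculus rests on the formula `(L_X β)(Z) = X(β(Z)) - β([X, Z])` (`lieDerivForm_apply`),
which frees the Lie derivative from the chart used to define it. -/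

open Filter Topology

noncomputable section

set_option linter.unusedSectionVars false

/-! ### Calculus of vector fields and one-forms: chart expressions. -/

section Calculus

variable {E : Type*} [NormedAddCommGroup E] [NormedSpace ℝ E]
  {H : Type*} [TopologicalSpace H] {I : ModelWithCorners ℝ E H}
  {M : Type*} [TopologicalSpace M] [ChartedSpace H M] [IsManifold I ∞ M]

/-! ### Smooth vector fields and one-forms in coordinates -/

variable (I) in
/-- The vector field `X` is smooth at `x`. -/
abbrev SmoothVFAt (X : ∀ x : M, TangentSpace I x) (x : M) : Prop :=
  ContMDiffAt I (I.prod 𝓘(ℝ, E)) ∞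
    (fun y => TotalSpace.mk' E (E := fun x : M => TangentSpace I x) y (X y)) x

variable (I) in
/-- The one-form `β` is smooth at `x`. -/
abbrev SmoothFormAt (β : ∀ x : M, Cotan I x) (x : M) : Prop :=
  ContMDiffAt I (I.prod 𝓘(ℝ, E →L[ℝ] ℝ)) ∞
    (fun y => TotalSpace.mk' (E →L[ℝ] ℝ) (E := fun x : M => Cotan I x) y (β y)) x

variable (I) in
/-- The section `s` of the generalized tangent bundle is smooth at `x`. -/
abbrev SmoothGenAt (s : ∀ x : M, GTan I x) (x : M) : Prop :=
  ContMDiffAt I (I.prod 𝓘(ℝ, GModel E)) ∞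
    (fun y => TotalSpace.mk' (GModel E) (E := fun x : M => GTan I x) y (s y)) x

/-- The components of a vector field in the preferred chart at `x₀`. -/
def vecCoord (x₀ : M) (X : ∀ x : M, TangentSpace I x) (y : M) : E :=
  (trivializationAt E (TangentSpace I) x₀).continuousLinearMapAt ℝ y (X y)

/-- The components of a one-form in the preferred chart at `x₀`. -/
def formCoord (x₀ : M) (β : ∀ x : M, Cotan I x) (y : M) : E →L[ℝ] ℝ :=
  (β y).comp ((trivializationAt E (TangentSpace I) x₀).symmL ℝ y)

theorem eventually_mem_chart (x₀ : M) : ∀ᶠ y in 𝓝 x₀, y ∈ (chartAt H x₀).source :=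
  (chartAt H x₀).open_source.mem_nhds (mem_chart_source H x₀)

theorem smoothVFAt_iff {X : ∀ x : M, TangentSpace I x} {x₀ : M} :
    SmoothVFAt I X x₀ ↔ ContMDiffAt I 𝓘(ℝ, E) ∞ (vecCoord x₀ X) x₀ := by
  rw [SmoothVFAt, contMDiffAt_totalSpace]
  refine ⟨fun h => h.2.congr_of_eventuallyEq ?_,
    fun h => ⟨contMDiffAt_id, h.congr_of_eventuallyEq ?_⟩⟩ <;>
  · filter_upwards [eventually_mem_chart (H := H) x₀] with y hy
    simp [vecCoord, Trivialization.continuousLinearMapAt_apply, Trivialization.linearMapAt_apply, hy]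

theorem smoothFormAt_iff {β : ∀ x : M, Cotan I x} {x₀ : M} :
    SmoothFormAt I β x₀ ↔ ContMDiffAt I 𝓘(ℝ, E →L[ℝ] ℝ) ∞ (formCoord x₀ β) x₀ := by
  rw [SmoothFormAt, contMDiffAt_hom_bundle]
  refine ⟨fun h => h.2.congr_of_eventuallyEq ?_,
    fun h => ⟨contMDiffAt_id, h.congr_of_eventuallyEq ?_⟩⟩ <;>
  · filter_upwards [eventually_mem_chart (H := H) x₀] with y hy
    ext v
    simp [formCoord, ContinuousLinearMap.inCoordinates]

/-- The tangent space at `x₀` is the model space by way of the preferred chart at `x₀`, so the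
derivative of that chart at `x₀` is the identity. -/
theorem vecCoord_self (x₀ : M) (X : ∀ x : M, TangentSpace I x) : vecCoord x₀ X x₀ = X x₀ := by
  rw [vecCoord, TangentBundle.continuousLinearMapAt_trivializationAt (mem_chart_source H x₀),
    mfderiv_extChartAt_self]
  rfl

theorem symmL_self (x₀ : M) (v : E) :
    (trivializationAt E (TangentSpace I) x₀).symmL ℝ x₀ v = (v : TangentSpace I x₀) := by
  rw [TangentBundle.symmL_trivializationAt (mem_chart_source H x₀),
    mfderivWithin_range_extChartAt_symm]
  rfl

theorem formCoord_self (x₀ : M) (β : ∀ x : M, Cotan I x) : formCoord x₀ β x₀ = β x₀ := by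
  ext v
  exact congrArg (β x₀) (symmL_self x₀ v)

theorem symmL_vecCoord {x₀ y : M} (hy : y ∈ (chartAt H x₀).source)
    (X : ∀ x : M, TangentSpace I x) :
    (trivializationAt E (TangentSpace I) x₀).symmL ℝ y (vecCoord x₀ X y) = X y :=
  Trivialization.symmL_continuousLinearMapAt _ (by simpa using hy) _

theorem formCoord_vecCoord {x₀ y : M} (hy : y ∈ (chartAt H x₀).source)
    (β : ∀ x : M, Cotan I x) (X : ∀ x : M, TangentSpace I x) :
    formCoord x₀ β y (vecCoord x₀ X y) = β y (X y) :=
  congrArg (β y) (symmL_vecCoord hy X)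

theorem SmoothVFAt.congr {X X' : ∀ x : M, TangentSpace I x} {x₀ : M} (h : SmoothVFAt I X x₀)
    (h' : ∀ᶠ y in 𝓝 x₀, X' y = X y) : SmoothVFAt I X' x₀ :=
  ContMDiffAt.congr_of_eventuallyEq h (h'.mono fun y hy => by simp only [hy])

theorem SmoothFormAt.congr {X X' : ∀ x : M, Cotan I x} {x₀ : M} (h : SmoothFormAt I X x₀)
    (h' : ∀ᶠ y in 𝓝 x₀, X' y = X y) : SmoothFormAt I X' x₀ :=
  ContMDiffAt.congr_of_eventuallyEq h (h'.mono fun y hy => by simp only [hy])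

theorem SmoothFormAt.apply {β : ∀ x : M, Cotan I x} {X : ∀ x : M, TangentSpace I x} {x₀ : M}
    (hβ : SmoothFormAt I β x₀) (hX : SmoothVFAt I X x₀) :
    ContMDiffAt I 𝓘(ℝ, ℝ) ∞ (fun y => β y (X y)) x₀ := by
  refine ((smoothFormAt_iff.1 hβ).clm_apply (smoothVFAt_iff.1 hX)).congr_of_eventuallyEq ?_
  filter_upwards [eventually_mem_chart (H := H) x₀] with y hy
  exact (formCoord_vecCoord hy β X).symm

/-- The vector field with constant components in the preferred chart at `x₀`. -/
def coordVF (x₀ : M) (v : E) (y : M) : TangentSpace I y :=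
  (trivializationAt E (TangentSpace I) x₀).symmL ℝ y v

theorem vecCoord_coordVF {x₀ y : M} (hy : y ∈ (chartAt H x₀).source) (v : E) :
    vecCoord (I := I) x₀ (coordVF x₀ v) y = v :=
  Trivialization.continuousLinearMapAt_symmL _ (by simpa using hy) _

theorem smoothVFAt_coordVF {x₀ y : M} (hy : y ∈ (chartAt H x₀).source) (v : E) :
    SmoothVFAt I (coordVF x₀ v) y := by
  have hs := (trivializationAt E (TangentSpace I : M → Type _) x₀).contMDiffAt_section_iff
    (IB := I) (n := ∞) (s := coordVF x₀ v) (x₀ := y) (by simpa using hy)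
  refine hs.2 ((contMDiffAt_const (c := v)).congr_of_eventuallyEq ?_)
  filter_upwards [(chartAt H x₀).open_source.mem_nhds hy] with z hz
  have := vecCoord_coordVF (I := I) hz v
  simpa [vecCoord, Trivialization.continuousLinearMapAt_apply, Trivialization.linearMapAt_apply, hz]
    using this

theorem coordVF_self (x₀ : M) (v : E) : coordVF (I := I) x₀ (v : E) x₀ = v :=
  symmL_self x₀ v

/-! ### Lie brackets and Lie derivatives in coordinates -/

theorem mdiffAt_of_smooth {F : Type*} [NormedAddCommGroup F] [NormedSpace ℝ F] {f : M → F} {x : M}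
    (hf : ContMDiffAt I 𝓘(ℝ, F) ∞ f x) : MDifferentiableAt I 𝓘(ℝ, F) f x :=
  hf.mdifferentiableAt (by simp)

theorem SmoothVFAt.mdiffAt {X : ∀ x : M, TangentSpace I x} {x : M} (hX : SmoothVFAt I X x) :
    MDifferentiableAt I (I.prod 𝓘(ℝ, E))
      (fun y => TotalSpace.mk' E (E := fun x : M => TangentSpace I x) y (X y)) x :=
  ContMDiffAt.mdifferentiableAt hX (by simp)

/-- Links the chart pullback used by `mlieBracket` and `lieDerivForm` with components in the tangent
bundle trivialization: both apply the derivative of the chart, since it inverts the derivative of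
the inverse chart. -/
theorem vecCoord_comp_symm (x₀ : M) (X : ∀ x : M, TangentSpace I x) {z : E}
    (hz : z ∈ (extChartAt I x₀).target) :
    mpullbackWithin 𝓘(ℝ, E) I (extChartAt I x₀).symm X (Set.range I) z
      = vecCoord x₀ X ((extChartAt I x₀).symm z) := by
  have hy : (extChartAt I x₀).symm z ∈ (chartAt H x₀).source := by
    simpa using (extChartAt I x₀).map_target hz
  have h1 : (mfderivWithin 𝓘(ℝ, E) I (extChartAt I x₀).symm (Set.range I) z).inverse =
      mfderiv I 𝓘(ℝ, E) (extChartAt I x₀) ((extChartAt I x₀).symm z) :=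
    ContinuousLinearMap.inverse_eq (mfderivWithin_extChartAt_symm_comp_mfderiv_extChartAt hz)
      (mfderiv_extChartAt_comp_mfderivWithin_extChartAt_symm hz)
  rw [mpullbackWithin_apply, h1, vecCoord,
    TangentBundle.continuousLinearMapAt_trivializationAt hy]
  rfl

theorem formCoord_comp_symm (x₀ : M) (β : ∀ x : M, Cotan I x) {z : E}
    (hz : z ∈ (extChartAt I x₀).target) :
    (β ((extChartAt I x₀).symm z)).comp
        (mfderivWithin 𝓘(ℝ, E) I (extChartAt I x₀).symm (Set.range I) z)
      = formCoord x₀ β ((extChartAt I x₀).symm z) := by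
  have hy : (extChartAt I x₀).symm z ∈ (chartAt H x₀).source := by
    simpa using (extChartAt I x₀).map_target hz
  have h2 := TangentBundle.symmL_trivializationAt (I := I) (𝕜 := ℝ) hy
  rw [(extChartAt I x₀).right_inv hz] at h2
  rw [formCoord, h2]
  rfl

theorem fderivWithin_comp_symm {F : Type*} [NormedAddCommGroup F] [NormedSpace ℝ F] {x₀ : M}
    {f : M → F} {g : E → F} (hf : ContMDiffAt I 𝓘(ℝ, F) ∞ f x₀)
    (h : ∀ z ∈ (extChartAt I x₀).target, g z = f ((extChartAt I x₀).symm z)) :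
    fderivWithin ℝ g (Set.range I) (extChartAt I x₀ x₀) = mvfderiv I f x₀ := by
  rw [(mdiffAt_of_smooth hf).mvfderiv]
  refine Filter.EventuallyEq.fderivWithin_eq ?_ ?_
  · filter_upwards [extChartAt_target_mem_nhdsWithin (I := I) x₀] with z hz
    rw [h z hz]
    rfl
  · rw [h _ (mem_extChartAt_target x₀)]
    rfl

/-- At the base point of its preferred chart the outer derivative in the definition of the bracket
is the identity, so only the Euclidean bracket of the components remains. -/
theorem mlieBracket_eq_coord {X Y : ∀ x : M, TangentSpace I x} {x₀ : M} (hX : SmoothVFAt I X x₀)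
    (hY : SmoothVFAt I Y x₀) :
    mlieBracket I X Y x₀
      = (mvfderiv I (vecCoord x₀ Y) x₀ (X x₀) - mvfderiv I (vecCoord x₀ X) x₀ (Y x₀) : E) := by
  have e1 : ∀ Z : ∀ x : M, TangentSpace I x,
      mpullbackWithin 𝓘(ℝ, E) I (extChartAt I x₀).symm Z (Set.range I) (extChartAt I x₀ x₀)
        = Z x₀ := fun Z => by
    rw [vecCoord_comp_symm x₀ Z (mem_extChartAt_target x₀), extChartAt_to_inv]
    exact vecCoord_self x₀ Z
  have h0 : (mfderiv I 𝓘(ℝ, E) (extChartAt I x₀) x₀).inverse = ContinuousLinearMap.id ℝ E := by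
    rw [mfderiv_extChartAt_self]
    exact ContinuousLinearMap.inverse_id
  rw [← mlieBracketWithin_univ, mlieBracketWithin_apply]
  refine (congrArg (fun T : E →L[ℝ] E => T _) h0).trans ?_
  have h1 : ∀ (A B : E → E) (s : Set E) (z : E),
      ContinuousLinearMap.id ℝ E (lieBracketWithin ℝ A B s z)
        = fderivWithin ℝ B s z (A z) - fderivWithin ℝ A s z (B z) := fun _ _ _ _ => rfl
  refine (h1 _ _ _ _).trans ?_
  rw [Set.preimage_univ, Set.univ_inter]
  have hx := fderivWithin_comp_symm (smoothVFAt_iff.1 hX) fun z hz => vecCoord_comp_symm x₀ X hz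
  have hy := fderivWithin_comp_symm (smoothVFAt_iff.1 hY) fun z hz => vecCoord_comp_symm x₀ Y hz
  erw [hx, hy, e1 X, e1 Y]
  rfl

theorem lieDerivForm_eq_coord {X : ∀ x : M, TangentSpace I x} {β : ∀ x : M, Cotan I x} {x₀ : M}
    (hX : SmoothVFAt I X x₀) (hβ : SmoothFormAt I β x₀) (v : TangentSpace I x₀) :
    lieDerivForm I X β x₀ v
      = mvfderiv I (formCoord x₀ β) x₀ (X x₀) v
        + (β x₀ : E →L[ℝ] ℝ) (mvfderiv I (vecCoord x₀ X) x₀ v) := by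
  have e1 : mpullbackWithin 𝓘(ℝ, E) I (extChartAt I x₀).symm X (Set.range I) (extChartAt I x₀ x₀)
        = X x₀ := by
    rw [vecCoord_comp_symm x₀ X (mem_extChartAt_target x₀), extChartAt_to_inv]
    exact vecCoord_self x₀ X
  have e2 : (β ((extChartAt I x₀).symm (extChartAt I x₀ x₀))).comp
      (mfderivWithin 𝓘(ℝ, E) I (extChartAt I x₀).symm (Set.range I) (extChartAt I x₀ x₀))
        = (β x₀ : E →L[ℝ] ℝ) := by
    rw [formCoord_comp_symm x₀ β (mem_extChartAt_target x₀), extChartAt_to_inv]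
    exact formCoord_self x₀ β
  have hx := fderivWithin_comp_symm (smoothVFAt_iff.1 hX) fun z hz => vecCoord_comp_symm x₀ X hz
  have hb := fderivWithin_comp_symm (smoothFormAt_iff.1 hβ) fun z hz => formCoord_comp_symm x₀ β hz
  simp only [lieDerivForm]
  rw [mfderiv_extChartAt_self]
  erw [hx, hb, e1, e2]
  rfl

end Calculus

/-! ### Chart-free formulas for Lie derivatives, and smoothness of brackets. -/

section Calculus

variable {E : Type*} [NormedAddCommGroup E] [NormedSpace ℝ E]
  {H : Type*} [TopologicalSpace H] {I : ModelWithCorners ℝ E H}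
  {M : Type*} [TopologicalSpace M] [ChartedSpace H M] [IsManifold I ∞ M]

theorem mvfderiv_congr {F : Type*} [NormedAddCommGroup F] [NormedSpace ℝ F] {f g : M → F} {x : M}
    (h : ∀ᶠ y in 𝓝 x, f y = g y) : mvfderiv I f x = mvfderiv I g x := by
  have h1 : mfderiv I 𝓘(ℝ, F) f x = mfderiv I 𝓘(ℝ, F) g x := EventuallyEq.mfderiv_eq h
  ext v
  exact congrArg (fun T : E →L[ℝ] F => T v) h1

theorem mvfderiv_clm_apply {F F' : Type*} [NormedAddCommGroup F] [NormedSpace ℝ F]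
    [NormedAddCommGroup F'] [NormedSpace ℝ F'] {g : M → F →L[ℝ] F'} {f : M → F} {x : M}
    (hg : ContMDiffAt I 𝓘(ℝ, F →L[ℝ] F') ∞ g x) (hf : ContMDiffAt I 𝓘(ℝ, F) ∞ f x)
    (v : TangentSpace I x) :
    mvfderiv I (fun y => g y (f y)) x v = mvfderiv I g x v (f x) + g x (mvfderiv I f x v) := by
  have hgf : MDifferentiableAt I 𝓘(ℝ, F') (fun y => g y (f y)) x :=
    (mdiffAt_of_smooth hg).clm_apply (mdiffAt_of_smooth hf)
  have hg' := (mdiffAt_of_smooth hg).differentiableWithinAt_writtenInExtChartAt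
  have hf' := (mdiffAt_of_smooth hf).differentiableWithinAt_writtenInExtChartAt
  rw [hgf.mvfderiv, (mdiffAt_of_smooth hg).mvfderiv, (mdiffAt_of_smooth hf).mvfderiv]
  have key := fderivWithin_clm_apply (I.uniqueDiffOn _ (Set.mem_range_self (chartAt H x x)))
    hg' hf'
  have hx : (extChartAt I x).symm (extChartAt I x x) = x := extChartAt_to_inv x
  have key2 := congrArg (fun T : E →L[ℝ] F' => T v) key
  refine key2.trans ?_
  simp only [writtenInExtChartAt, extChartAt_model_space_eq_id, PartialEquiv.refl_coe,
    Function.comp, id]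
  erw [hx]
  exact add_comm _ _

theorem mvfderiv_form_apply {β : ∀ x : M, Cotan I x} {Z : ∀ x : M, TangentSpace I x} {x : M}
    (hβ : SmoothFormAt I β x) (hZ : SmoothVFAt I Z x) (v : TangentSpace I x) :
    mvfderiv I (fun y => β y (Z y)) x v
      = mvfderiv I (formCoord x β) x v (Z x)
        + (β x : E →L[ℝ] ℝ) (mvfderiv I (vecCoord x Z) x v) := by
  have h1 : ∀ᶠ y in 𝓝 x, β y (Z y) = formCoord x β y (vecCoord x Z y) := by
    filter_upwards [eventually_mem_chart (H := H) x] with y hy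
    exact (formCoord_vecCoord hy β Z).symm
  rw [mvfderiv_congr h1, mvfderiv_clm_apply (smoothFormAt_iff.1 hβ) (smoothVFAt_iff.1 hZ) v,
    vecCoord_self, formCoord_self]
  rfl

/-- `(L_X β)(Z) = X(β(Z)) - β([X, Z])`. -/
theorem lieDerivForm_apply {X Z : ∀ x : M, TangentSpace I x} {β : ∀ x : M, Cotan I x} {x : M}
    (hX : SmoothVFAt I X x) (hβ : SmoothFormAt I β x) (hZ : SmoothVFAt I Z x) :
    lieDerivForm I X β x (Z x)
      = mvfderiv I (fun y => β y (Z y)) x (X x) - β x (mlieBracket I X Z x) := by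
  rw [lieDerivForm_eq_coord hX hβ, mvfderiv_form_apply hβ hZ, mlieBracket_eq_coord hX hZ]
  have := (β x : E →L[ℝ] ℝ).map_sub (mvfderiv I (vecCoord x Z) x (X x))
    (mvfderiv I (vecCoord x X) x (Z x))
  erw [this]
  ring

section Boundaryless

variable [I.Boundaryless]

/-- Expresses the components of `df` as an ordinary derivative at all points near `x₀`, so that both
the smoothness of `df` and the symmetry of second derivatives can be taken from Euclidean calculus.
-/
theorem formCoord_mvfderiv {f : M → ℝ} {x₀ : M} (hf : ContMDiffAt I 𝓘(ℝ, ℝ) ∞ f x₀) :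
    ∀ᶠ y in 𝓝 x₀, formCoord x₀ (mvfderiv I f) y
      = fderiv ℝ (f ∘ (extChartAt I x₀).symm) (extChartAt I x₀ y) := by
  -- Smoothness of order `∞` at one point need not spread to a neighbourhood, but smoothness of
  -- order one does.
  have hf1 : ∀ᶠ y in 𝓝 x₀, MDifferentiableAt I 𝓘(ℝ, ℝ) f y := by
    have h1 : ContMDiffAt I 𝓘(ℝ, ℝ) 1 f x₀ := ContMDiffAt.of_le hf (by simp)
    have := (contMDiffAt_iff_contMDiffAt_nhds (by simp)).1 h1
    exact this.mono fun y hy => hy.mdifferentiableAt (by simp)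
  filter_upwards [eventually_mem_chart (H := H) x₀, hf1] with y hy hfy
  have hy' : y ∈ (extChartAt I x₀).source := by simpa using hy
  have hz := (extChartAt I x₀).map_source hy'
  have hinv := (extChartAt I x₀).left_inv hy'
  have hsymm : MDifferentiableAt 𝓘(ℝ, E) I (extChartAt I x₀).symm (extChartAt I x₀ y) := by
    have := mdifferentiableWithinAt_extChartAt_symm (I := I) hz
    rwa [I.range_eq_univ, mdifferentiableWithinAt_univ] at this
  have h2 := TangentBundle.symmL_trivializationAt (I := I) (𝕜 := ℝ) hy
  rw [I.range_eq_univ, mfderivWithin_univ] at h2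
  have h3 := mfderiv_comp_of_eq (I := 𝓘(ℝ, E)) (I' := I) (I'' := 𝓘(ℝ, ℝ))
    (x := extChartAt I x₀ y) (f := (extChartAt I x₀).symm) (g := f) hfy hsymm hinv
  rw [mfderiv_eq_fderiv] at h3
  rw [formCoord, h2, h3]
  have : ∀ y' (h : y' = y), (mvfderiv I f y : E →L[ℝ] ℝ) = mfderiv I 𝓘(ℝ, ℝ) f y' := by
    rintro _ rfl; rfl
  erw [this _ hinv]
  rfl

theorem contDiffAt_comp_symm {F : Type*} [NormedAddCommGroup F] [NormedSpace ℝ F] {f : M → F}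
    {x₀ : M} (hf : ContMDiffAt I 𝓘(ℝ, F) ∞ f x₀) :
    ContDiffAt ℝ ∞ (f ∘ (extChartAt I x₀).symm) (extChartAt I x₀ x₀) := by
  have := (contMDiffAt_iff.1 hf).2
  rw [I.range_eq_univ, contDiffWithinAt_univ] at this
  exact this

/-- The differential of a smooth function is a smooth one-form. -/
theorem smoothFormAt_mvfderiv {f : M → ℝ} {x : M} (hf : ContMDiffAt I 𝓘(ℝ, ℝ) ∞ f x) :
    SmoothFormAt I (mvfderiv I f) x := by
  rw [smoothFormAt_iff]
  refine ContMDiffAt.congr_of_eventuallyEq ?_ (formCoord_mvfderiv hf)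
  have h1 : ContDiffAt ℝ ∞ (fderiv ℝ (f ∘ (extChartAt I x).symm)) (extChartAt I x x) :=
    (contDiffAt_comp_symm hf).fderiv_right (by simp)
  exact h1.contMDiffAt.comp x contMDiffAt_extChartAt

/-- This is `d(df) = 0` at the base point of the chart: the components of `df` are first
derivatives, and second derivatives commute. -/
theorem mvfderiv_formCoord_symm {f : M → ℝ} {x : M} (hf : ContMDiffAt I 𝓘(ℝ, ℝ) ∞ f x)
    (v w : TangentSpace I x) :
    mvfderiv I (formCoord x (mvfderiv I f)) x v w
      = mvfderiv I (formCoord x (mvfderiv I f)) x w v := by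
  have h0 := smoothFormAt_iff.1 (smoothFormAt_mvfderiv hf)
  have h1 : mvfderiv I (formCoord x (mvfderiv I f)) x
      = fderiv ℝ (fderiv ℝ (f ∘ (extChartAt I x).symm)) (extChartAt I x x) := by
    rw [mvfderiv_congr (formCoord_mvfderiv hf)]
    have h2 : ContMDiffAt I 𝓘(ℝ, E →L[ℝ] ℝ) ∞
        (fun y => fderiv ℝ (f ∘ (extChartAt I x).symm) (extChartAt I x y)) x :=
      h0.congr_of_eventuallyEq ((formCoord_mvfderiv hf).mono fun y hy => hy.symm)
    have h3 := fderivWithin_comp_symm (I := I) (x₀ := x)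
      (g := fderiv ℝ (f ∘ (extChartAt I x).symm)) h2
      (fun z hz => by rw [(extChartAt I x).right_inv hz])
    rw [I.range_eq_univ, fderivWithin_univ] at h3
    exact h3.symm
  have h4 : IsSymmSndFDerivAt ℝ (f ∘ (extChartAt I x).symm) (extChartAt I x x) :=
    (contDiffAt_comp_symm hf).isSymmSndFDerivAt (by simpa using ENat.LEInfty.out)
  rw [h1]
  exact h4 v w

/-- `[X, Y](f) = X(Y(f)) - Y(X(f))`. -/
theorem mvfderiv_mlieBracket {X Y : ∀ x : M, TangentSpace I x} {f : M → ℝ} {x : M}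
    (hX : SmoothVFAt I X x) (hY : SmoothVFAt I Y x) (hf : ContMDiffAt I 𝓘(ℝ, ℝ) ∞ f x) :
    mvfderiv I f x (mlieBracket I X Y x)
      = mvfderiv I (fun y => mvfderiv I f y (Y y)) x (X x)
        - mvfderiv I (fun y => mvfderiv I f y (X y)) x (Y x) := by
  have hd := smoothFormAt_mvfderiv hf
  rw [mvfderiv_form_apply hd hY, mvfderiv_form_apply hd hX, mlieBracket_eq_coord hX hY,
    mvfderiv_formCoord_symm hf (Y x) (X x)]
  have := (mvfderiv I f x : E →L[ℝ] ℝ).map_sub (mvfderiv I (vecCoord x Y) x (X x))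
    (mvfderiv I (vecCoord x X) x (Y x))
  erw [this]
  ring

/-- The derivative of a smooth function along a smooth vector field is smooth. -/
theorem contMDiffAt_mvfderiv_apply {X : ∀ x : M, TangentSpace I x} {f : M → ℝ} {x : M}
    (hX : SmoothVFAt I X x) (hf : ContMDiffAt I 𝓘(ℝ, ℝ) ∞ f x) :
    ContMDiffAt I 𝓘(ℝ, ℝ) ∞ (fun y => mvfderiv I f y (X y)) x :=
  (smoothFormAt_mvfderiv hf).apply hX

variable [FiniteDimensional ℝ E]

theorem SmoothVFAt.mlieBracket {X Y : ∀ x : M, TangentSpace I x} {x : M} (hX : SmoothVFAt I X x)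
    (hY : SmoothVFAt I Y x) : SmoothVFAt I (mlieBracket I X Y) x := by
  have := FiniteDimensional.complete ℝ E
  have : IsManifold I (((⊤ : ℕ∞) : ℕ∞ω) + 1) M := ‹IsManifold I ∞ M›
  have : IsManifold I (minSmoothness ℝ 2) M := by
    rw [minSmoothness_of_isRCLikeNormedField]; infer_instance
  exact ContMDiffAt.mlieBracket_vectorField (m := ⊤) (n := ⊤) hX hY (by simp)

/-- The definition uses a different chart at each point, so smoothness is not visible in it. The
invariant formula `lieDerivForm_apply`, evaluated on the coordinate fields of one fixed chart, gives
components that are smooth. -/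
theorem SmoothFormAt.lieDerivForm {X : ∀ x : M, TangentSpace I x} {β : ∀ x : M, Cotan I x} {x : M}
    (hX : ∀ᶠ y in 𝓝 x, SmoothVFAt I X y) (hβ : ∀ᶠ y in 𝓝 x, SmoothFormAt I β y) :
    SmoothFormAt I (lieDerivForm I X β) x := by
  refine smoothFormAt_iff.2 ?_
  let b := Module.finBasis ℝ E
  have h1 : formCoord x (_root_.lieDerivForm I X β) =ᶠ[𝓝 x] fun y => ∑ i,
      (mvfderiv I (fun y => β y (coordVF x (b i) y)) y (X y)
        - β y (_root_.VectorField.mlieBracket I X (coordVF x (b i)) y)) •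
      LinearMap.toContinuousLinearMap (b.coord i) := by
    filter_upwards [hX, hβ, eventually_mem_chart (H := H) x] with y hXy hβy hy
    ext v
    have : v = ∑ i, b.repr v i • b i := (b.sum_repr v).symm
    conv_lhs => rw [this]
    simp only [map_sum, map_smul, sum_apply, smul_eq_mul]
    refine Finset.sum_congr rfl fun i _ => ?_
    rw [← lieDerivForm_apply hXy hβy (smoothVFAt_coordVF hy (b i))]
    exact mul_comm _ _
  refine ContMDiffAt.congr_of_eventuallyEq ?_ h1
  refine ContMDiffAt.sum fun i _ => ?_
  have hb := smoothVFAt_coordVF (I := I) (mem_chart_source H x) (b i)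
  have hX' := hX.self_of_nhds
  have hβ' := hβ.self_of_nhds
  exact ((contMDiffAt_mvfderiv_apply hX' (hβ'.apply hb)).sub
    (hβ'.apply (hX'.mlieBracket hb))).smul contMDiffAt_const

end Boundaryless

end Calculus

section Calculus

variable {E : Type*} [NormedAddCommGroup E] [NormedSpace ℝ E] [FiniteDimensional ℝ E]
  {H : Type*} [TopologicalSpace H] {I : ModelWithCorners ℝ E H} [I.Boundaryless]
  {M : Type*} [TopologicalSpace M] [ChartedSpace H M] [IsManifold I ∞ M]

/-! ### Algebra of smooth vector fields and forms -/

theorem SmoothVFAt.add {X Y : ∀ x : M, TangentSpace I x} {x : M} (hX : SmoothVFAt I X x)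
    (hY : SmoothVFAt I Y x) : SmoothVFAt I (fun y => X y + Y y) x :=
  ContMDiffAt.add_section hX hY

theorem SmoothVFAt.smul {g : M → ℝ} {X : ∀ x : M, TangentSpace I x} {x : M}
    (hg : ContMDiffAt I 𝓘(ℝ, ℝ) ∞ g x) (hX : SmoothVFAt I X x) :
    SmoothVFAt I (fun y => g y • X y) x :=
  ContMDiffAt.smul_section hg hX

theorem SmoothFormAt.add {α β : ∀ x : M, Cotan I x} {x : M} (hα : SmoothFormAt I α x)
    (hβ : SmoothFormAt I β x) : SmoothFormAt I (fun y => α y + β y) x :=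
  ContMDiffAt.add_section hα hβ

theorem SmoothFormAt.sub {α β : ∀ x : M, Cotan I x} {x : M} (hα : SmoothFormAt I α x)
    (hβ : SmoothFormAt I β x) : SmoothFormAt I (fun y => α y - β y) x :=
  ContMDiffAt.sub_section hα hβ

theorem SmoothFormAt.smul {g : M → ℝ} {β : ∀ x : M, Cotan I x} {x : M}
    (hg : ContMDiffAt I 𝓘(ℝ, ℝ) ∞ g x) (hβ : SmoothFormAt I β x) :
    SmoothFormAt I (fun y => g y • β y) x :=
  ContMDiffAt.smul_section hg hβ

theorem SmoothFormAt.sum {ι : Type*} {s : Finset ι} {β : ι → ∀ x : M, Cotan I x} {x : M}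
    (hβ : ∀ i ∈ s, SmoothFormAt I (β i) x) : SmoothFormAt I (fun y => ∑ i ∈ s, β i y) x :=
  ContMDiffAt.sum_section hβ

/-- Every tangent vector is the value of a coordinate field. This reduces identities between
one-forms to identities between functions. -/
theorem cotan_ext {x : M} {α β : Cotan I x}
    (h : ∀ Z : ∀ x : M, TangentSpace I x, (∀ᶠ y in 𝓝 x, SmoothVFAt I Z y) →
      α (Z x) = β (Z x)) : α = β := by
  ext v
  have := h (coordVF x (v : E)) ((eventually_mem_chart (H := H) x).mono
    fun y hy => smoothVFAt_coordVF hy _)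
  have e : coordVF (I := I) (E := E) x v x = v := coordVF_self (I := I) (E := E) x v
  exact (congrArg α e).symm.trans (this.trans (congrArg β e))

/-! ### Derivatives of functions -/

section Functions

variable {f g : M → ℝ} {x : M}

theorem mvfderiv_add_of_smooth (hf : ContMDiffAt I 𝓘(ℝ, ℝ) ∞ f x) (hg : ContMDiffAt I 𝓘(ℝ, ℝ) ∞ g x) :
    mvfderiv I (fun y => f y + g y) x = mvfderiv I f x + mvfderiv I g x :=
  mvfderiv_add (mdiffAt_of_smooth hf) (mdiffAt_of_smooth hg)

theorem mvfderiv_sub_of_smooth (hf : ContMDiffAt I 𝓘(ℝ, ℝ) ∞ f x) (hg : ContMDiffAt I 𝓘(ℝ, ℝ) ∞ g x) :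
    mvfderiv I (fun y => f y - g y) x = mvfderiv I f x - mvfderiv I g x :=
  mvfderiv_sub (mdiffAt_of_smooth hf) (mdiffAt_of_smooth hg)

theorem mvfderiv_mul_of_smooth (hf : ContMDiffAt I 𝓘(ℝ, ℝ) ∞ f x) (hg : ContMDiffAt I 𝓘(ℝ, ℝ) ∞ g x)
    (v : TangentSpace I x) :
    mvfderiv I (fun y => f y * g y) x v = mvfderiv I f x v * g x + f x * mvfderiv I g x v := by
  have h := mvfderiv_mul (mdiffAt_of_smooth hf) (mdiffAt_of_smooth hg)
  refine (congrArg (fun T : TangentSpace I x →L[ℝ] ℝ => T v) h).trans ?_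
  simp only [add_apply, smul_apply, smul_eq_mul]
  ring

theorem mvfderiv_sum_of_smooth {ι : Type*} {s : Finset ι} {f : ι → M → ℝ}
    (hf : ∀ i ∈ s, ContMDiffAt I 𝓘(ℝ, ℝ) ∞ (f i) x) :
    mvfderiv I (fun y => ∑ i ∈ s, f i y) x = ∑ i ∈ s, mvfderiv I (f i) x := by
  classical
  induction s using Finset.induction_on with
  | empty => simpa using mvfderiv_const (I := I) (0 : ℝ) (x := x)
  | insert a s ha ih =>
    simp only [Finset.sum_insert ha]
    rw [mvfderiv_add_of_smooth (hf a (Finset.mem_insert_self a s))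
      (ContMDiffAt.sum fun i hi => hf i (Finset.mem_insert_of_mem hi)),
      ih fun i hi => hf i (Finset.mem_insert_of_mem hi)]

end Functions

/-! ### The Lie derivative of a one-form -/

section LieDerivForm

variable {X Y : ∀ x : M, TangentSpace I x} {α β : ∀ x : M, Cotan I x} {f g : M → ℝ} {x : M}

theorem mlieBracket_smul_right_apply (hg : ContMDiffAt I 𝓘(ℝ, ℝ) ∞ g x)
    (hY : SmoothVFAt I Y x) :
    mlieBracket I X (fun y => g y • Y y) x
      = mvfderiv I g x (X x) • Y x + g x • mlieBracket I X Y x := by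
  have := FiniteDimensional.complete ℝ E
  have : IsManifold I 2 M := .of_le (n := ∞) ENat.LEInfty.out
  exact mlieBracket_smul_right (mdiffAt_of_smooth hg) hY.mdiffAt

theorem mlieBracket_smul_left_apply (hg : ContMDiffAt I 𝓘(ℝ, ℝ) ∞ g x)
    (hX : SmoothVFAt I X x) :
    mlieBracket I (fun y => g y • X y) Y x
      = -mvfderiv I g x (Y x) • X x + g x • mlieBracket I X Y x := by
  have := FiniteDimensional.complete ℝ E
  have : IsManifold I 2 M := .of_le (n := ∞) ENat.LEInfty.out
  exact mlieBracket_smul_left (mdiffAt_of_smooth hg) hX.mdiffAt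

theorem mlieBracket_add_right_apply {Z : ∀ x : M, TangentSpace I x} (hY : SmoothVFAt I Y x)
    (hZ : SmoothVFAt I Z x) :
    mlieBracket I X (fun y => Y y + Z y) x = mlieBracket I X Y x + mlieBracket I X Z x := by
  have : IsManifold I 2 M := .of_le (n := ∞) ENat.LEInfty.out
  exact mlieBracket_add_right hY.mdiffAt hZ.mdiffAt

theorem mlieBracket_add_left_apply {Z : ∀ x : M, TangentSpace I x} (hY : SmoothVFAt I Y x)
    (hZ : SmoothVFAt I Z x) :
    mlieBracket I (fun y => Y y + Z y) X x = mlieBracket I Y X x + mlieBracket I Z X x := by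
  have : IsManifold I 2 M := .of_le (n := ∞) ENat.LEInfty.out
  exact mlieBracket_add_left hY.mdiffAt hZ.mdiffAt

theorem mlieBracket_jacobi {Z : ∀ x : M, TangentSpace I x} (hX : SmoothVFAt I X x)
    (hY : SmoothVFAt I Y x) (hZ : SmoothVFAt I Z x) :
    mlieBracket I X (mlieBracket I Y Z) x = mlieBracket I (mlieBracket I X Y) Z x
      + mlieBracket I Y (mlieBracket I X Z) x := by
  have := FiniteDimensional.complete ℝ E
  have : IsManifold I (minSmoothness ℝ 3) M := by
    rw [minSmoothness_of_isRCLikeNormedField]; exact .of_le (n := ∞) ENat.LEInfty.out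
  have h2 : minSmoothness ℝ 2 ≤ ∞ := by
    rw [minSmoothness_of_isRCLikeNormedField]; exact ENat.LEInfty.out
  exact leibniz_identity_mlieBracket_apply (ContMDiffAt.of_le hX h2) (ContMDiffAt.of_le hY h2)
    (ContMDiffAt.of_le hZ h2)

theorem lieDerivForm_congr {X' : ∀ x : M, TangentSpace I x} {β' : ∀ x : M, Cotan I x}
    (hX : SmoothVFAt I X x) (hβ : SmoothFormAt I β x)
    (hXX' : ∀ᶠ y in 𝓝 x, X' y = X y) (hββ' : ∀ᶠ y in 𝓝 x, β' y = β y) :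
    lieDerivForm I X' β' x = lieDerivForm I X β x := by
  refine cotan_ext fun Z hZ => ?_
  have hZ := hZ.self_of_nhds
  rw [lieDerivForm_apply hX hβ hZ, lieDerivForm_apply (hX.congr hXX') (hβ.congr hββ') hZ,
    hXX'.self_of_nhds, hββ'.self_of_nhds,
    EventuallyEq.mlieBracket_vectorField_eq hXX' (Eventually.of_forall fun _ => rfl),
    mvfderiv_congr (hββ'.mono fun y hy => by rw [hy])]

theorem lieDerivForm_add_right (hX : SmoothVFAt I X x) (hα : SmoothFormAt I α x)
    (hβ : SmoothFormAt I β x) :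
    lieDerivForm I X (fun y => α y + β y) x = lieDerivForm I X α x + lieDerivForm I X β x := by
  refine cotan_ext fun Z hZ => ?_
  have hZ := hZ.self_of_nhds
  rw [add_apply, lieDerivForm_apply hX (hα.add hβ) hZ, lieDerivForm_apply hX hα hZ,
    lieDerivForm_apply hX hβ hZ]
  simp only [add_apply]
  rw [mvfderiv_add_of_smooth (hα.apply hZ) (hβ.apply hZ)]
  simp only [add_apply]
  ring

theorem lieDerivForm_sub_right (hX : SmoothVFAt I X x) (hα : SmoothFormAt I α x)
    (hβ : SmoothFormAt I β x) :
    lieDerivForm I X (fun y => α y - β y) x = lieDerivForm I X α x - lieDerivForm I X β x := by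
  have h := lieDerivForm_add_right hX (hα.sub hβ) hβ
  simp only [sub_add_cancel] at h
  exact eq_sub_of_add_eq h.symm

theorem lieDerivForm_add_left (hX : SmoothVFAt I X x) (hY : SmoothVFAt I Y x)
    (hβ : SmoothFormAt I β x) :
    lieDerivForm I (fun y => X y + Y y) β x = lieDerivForm I X β x + lieDerivForm I Y β x := by
  refine cotan_ext fun Z hZ => ?_
  have hZ := hZ.self_of_nhds
  rw [add_apply, lieDerivForm_apply (hX.add hY) hβ hZ, lieDerivForm_apply hX hβ hZ,
    lieDerivForm_apply hY hβ hZ, mlieBracket_add_left_apply hX hY, map_add, map_add]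
  ring

theorem lieDerivForm_smul_right (hX : SmoothVFAt I X x) (hg : ContMDiffAt I 𝓘(ℝ, ℝ) ∞ g x)
    (hβ : SmoothFormAt I β x) :
    lieDerivForm I X (fun y => g y • β y) x
      = mvfderiv I g x (X x) • β x + g x • lieDerivForm I X β x := by
  refine cotan_ext fun Z hZ => ?_
  have hZ := hZ.self_of_nhds
  rw [add_apply, smul_apply, smul_apply, lieDerivForm_apply hX (hβ.smul hg) hZ,
    lieDerivForm_apply hX hβ hZ]
  simp only [smul_apply, smul_eq_mul]
  rw [mvfderiv_mul_of_smooth hg (hβ.apply hZ)]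
  ring

theorem lieDerivForm_smul_left (hX : SmoothVFAt I X x) (hg : ContMDiffAt I 𝓘(ℝ, ℝ) ∞ g x)
    (hβ : SmoothFormAt I β x) :
    lieDerivForm I (fun y => g y • X y) β x
      = g x • lieDerivForm I X β x + β x (X x) • mvfderiv I g x := by
  refine cotan_ext fun Z hZ => ?_
  have hZ := hZ.self_of_nhds
  rw [add_apply, smul_apply, smul_apply, lieDerivForm_apply (hX.smul hg) hβ hZ,
    lieDerivForm_apply hX hβ hZ, mlieBracket_smul_left_apply hg hX, map_add, map_smul, map_smul,
    map_smul]
  simp only [smul_eq_mul]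
  ring

theorem lieDerivForm_mvfderiv (hX : SmoothVFAt I X x) (hf : ContMDiffAt I 𝓘(ℝ, ℝ) ∞ f x) :
    lieDerivForm I X (mvfderiv I f) x = mvfderiv I (fun y => mvfderiv I f y (X y)) x := by
  refine cotan_ext fun Z hZ => ?_
  have hZ := hZ.self_of_nhds
  rw [lieDerivForm_apply hX (smoothFormAt_mvfderiv hf) hZ, mvfderiv_mlieBracket hX hZ hf]
  ring

/-- `L_{[X, Y]} = L_X L_Y - L_Y L_X`. -/
theorem lieDerivForm_mlieBracket (hX : ∀ᶠ y in 𝓝 x, SmoothVFAt I X y)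
    (hY : ∀ᶠ y in 𝓝 x, SmoothVFAt I Y y) (hβ : ∀ᶠ y in 𝓝 x, SmoothFormAt I β y) :
    lieDerivForm I (mlieBracket I X Y) β x
      = lieDerivForm I X (lieDerivForm I Y β) x - lieDerivForm I Y (lieDerivForm I X β) x := by
  refine cotan_ext fun Z hZ => ?_
  have hX0 := hX.self_of_nhds
  have hY0 := hY.self_of_nhds
  have hβ0 := hβ.self_of_nhds
  have hZ0 := hZ.self_of_nhds
  -- One order of the two Lie derivatives is expanded on `Z`. The terms `X(β([Y, Z]))` and `Y(β([X,
  -- Z]))` are symmetric in `X` and `Y` and cancel in the commutator; the Jacobi identity for vector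
  -- fields accounts for the double brackets.
  have key : ∀ X Y : ∀ x : M, TangentSpace I x, (∀ᶠ y in 𝓝 x, SmoothVFAt I X y) →
      (∀ᶠ y in 𝓝 x, SmoothVFAt I Y y) →
      lieDerivForm I X (lieDerivForm I Y β) x (Z x)
        = mvfderiv I (fun y => mvfderiv I (fun z => β z (Z z)) y (Y y)) x (X x)
          - mvfderiv I (fun y => β y (mlieBracket I Y Z y)) x (X x)
          - (mvfderiv I (fun y => β y (mlieBracket I X Z y)) x (Y x)
            - β x (mlieBracket I Y (mlieBracket I X Z) x)) := by
    intro X Y hX hY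
    have hX0 := hX.self_of_nhds
    have hY0 := hY.self_of_nhds
    rw [lieDerivForm_apply hX0 (SmoothFormAt.lieDerivForm hY hβ) hZ0,
      lieDerivForm_apply hY0 hβ0 (hX0.mlieBracket hZ0)]
    have h1 : ∀ᶠ y in 𝓝 x, lieDerivForm I Y β y (Z y)
        = mvfderiv I (fun z => β z (Z z)) y (Y y) - β y (mlieBracket I Y Z y) := by
      filter_upwards [hY, hβ, hZ] with y h1 h2 h3
      exact lieDerivForm_apply h1 h2 h3
    rw [mvfderiv_congr h1, mvfderiv_sub_of_smooth (contMDiffAt_mvfderiv_apply hY0 (hβ0.apply hZ0))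
      (hβ0.apply (hY0.mlieBracket hZ0))]
    rfl
  rw [sub_apply, key X Y hX hY, key Y X hY hX, lieDerivForm_apply (hX0.mlieBracket hY0) hβ0 hZ0,
    mvfderiv_mlieBracket hX0 hY0 (hβ0.apply hZ0), mlieBracket_jacobi hX0 hY0 hZ0, map_add]
  ring

end LieDerivForm

/-! ### Coordinate expressions -/

/-- A smooth one-form is locally a combination of differentials. -/
theorem exists_eq_sum_smul_mvfderiv {η : ∀ x : M, Cotan I x} {x : M} (hη : SmoothFormAt I η x) :
    ∃ (n : ℕ) (g f : Fin n → M → ℝ), (∀ k, ContMDiffAt I 𝓘(ℝ, ℝ) ∞ (g k) x) ∧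
      (∀ k, ∀ᶠ y in 𝓝 x, ContMDiffAt I 𝓘(ℝ, ℝ) ∞ (f k) y) ∧
      ∀ᶠ y in 𝓝 x, η y = ∑ k, g k y • mvfderiv I (f k) y := by
  let b := Module.finBasis ℝ E
  let l : Fin (Module.finrank ℝ E) → E →L[ℝ] ℝ := fun k => LinearMap.toContinuousLinearMap (b.coord k)
  -- The coefficients are the components of `η`, and the functions are the coordinates of the
  -- preferred chart at `x`.
  refine ⟨Module.finrank ℝ E, fun k y => η y (coordVF x (b k) y),
    fun k y => l k (extChartAt I x y), fun k => ?_, fun k => ?_, ?_⟩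
  · exact hη.apply (smoothVFAt_coordVF (mem_chart_source H x) (b k))
  · filter_upwards [eventually_mem_chart (H := H) x] with y hy
    exact (l k).contMDiff.contMDiffAt.comp y (contMDiffAt_extChartAt' hy)
  · filter_upwards [eventually_mem_chart (H := H) x] with y hy
    ext v
    have h1 : ∀ k, mvfderiv I (fun y => l k (extChartAt I x y)) y v
        = b.repr ((trivializationAt E (TangentSpace I) x).continuousLinearMapAt ℝ y v) k := by
      intro k
      have h2 := mfderiv_comp_apply (I := I) (I' := 𝓘(ℝ, E)) (I'' := 𝓘(ℝ, ℝ)) y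
        (g := l k) (f := extChartAt I x)
        ((l k).differentiableAt.mdifferentiableAt) (mdifferentiableAt_extChartAt hy) v
      rw [TangentBundle.continuousLinearMapAt_trivializationAt hy]
      refine h2.trans ?_
      rw [mfderiv_eq_fderiv, ContinuousLinearMap.fderiv]
      rfl
    have hv : v = ∑ k, b.repr ((trivializationAt E (TangentSpace I) x).continuousLinearMapAt ℝ y v) k
        • coordVF (I := I) x (b k) y := by
      have h2 : (trivializationAt E (TangentSpace I) x).symmL ℝ y
          ((trivializationAt E (TangentSpace I) x).continuousLinearMapAt ℝ y v) = v :=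
        Trivialization.symmL_continuousLinearMapAt _ (by simpa using hy) _
      conv_lhs => rw [← h2, ← b.sum_repr
        ((trivializationAt E (TangentSpace I) x).continuousLinearMapAt ℝ y v)]
      rw [map_sum]
      simp only [map_smul]
      rfl
    conv_lhs => rw [hv]
    simp only [map_sum, map_smul, sum_apply, smul_apply, smul_eq_mul, h1]
    exact Finset.sum_congr rfl fun k _ => mul_comm _ _

/-- Tangent vectors are determined by their action on smooth functions. -/
theorem tangent_ext {x : M} {v w : TangentSpace I x}
    (h : ∀ f : M → ℝ, (∀ᶠ y in 𝓝 x, ContMDiffAt I 𝓘(ℝ, ℝ) ∞ f y) →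
      mvfderiv I f x v = mvfderiv I f x w) : v = w := by
  let b := Module.finBasis ℝ E
  refine b.ext_elem (x := (v : E)) (y := (w : E)) fun k => ?_
  let l : E →L[ℝ] ℝ := LinearMap.toContinuousLinearMap (b.coord k)
  have h1 : ∀ v : TangentSpace I x, mvfderiv I (fun y => l (extChartAt I x y)) x v = l (v : E) := by
    intro v
    have h2 := mfderiv_comp_apply (I := I) (I' := 𝓘(ℝ, E)) (I'' := 𝓘(ℝ, ℝ)) x
        (g := l) (f := extChartAt I x)
        (l.differentiableAt.mdifferentiableAt)
        (mdifferentiableAt_extChartAt (mem_chart_source H x)) v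
    refine h2.trans ?_
    rw [mfderiv_eq_fderiv, ContinuousLinearMap.fderiv, mfderiv_extChartAt_self]
    rfl
  have h2 := h (fun y => l (extChartAt I x y)) (by
    filter_upwards [eventually_mem_chart (H := H) x] with y hy
    exact l.contMDiff.contMDiffAt.comp y (contMDiffAt_extChartAt' hy))
  rw [h1, h1] at h2
  exact h2

end Calculus

section Bundles

variable {E : Type*} [NormedAddCommGroup E] [NormedSpace ℝ E]
  {H : Type*} [TopologicalSpace H] {I : ModelWithCorners ℝ E H}
  {M : Type*} [TopologicalSpace M] [ChartedSpace H M]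
  {E' : Type*} [NormedAddCommGroup E'] [NormedSpace ℝ E']
  {H' : Type*} [TopologicalSpace H'] {J : ModelWithCorners ℝ E' H'}
  {N : Type*} [TopologicalSpace N] [ChartedSpace H' N]

/-! ### Sections of vector bundles along a map -/

section Product

variable {F₁ : Type*} [NormedAddCommGroup F₁] [NormedSpace ℝ F₁] {V₁ : N → Type*}
  [∀ x, AddCommGroup (V₁ x)] [∀ x, Module ℝ (V₁ x)] [∀ x, TopologicalSpace (V₁ x)]
  [TopologicalSpace (TotalSpace F₁ V₁)] [FiberBundle F₁ V₁]
  {F₂ : Type*} [NormedAddCommGroup F₂] [NormedSpace ℝ F₂] {V₂ : N → Type*}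
  [∀ x, AddCommGroup (V₂ x)] [∀ x, Module ℝ (V₂ x)] [∀ x, TopologicalSpace (V₂ x)]
  [TopologicalSpace (TotalSpace F₂ V₂)] [FiberBundle F₂ V₂]

theorem contMDiffAt_prod_bundle_iff {φ : M → N} {s : ∀ x, V₁ (φ x) × V₂ (φ x)} {x₀ : M} :
    ContMDiffAt I (J.prod 𝓘(ℝ, F₁ × F₂)) ∞
      (fun x => TotalSpace.mk' (F₁ × F₂) (E := fun y => V₁ y × V₂ y) (φ x) (s x)) x₀ ↔
    ContMDiffAt I (J.prod 𝓘(ℝ, F₁)) ∞ (fun x => TotalSpace.mk' F₁ (φ x) (s x).1) x₀ ∧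
    ContMDiffAt I (J.prod 𝓘(ℝ, F₂)) ∞ (fun x => TotalSpace.mk' F₂ (φ x) (s x).2) x₀ := by
  rw [contMDiffAt_totalSpace, contMDiffAt_totalSpace, contMDiffAt_totalSpace]
  have h := contMDiffAt_prod_module_iff (I := I) (n := ∞) (x := x₀)
    (fun x => ((trivializationAt F₁ V₁ (φ x₀) ⟨φ x, (s x).1⟩).2,
      (trivializationAt F₂ V₂ (φ x₀) ⟨φ x, (s x).2⟩).2))
  constructor
  · rintro ⟨h1, h2⟩
    exact ⟨⟨h1, (h.1 h2).1⟩, h1, (h.1 h2).2⟩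
  · rintro ⟨⟨h1, h2⟩, -, h3⟩
    exact ⟨h1, h.2 ⟨h2, h3⟩⟩

end Product

section Single

variable {F : Type*} [NormedAddCommGroup F] [NormedSpace ℝ F] {V : N → Type*}
  [∀ x, AddCommGroup (V x)] [∀ x, Module ℝ (V x)] [∀ x, TopologicalSpace (V x)]
  [TopologicalSpace (TotalSpace F V)] [FiberBundle F V] [VectorBundle ℝ F V]

theorem contMDiffAt_pullback_iff (φ : C^∞⟮I, M; J, N⟯) {s : ∀ x, V (φ x)} {x₀ : M} :
    ContMDiffAt I (I.prod 𝓘(ℝ, F)) ∞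
      (fun x => TotalSpace.mk' F (E := (φ : M → N) *ᵖ V) x (s x)) x₀ ↔
    ContMDiffAt I (J.prod 𝓘(ℝ, F)) ∞ (fun x => TotalSpace.mk' F (φ x) (s x)) x₀ := by
  rw [contMDiffAt_totalSpace, contMDiffAt_totalSpace]
  exact ⟨fun h => ⟨φ.contMDiff.contMDiffAt, h.2⟩, fun h => ⟨contMDiffAt_id, h.2⟩⟩

/-- The fibrewise linear form of the trivialization is used so that sums and scalar multiples of
sections along a map pass through it. -/
theorem contMDiffAt_along_iff {φ : M → N} {s : ∀ x, V (φ x)} {x₀ : M} :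
    ContMDiffAt I (J.prod 𝓘(ℝ, F)) ∞ (fun x => TotalSpace.mk' F (φ x) (s x)) x₀ ↔
      ContMDiffAt I J ∞ φ x₀ ∧ ContMDiffAt I 𝓘(ℝ, F) ∞
        (fun x => (trivializationAt F V (φ x₀)).continuousLinearMapAt ℝ (φ x) (s x)) x₀ := by
  rw [contMDiffAt_totalSpace]
  refine and_congr_right fun h1 => ?_
  have h2 : ∀ᶠ x in 𝓝 x₀, φ x ∈ (trivializationAt F V (φ x₀)).baseSet :=
    h1.continuousAt.eventually ((trivializationAt F V (φ x₀)).open_baseSet.mem_nhds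
      (FiberBundle.mem_baseSet_trivializationAt' (φ x₀)))
  have h3 : (fun x => (trivializationAt F V (φ x₀) ⟨φ x, s x⟩).2) =ᶠ[𝓝 x₀]
      fun x => (trivializationAt F V (φ x₀)).continuousLinearMapAt ℝ (φ x) (s x) := by
    filter_upwards [h2] with x hx
    simp [Trivialization.continuousLinearMapAt_apply, Trivialization.linearMapAt_apply, hx]
  exact ⟨fun h => h.congr_of_eventuallyEq h3.symm, fun h => h.congr_of_eventuallyEq h3⟩

theorem contMDiffAt_sum_smul_along {ι : Type*} [Fintype ι] {φ : M → N} {x₀ : M}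
    {c : ι → M → ℝ} {e : ι → ∀ x, V (φ x)} (hφ : ContMDiffAt I J ∞ φ x₀)
    (hc : ∀ i, ContMDiffAt I 𝓘(ℝ, ℝ) ∞ (c i) x₀)
    (he : ∀ i, ContMDiffAt I (J.prod 𝓘(ℝ, F)) ∞ (fun x => TotalSpace.mk' F (φ x) (e i x)) x₀) :
    ContMDiffAt I (J.prod 𝓘(ℝ, F)) ∞
      (fun x => TotalSpace.mk' F (φ x) (∑ i, c i x • e i x)) x₀ := by
  rw [contMDiffAt_along_iff]
  refine ⟨hφ, ?_⟩
  simp only [map_sum, map_smul]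
  exact ContMDiffAt.sum fun i _ => (hc i).smul (contMDiffAt_along_iff.1 (he i)).2

theorem contMDiffAt_det {k : ℕ} {G : M → Matrix (Fin k) (Fin k) ℝ} {x₀ : M}
    (hG : ∀ i j, ContMDiffAt I 𝓘(ℝ, ℝ) ∞ (fun x => G x i j) x₀) :
    ContMDiffAt I 𝓘(ℝ, ℝ) ∞ (fun x => (G x).det) x₀ := by
  simp only [Matrix.det_apply']
  refine ContMDiffAt.sum fun σ _ => ?_
  exact contMDiffAt_const.mul (contMDiffAt_finsetProd fun i _ => hG _ _)

/-- The coefficients of a smooth section with respect to a smooth frame are smooth. -/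
theorem contMDiffAt_frame_coeff [FiniteDimensional ℝ F] {k : ℕ} {φ : M → N} {x₀ : M}
    {e : Fin k → ∀ x, V (φ x)} {s : ∀ x, V (φ x)} {c : Fin k → M → ℝ}
    (he : ∀ i, ContMDiffAt I (J.prod 𝓘(ℝ, F)) ∞ (fun x => TotalSpace.mk' F (φ x) (e i x)) x₀)
    (hs : ContMDiffAt I (J.prod 𝓘(ℝ, F)) ∞ (fun x => TotalSpace.mk' F (φ x) (s x)) x₀)
    (hli : LinearIndependent ℝ fun i => e i x₀)
    (hc : ∀ᶠ x in 𝓝 x₀, s x = ∑ i, c i x • e i x) (i : Fin k) :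
    ContMDiffAt I 𝓘(ℝ, ℝ) ∞ (c i) x₀ := by
  let T : ∀ x, V (φ x) →L[ℝ] F := fun x =>
    (trivializationAt F V (φ x₀)).continuousLinearMapAt ℝ (φ x)
  have hT : LinearIndependent ℝ fun i => T x₀ (e i x₀) := by
    refine hli.map' (T x₀ : V (φ x₀) →ₗ[ℝ] F) ?_
    refine LinearMap.ker_eq_bot.2 fun v w h => ?_
    have hb := FiberBundle.mem_baseSet_trivializationAt' (F := F) (E := V) (φ x₀)
    have h1 := congrArg ((trivializationAt F V (φ x₀)).symmL ℝ (φ x₀)) h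
    have h2 : ∀ v, (trivializationAt F V (φ x₀)).symmL ℝ (φ x₀) (T x₀ v) = v := fun v =>
      Trivialization.symmL_continuousLinearMapAt _ hb v
    exact (h2 v).symm.trans (h1.trans (h2 w))
  -- Functionals dual to the frame at `x₀` are kept fixed. Their matrix `G` against the frame at
  -- nearby points is the identity at `x₀`, hence invertible near it, and Cramer's rule writes the
  -- coefficients as quotients of smooth determinants.
  have hdual : ∃ l : Fin k → F →ₗ[ℝ] ℝ, ∀ i j, l i (T x₀ (e j x₀)) = if i = j then 1 else 0 := by
    obtain ⟨g, hg⟩ := LinearMap.exists_leftInverse_of_injective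
      (Fintype.linearCombination ℝ fun i => T x₀ (e i x₀))
      (LinearMap.ker_eq_bot.2 (linearIndependent_iff_injective_fintypeLinearCombination.1 hT))
    refine ⟨fun i => (LinearMap.proj i).comp g, fun i j => ?_⟩
    have h1 : T x₀ (e j x₀) = Fintype.linearCombination ℝ (fun i => T x₀ (e i x₀))
        (Pi.single j 1) := by
      simp
    rw [h1]
    have h2 := congrFun (congrArg DFunLike.coe hg) (Pi.single j (1 : ℝ))
    have h3 := congrFun h2 i
    simpa [Pi.single_apply] using h3
  obtain ⟨l, hl⟩ := hdual
  let L : Fin k → F →L[ℝ] ℝ := fun i => LinearMap.toContinuousLinearMap (l i)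
  let G : M → Matrix (Fin k) (Fin k) ℝ := fun x => Matrix.of fun i j => L i (T x (e j x))
  have hTs : ContMDiffAt I 𝓘(ℝ, F) ∞ (fun x => T x (s x)) x₀ := (contMDiffAt_along_iff.1 hs).2
  have hTe : ∀ j, ContMDiffAt I 𝓘(ℝ, F) ∞ (fun x => T x (e j x)) x₀ := fun j =>
    (contMDiffAt_along_iff.1 (he j)).2
  have hG : ∀ i j, ContMDiffAt I 𝓘(ℝ, ℝ) ∞ (fun x => G x i j) x₀ := fun i j =>
    (L i).contMDiff.contMDiffAt.comp x₀ (hTe j)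
  have hG0 : G x₀ = 1 := by
    ext i j
    simpa [G, L, Matrix.one_apply] using hl i j
  have hd := contMDiffAt_det hG
  have hne : ∀ᶠ x in 𝓝 x₀, (G x).det ≠ 0 := by
    refine hd.continuousAt.eventually_ne ?_
    rw [hG0, Matrix.det_one]
    exact one_ne_zero
  have hcram : ContMDiffAt I 𝓘(ℝ, ℝ) ∞
      (fun x => ((G x).updateCol i fun j => L j (T x (s x))).det) x₀ := by
    refine contMDiffAt_det (G := fun x => (G x).updateCol i fun j => L j (T x (s x))) fun a b => ?_
    by_cases hb : b = i
    · subst hb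
      simp only [Matrix.updateCol_self]
      exact (L a).contMDiff.contMDiffAt.comp x₀ hTs
    · simp only [Matrix.updateCol_ne hb]
      exact hG a b
  have hq : ContMDiffAt I 𝓘(ℝ, ℝ) ∞
      (fun x => ((G x).det)⁻¹ * ((G x).updateCol i fun j => L j (T x (s x))).det) x₀ := by
    refine ContMDiffAt.mul ?_ hcram
    exact hd.inv₀ hne.self_of_nhds
  refine hq.congr_of_eventuallyEq ?_
  filter_upwards [hne, hc] with x hx hcx
  have h1 : (fun j => L j (T x (s x))) = (G x).mulVec fun i => c i x := by
    funext j
    rw [hcx]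
    simp only [map_sum, map_smul, smul_eq_mul, Matrix.mulVec, dotProduct, G, Matrix.of_apply]
    exact Finset.sum_congr rfl fun i _ => mul_comm _ _
  have h2 : ((G x).updateCol i fun j => L j (T x (s x))).det = (G x).det * c i x := by
    rw [h1, ← Matrix.cramer_apply, Matrix.cramer_eq_adjugate_mulVec, Matrix.mulVec_mulVec,
      Matrix.adjugate_mul, Matrix.smul_mulVec, Matrix.one_mulVec]
    rfl
  rw [h2, inv_mul_cancel_left₀ hx]

end Single

end Bundles

section Frames

variable {E : Type*} [NormedAddCommGroup E] [NormedSpace ℝ E]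
  {H : Type*} [TopologicalSpace H] {I : ModelWithCorners ℝ E H}
  {M : Type*} [TopologicalSpace M] [ChartedSpace H M] [IsManifold I ∞ M]
  {F : Type*} [NormedAddCommGroup F] [NormedSpace ℝ F] {V : M → Type*}
  [∀ x, AddCommGroup (V x)] [∀ x, Module ℝ (V x)] [∀ x, TopologicalSpace (V x)]
  [TopologicalSpace (TotalSpace F V)] [FiberBundle F V] [VectorBundle ℝ F V]
  {A : ∀ x : M, Submodule ℝ (V x)}

/-! ### Frames of subbundles by global sections -/

/-- The global sections `e` are a frame of `A` over `U`. -/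
structure IsSectionFrame {k : ℕ} (e : Fin k → smoothSections I F A) (U : Set M) : Prop where
  indep : ∀ x ∈ U, LinearIndependent ℝ fun i => (e i).1 x
  span : ∀ x ∈ U, Submodule.span ℝ (Set.range fun i => (e i).1 x) = A x

theorem exists_bump [FiniteDimensional ℝ E] [T2Space M] {U : Set M} (hU : IsOpen U) {x₀ : M}
    (hx : x₀ ∈ U) : ∃ b : M → ℝ, ContMDiff I 𝓘(ℝ, ℝ) ∞ b ∧ (∀ᶠ x in 𝓝 x₀, b x = 1) ∧
      tsupport b ⊆ U := by
  obtain ⟨b, -, hb⟩ := (SmoothBumpFunction.nhds_basis_tsupport (I := I) x₀).mem_iff.1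
    (hU.mem_nhds hx)
  exact ⟨b, b.contMDiff, b.eventuallyEq_one, hb⟩

/-- A subbundle has local frames by global sections. -/
theorem IsSubbundle.exists_sectionFrame [FiniteDimensional ℝ E] [T2Space M]
    (hA : IsSubbundle I F A) (x₀ : M) :
    ∃ (k : ℕ) (e : Fin k → smoothSections I F A) (U : Set M), IsOpen U ∧ x₀ ∈ U ∧
      IsSectionFrame e U := by
  obtain ⟨k, U, e, hU, hx, he, hf⟩ := hA x₀
  obtain ⟨b, hb, hb1, hbU⟩ := exists_bump (I := I) hU hx
  obtain ⟨W, hW1, hWo, hWx⟩ := eventually_nhds_iff.1 hb1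
  -- The local frame is cut off by a bump function and remains a frame on the smaller set where the
  -- bump function equals one.
  refine ⟨k, fun i => ⟨fun x => b x • e i x, ?_, fun x => ?_⟩, W ∩ U, hWo.inter hU, ⟨hWx, hx⟩,
    ?_, ?_⟩
  · exact ContMDiffOn.smul_section_of_tsupport hb.contMDiffOn hU hbU (he i)
  · by_cases hxU : x ∈ U
    · refine (A x).smul_mem _ ?_
      rw [← (hf x hxU).2]
      exact Submodule.subset_span ⟨i, rfl⟩
    · show b x • e i x ∈ A x
      rw [image_eq_zero_of_notMem_tsupport fun h => hxU (hbU h), zero_smul]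
      exact (A x).zero_mem
  · rintro x ⟨hxW, hxU⟩
    simpa only [hW1 x hxW, one_smul] using (hf x hxU).1
  · rintro x ⟨hxW, hxU⟩
    simpa only [hW1 x hxW, one_smul] using (hf x hxU).2

theorem smoothSections_contMDiffAt (s : smoothSections I F A) (x : M) :
    ContMDiffAt I (I.prod 𝓘(ℝ, F)) ∞ (fun x => TotalSpace.mk' F x (s.1 x)) x := s.2.1 x

variable {E' : Type*} [NormedAddCommGroup E'] [NormedSpace ℝ E']
  {H' : Type*} [TopologicalSpace H'] {J : ModelWithCorners ℝ E' H'}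
  {N : Type*} [TopologicalSpace N] [ChartedSpace H' N]

theorem smoothSections_contMDiffAt_comp {φ : N → M} {y : N} (hφ : ContMDiffAt J I ∞ φ y)
    (s : smoothSections I F A) :
    ContMDiffAt J (I.prod 𝓘(ℝ, F)) ∞ (fun y => TotalSpace.mk' F (φ y) (s.1 (φ y))) y :=
  (s.2.1 (φ y)).comp y hφ

theorem IsSectionFrame.exists_coeff {k : ℕ} {e : Fin k → smoothSections I F A} {U : Set M}
    (he : IsSectionFrame e U) (φ : N → M) (w : ∀ y, V (φ y)) (hw : ∀ y, w y ∈ A (φ y)) :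
    ∃ c : Fin k → N → ℝ, ∀ y, φ y ∈ U → w y = ∑ i, c i y • (e i).1 (φ y) := by
  have h : ∀ y, ∃ c : Fin k → ℝ, φ y ∈ U → w y = ∑ i, c i • (e i).1 (φ y) := by
    intro y
    by_cases hy : φ y ∈ U
    · have h1 := hw y
      rw [← he.span _ hy, Submodule.mem_span_range_iff_exists_fun] at h1
      obtain ⟨c, hc⟩ := h1
      exact ⟨c, fun _ => hc.symm⟩
    · exact ⟨0, fun h => absurd h hy⟩
  choose c hc using h
  exact ⟨fun i y => c y i, hc⟩

/-- A section of `A` along `φ` is a combination of the sections of a frame, with coefficients that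
are smooth wherever it is. -/
theorem IsSectionFrame.exists_smooth_coeff [FiniteDimensional ℝ F] {k : ℕ}
    {e : Fin k → smoothSections I F A} {U : Set M} (hU : IsOpen U)
    (he : IsSectionFrame e U) (φ : N → M) (w : ∀ y, V (φ y)) (hw : ∀ y, w y ∈ A (φ y)) :
    ∃ c : Fin k → N → ℝ, (∀ y, φ y ∈ U → w y = ∑ i, c i y • (e i).1 (φ y)) ∧
      ∀ y, φ y ∈ U → ContMDiffAt J I ∞ φ y →
        ContMDiffAt J (I.prod 𝓘(ℝ, F)) ∞ (fun y => TotalSpace.mk' F (φ y) (w y)) y →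
        ∀ i, ContMDiffAt J 𝓘(ℝ, ℝ) ∞ (c i) y := by
  obtain ⟨c, hc⟩ := he.exists_coeff φ w hw
  refine ⟨c, hc, fun y hy hφ hwy i => ?_⟩
  exact contMDiffAt_frame_coeff (J := I) (φ := φ) (e := fun i y => (e i).1 (φ y))
    (fun i => smoothSections_contMDiffAt_comp hφ (e i)) hwy (he.indep _ hy)
    ((hφ.continuousAt.eventually (hU.mem_nhds hy)).mono hc) i

theorem IsSectionFrame.basis_indep {k : ℕ} {e : Fin k → smoothSections I F A} {U : Set M}
    (he : IsSectionFrame e U) {x : M} (hx : x ∈ U) :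
    LinearIndependent ℝ fun i => secVal (e i) x :=
  LinearIndependent.of_comp (A x).subtype (he.indep x hx)

theorem IsSectionFrame.basis_span {k : ℕ} {e : Fin k → smoothSections I F A} {U : Set M}
    (he : IsSectionFrame e U) {x : M} (hx : x ∈ U) :
    Submodule.span ℝ (Set.range fun i => secVal (e i) x) = ⊤ := by
  refine Submodule.map_injective_of_injective (A x).injective_subtype ?_
  rw [Submodule.map_span, Submodule.map_top, Submodule.range_subtype, ← Set.range_comp]
  exact he.span x hx

theorem isSectionFrame_of_secVal {k : ℕ} {e : Fin k → smoothSections I F A} {U : Set M}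
    (h1 : ∀ x ∈ U, LinearIndependent ℝ fun i => secVal (e i) x)
    (h2 : ∀ x ∈ U, Submodule.span ℝ (Set.range fun i => secVal (e i) x) = ⊤) :
    IsSectionFrame e U where
  indep x hx := (h1 x hx).map' (A x).subtype (A x).ker_subtype
  span x hx := by
    have h := congrArg (Submodule.map (A x).subtype) (h2 x hx)
    rw [Submodule.map_span, Submodule.map_top, Submodule.range_subtype, ← Set.range_comp] at h
    exact h

/-- Every vector of `A` extends to a global section. -/
theorem IsSubbundle.exists_section_eq [FiniteDimensional ℝ E] [T2Space M]
    (hA : IsSubbundle I F A) {x : M} (a : A x) : ∃ s : smoothSections I F A, secVal s x = a := by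
  obtain ⟨k, e, U, -, hx, he⟩ := hA.exists_sectionFrame x
  have h := he.basis_span hx
  have ha : a ∈ Submodule.span ℝ (Set.range fun i => secVal (e i) x) := h ▸ Submodule.mem_top
  rw [Submodule.mem_span_range_iff_exists_fun] at ha
  obtain ⟨c, hc⟩ := ha
  refine ⟨∑ i, c i • e i, ?_⟩
  rw [← hc]
  ext
  simp [secVal, Finset.sum_apply]

theorem IsSectionFrame.finrank_eq {k : ℕ} {e : Fin k → smoothSections I F A} {U : Set M}
    (he : IsSectionFrame e U) {x : M} (hx : x ∈ U) : Module.finrank ℝ (A x) = k := by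
  have := Module.finrank_eq_card_basis
    (Module.Basis.mk (he.basis_indep hx) (he.basis_span hx).ge)
  simpa using this

end Frames

section Courant

variable {E : Type*} [NormedAddCommGroup E] [NormedSpace ℝ E] [FiniteDimensional ℝ E]
  {H : Type*} [TopologicalSpace H] {I : ModelWithCorners ℝ E H} [I.Boundaryless]
  {M : Type*} [TopologicalSpace M] [ChartedSpace H M] [IsManifold I ∞ M]

/-! ### The Courant bracket -/

theorem smoothGenAt_iff {s : ∀ x : M, GTan I x} {x : M} :
    SmoothGenAt I s x ↔ SmoothVFAt I (fun y => (s y).1) x ∧ SmoothFormAt I (fun y => (s y).2) x :=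
  contMDiffAt_prod_bundle_iff (φ := fun x : M => x)

theorem SmoothGenAt.fst {s : ∀ x : M, GTan I x} {x : M} (h : SmoothGenAt I s x) :
    SmoothVFAt I (fun y => (s y).1) x := (smoothGenAt_iff.1 h).1

theorem SmoothGenAt.snd {s : ∀ x : M, GTan I x} {x : M} (h : SmoothGenAt I s x) :
    SmoothFormAt I (fun y => (s y).2) x := (smoothGenAt_iff.1 h).2

theorem SmoothGenAt.smul {g : M → ℝ} {s : ∀ x : M, GTan I x} {x : M}
    (hg : ContMDiffAt I 𝓘(ℝ, ℝ) ∞ g x) (hs : SmoothGenAt I s x) :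
    SmoothGenAt I (fun y => g y • s y) x :=
  ContMDiffAt.smul_section hg hs

theorem SmoothGenAt.add {s t : ∀ x : M, GTan I x} {x : M}
    (hs : SmoothGenAt I s x) (ht : SmoothGenAt I t x) : SmoothGenAt I (fun y => s y + t y) x :=
  ContMDiffAt.add_section hs ht

theorem SmoothGenAt.sum {ι : Type*} {a : Finset ι} {s : ι → ∀ x : M, GTan I x} {x : M}
    (hs : ∀ i ∈ a, SmoothGenAt I (s i) x) : SmoothGenAt I (fun y => ∑ i ∈ a, s i y) x :=
  ContMDiffAt.sum_section hs

section Pointwise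

variable {s t u : ∀ x : M, GTan I x} {x : M}

theorem SmoothGenAt.pair (hs : SmoothGenAt I s x) (ht : SmoothGenAt I t x) :
    ContMDiffAt I 𝓘(ℝ, ℝ) ∞ (fun y => (s y).2 (t y).1 - (t y).2 (s y).1) x :=
  (hs.snd.apply ht.fst).sub (ht.snd.apply hs.fst)

theorem SmoothGenAt.courantBracket (hs : ∀ᶠ y in 𝓝 x, SmoothGenAt I s y)
    (ht : ∀ᶠ y in 𝓝 x, SmoothGenAt I t y) : SmoothGenAt I (courantBracket I s t) x := by
  have hs1 := hs.mono fun y h => h.fst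
  have hs2 := hs.mono fun y h => h.snd
  have ht1 := ht.mono fun y h => h.fst
  have ht2 := ht.mono fun y h => h.snd
  refine smoothGenAt_iff.2 ⟨hs1.self_of_nhds.mlieBracket ht1.self_of_nhds, ?_⟩
  refine SmoothFormAt.add ((SmoothFormAt.lieDerivForm hs1 ht2).sub
    (SmoothFormAt.lieDerivForm ht1 hs2)) ?_
  exact SmoothFormAt.smul contMDiffAt_const
    (smoothFormAt_mvfderiv (hs.self_of_nhds.pair ht.self_of_nhds))

theorem courantBracket_skew (s t : ∀ x : M, GTan I x) (x : M) :
    courantBracket I s t x = -courantBracket I t s x := by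
  refine Prod.ext mlieBracket_swap_apply ?_
  have h : mvfderiv I (fun y => (s y).2 (t y).1 - (t y).2 (s y).1) x
      = -mvfderiv I (fun y => (t y).2 (s y).1 - (s y).2 (t y).1) x := by
    rw [← mvfderiv_neg]
    congr 1
    funext y
    simp
  simp only [courantBracket, h, Prod.snd_neg]
  rw [smul_neg]
  abel

theorem courantBracket_congr {s' t' : ∀ x : M, GTan I x} (hs : SmoothGenAt I s x)
    (ht : SmoothGenAt I t x) (hss' : ∀ᶠ y in 𝓝 x, s' y = s y) (htt' : ∀ᶠ y in 𝓝 x, t' y = t y) :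
    courantBracket I s' t' x = courantBracket I s t x := by
  have h1 : ∀ᶠ y in 𝓝 x, (s' y).1 = (s y).1 := hss'.mono fun y h => by rw [h]
  have h2 : ∀ᶠ y in 𝓝 x, (s' y).2 = (s y).2 := hss'.mono fun y h => by rw [h]
  have h3 : ∀ᶠ y in 𝓝 x, (t' y).1 = (t y).1 := htt'.mono fun y h => by rw [h]
  have h4 : ∀ᶠ y in 𝓝 x, (t' y).2 = (t y).2 := htt'.mono fun y h => by rw [h]
  refine Prod.ext (EventuallyEq.mlieBracket_vectorField_eq h1 h3) ?_
  simp only [courantBracket]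
  rw [lieDerivForm_congr hs.fst ht.snd h1 h4, lieDerivForm_congr ht.fst hs.snd h3 h2,
    mvfderiv_congr (g := fun y => (s y).2 (t y).1 - (t y).2 (s y).1)
      (by filter_upwards [hss', htt'] with y hy hy'; rw [hy, hy'])]

theorem courantBracket_add_right (hs : SmoothGenAt I s x) (ht : SmoothGenAt I t x)
    (hu : SmoothGenAt I u x) :
    courantBracket I s (fun y => t y + u y) x = courantBracket I s t x + courantBracket I s u x := by
  refine Prod.ext (mlieBracket_add_right_apply ht.fst hu.fst) ?_
  have h : mvfderiv I (fun y => (s y).2 (t y + u y).1 - (t y + u y).2 (s y).1) x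
      = mvfderiv I (fun y => (s y).2 (t y).1 - (t y).2 (s y).1) x
        + mvfderiv I (fun y => (s y).2 (u y).1 - (u y).2 (s y).1) x := by
    rw [← mvfderiv_add_of_smooth (hs.pair ht) (hs.pair hu)]
    congr 1
    funext y
    simp only [Prod.fst_add, Prod.snd_add, map_add, add_apply]
    ring
  have h1 := lieDerivForm_add_right hs.fst ht.snd hu.snd
  have h2 := lieDerivForm_add_left ht.fst hu.fst hs.snd
  simp only [courantBracket, Prod.snd_add] at h ⊢
  rw [h]
  erw [h1, h2]
  rw [smul_add]
  abel

theorem courantBracket_add_left (hs : SmoothGenAt I s x) (ht : SmoothGenAt I t x)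
    (hu : SmoothGenAt I u x) :
    courantBracket I (fun y => t y + u y) s x = courantBracket I t s x + courantBracket I u s x := by
  rw [courantBracket_skew, courantBracket_add_right hs ht hu, courantBracket_skew t,
    courantBracket_skew u]
  abel

/-- The Leibniz rule `[s, g t] = g [s, t] + ρ(s)(g) t - ⟨s, t⟩ dg`, for orthogonal `s` and `t`. -/
theorem courantBracket_smul_right {g : M → ℝ} (hs : SmoothGenAt I s x) (ht : SmoothGenAt I t x)
    (hg : ContMDiffAt I 𝓘(ℝ, ℝ) ∞ g x) (h0 : symPairing I (s x) (t x) = 0) :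
    courantBracket I s (fun y => g y • t y) x
      = g x • courantBracket I s t x + mvfderiv I g x (s x).1 • t x := by
  refine Prod.ext ?_ ?_
  · exact (mlieBracket_smul_right_apply hg ht.fst).trans (add_comm _ _)
  have h : mvfderiv I (fun y => (s y).2 (g y • t y).1 - (g y • t y).2 (s y).1) x
      = ((s x).2 (t x).1 - (t x).2 (s x).1) • mvfderiv I g x
        + g x • mvfderiv I (fun y => (s y).2 (t y).1 - (t y).2 (s y).1) x := by
    have e : (fun y => (s y).2 (g y • t y).1 - (g y • t y).2 (s y).1)
        = fun y => g y * ((s y).2 (t y).1 - (t y).2 (s y).1) := by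
      funext y
      simp only [Prod.smul_fst, Prod.smul_snd, map_smul, smul_apply, smul_eq_mul]
      ring
    rw [e]
    ext v
    rw [mvfderiv_mul_of_smooth hg (hs.pair ht)]
    simp only [add_apply, smul_apply, smul_eq_mul]
    ring
  have h1 := lieDerivForm_smul_right hs.fst hg ht.snd
  have h2 := lieDerivForm_smul_left ht.fst hg hs.snd
  -- The terms in `dg` add up to minus the symmetric pairing of `s x` and `t x`; orthogonality makes
  -- them cancel.
  have h3 : (t x).2 (s x).1 = -(s x).2 (t x).1 := by
    simp only [symPairing] at h0
    linarith
  simp only [courantBracket, Prod.snd_add, Prod.smul_snd] at h ⊢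
  rw [h]
  erw [h1, h2]
  rw [h3]
  ext v
  simp only [add_apply, sub_apply, smul_apply, smul_eq_mul]
  ring

theorem courantBracket_smul_left {g : M → ℝ} (hs : SmoothGenAt I s x) (ht : SmoothGenAt I t x)
    (hg : ContMDiffAt I 𝓘(ℝ, ℝ) ∞ g x) (h0 : symPairing I (s x) (t x) = 0) :
    courantBracket I (fun y => g y • s y) t x
      = g x • courantBracket I s t x - mvfderiv I g x (t x).1 • s x := by
  have h0' : symPairing I (t x) (s x) = 0 := by
    rw [← h0]; simp only [symPairing]; ring
  rw [courantBracket_skew, courantBracket_smul_right ht hs hg h0', courantBracket_skew s t]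
  rw [smul_neg]
  abel

theorem courantBracket_zero_right (s : ∀ x : M, GTan I x) (x : M) (hs : SmoothGenAt I s x) :
    courantBracket I s (fun _ => 0) x = 0 := by
  have h0 : SmoothGenAt I (fun y : M => (0 : GTan I y)) x := contMDiffAt_zeroSection ℝ _
  have h := courantBracket_add_right hs h0 h0
  simp only [add_zero] at h
  exact left_eq_add.1 h

theorem courantBracket_sum_right {ι : Type*} {a : Finset ι} {t : ι → ∀ x : M, GTan I x}
    (hs : SmoothGenAt I s x) (ht : ∀ i ∈ a, SmoothGenAt I (t i) x) :
    courantBracket I s (fun y => ∑ i ∈ a, t i y) x = ∑ i ∈ a, courantBracket I s (t i) x := by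
  classical
  induction a using Finset.induction_on with
  | empty => simpa using courantBracket_zero_right s x hs
  | insert i a ha ih =>
    simp only [Finset.sum_insert ha]
    rw [courantBracket_add_right hs (ht i (Finset.mem_insert_self i a))
      (SmoothGenAt.sum fun i hi => ht i (Finset.mem_insert_of_mem hi)),
      ih fun i hi => ht i (Finset.mem_insert_of_mem hi)]

/-- The Courant bracket of `∑ cᵢ sᵢ` and `t`, for sections `sᵢ` orthogonal to `t`. -/
theorem courantBracket_sum_smul_right {ι : Type*} [Fintype ι] {c : ι → M → ℝ}
    {t : ι → ∀ x : M, GTan I x}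
    (hs : SmoothGenAt I s x) (hc : ∀ i, ContMDiffAt I 𝓘(ℝ, ℝ) ∞ (c i) x)
    (ht : ∀ i, SmoothGenAt I (t i) x) (h0 : ∀ i, symPairing I (s x) (t i x) = 0) :
    courantBracket I s (fun y => ∑ i, c i y • t i y) x
      = ∑ i, c i x • courantBracket I s (t i) x + ∑ i, mvfderiv I (c i) x (s x).1 • t i x := by
  rw [courantBracket_sum_right hs fun i _ => SmoothGenAt.smul (hc i) (ht i),
    ← Finset.sum_add_distrib]
  exact Finset.sum_congr rfl fun i _ => courantBracket_smul_right hs (ht i) (hc i) (h0 i)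

theorem courantBracket_sum_smul_left {ι : Type*} [Fintype ι] {c : ι → M → ℝ}
    {t : ι → ∀ x : M, GTan I x}
    (hs : SmoothGenAt I s x) (hc : ∀ i, ContMDiffAt I 𝓘(ℝ, ℝ) ∞ (c i) x)
    (ht : ∀ i, SmoothGenAt I (t i) x) (h0 : ∀ i, symPairing I (t i x) (s x) = 0) :
    courantBracket I (fun y => ∑ i, c i y • t i y) s x
      = ∑ i, c i x • courantBracket I (t i) s x - ∑ i, mvfderiv I (c i) x (s x).1 • t i x := by
  have h0' : ∀ i, symPairing I (s x) (t i x) = 0 := fun i => by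
    rw [← h0 i]; simp only [symPairing]; ring
  rw [courantBracket_skew, courantBracket_sum_smul_right hs hc ht h0', neg_add,
    ← sub_eq_add_neg, ← Finset.sum_neg_distrib]
  congr 1
  refine Finset.sum_congr rfl fun i _ => ?_
  rw [courantBracket_skew (t i) s, smul_neg]

/-- The Courant bracket of two combinations of mutually orthogonal sections. -/
theorem courantBracket_expand {ι κ : Type*} [Fintype ι] [Fintype κ] {S T : ∀ x : M, GTan I x}
    {c : ι → M → ℝ} {d : κ → M → ℝ} {s : ι → ∀ x : M, GTan I x} {t : κ → ∀ x : M, GTan I x}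
    (hc : ∀ i, ContMDiffAt I 𝓘(ℝ, ℝ) ∞ (c i) x) (hd : ∀ j, ContMDiffAt I 𝓘(ℝ, ℝ) ∞ (d j) x)
    (hs : ∀ i, SmoothGenAt I (s i) x) (ht : ∀ j, SmoothGenAt I (t j) x)
    (h0 : ∀ i j, symPairing I (s i x) (t j x) = 0)
    (hS : ∀ᶠ y in 𝓝 x, S y = ∑ i, c i y • s i y) (hT : ∀ᶠ y in 𝓝 x, T y = ∑ j, d j y • t j y) :
    courantBracket I S T x
      = ∑ i, ∑ j, (c i x * d j x) • courantBracket I (s i) (t j) x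
        + ∑ j, mvfderiv I (d j) x (S x).1 • t j x - ∑ i, mvfderiv I (c i) x (T x).1 • s i x := by
  have hS' : SmoothGenAt I (fun y => ∑ i, c i y • s i y) x :=
    SmoothGenAt.sum fun i _ => SmoothGenAt.smul (hc i) (hs i)
  have hT' : SmoothGenAt I (fun y => ∑ j, d j y • t j y) x :=
    SmoothGenAt.sum fun i _ => SmoothGenAt.smul (hd i) (ht i)
  have hpair : ∀ (u : GTan I x) (r : κ → ℝ) (w : κ → GTan I x),
      symPairing I u (∑ j, r j • w j) = ∑ j, r j * symPairing I u (w j) := by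
    intro u r w
    simp only [symPairing, Prod.snd_sum, Prod.fst_sum, Prod.smul_fst, Prod.smul_snd, map_sum,
      map_smul, sum_apply, smul_apply, smul_eq_mul]
    rw [← Finset.sum_add_distrib, Finset.mul_sum]
    exact Finset.sum_congr rfl fun j _ => by ring
  rw [courantBracket_congr hS' hT' hS hT, hS.self_of_nhds, hT.self_of_nhds,
    courantBracket_sum_smul_left hT' hc hs (fun i => by
      rw [hpair]; simp [h0])]
  congr 1
  have h1 : ∀ i, courantBracket I (s i) (fun y => ∑ j, d j y • t j y) x
      = ∑ j, d j x • courantBracket I (s i) (t j) x + ∑ j, mvfderiv I (d j) x (s i x).1 • t j x :=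
    fun i => courantBracket_sum_smul_right (hs i) hd ht (h0 i)
  simp only [h1, smul_add, Finset.sum_add_distrib]
  congr 1
  · refine Finset.sum_congr rfl fun i _ => ?_
    rw [Finset.smul_sum]
    exact Finset.sum_congr rfl fun j _ => smul_smul _ _ _
  · simp only [Finset.smul_sum]
    rw [Finset.sum_comm]
    refine Finset.sum_congr rfl fun j _ => ?_
    simp only [Prod.fst_sum, map_sum, Prod.smul_fst, map_smul, smul_eq_mul, smul_smul,
      Finset.sum_smul]

end Pointwise

end Courant

/-! ### Naturality of brackets and Lie derivatives under related vector fields. -/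

section Related

variable {E : Type*} [NormedAddCommGroup E] [NormedSpace ℝ E] [FiniteDimensional ℝ E]
  {H : Type*} [TopologicalSpace H] {I : ModelWithCorners ℝ E H} [I.Boundaryless]
  {M : Type*} [TopologicalSpace M] [ChartedSpace H M] [IsManifold I ∞ M]
  {E' : Type*} [NormedAddCommGroup E'] [NormedSpace ℝ E'] [FiniteDimensional ℝ E']
  {H' : Type*} [TopologicalSpace H'] {J : ModelWithCorners ℝ E' H'} [J.Boundaryless]
  {N : Type*} [TopologicalSpace N] [ChartedSpace H' N] [IsManifold J ∞ N]

theorem mvfderiv_comp_smooth {f : N → ℝ} {ψ : M → N} {x : M}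
    (hf : ContMDiffAt J 𝓘(ℝ, ℝ) ∞ f (ψ x)) (hψ : ContMDiffAt I J ∞ ψ x) :
    mvfderiv I (fun y => f (ψ y)) x = (mvfderiv J f (ψ x)).comp (mfderiv I J ψ x) := by
  ext v
  exact mvfderiv_comp_apply x (hf.mdifferentiableAt (by simp)) (hψ.mdifferentiableAt (by simp)) v

theorem ContMDiffAt.comp_smooth {f : N → ℝ} {ψ : M → N} {x : M}
    (hf : ContMDiffAt J 𝓘(ℝ, ℝ) ∞ f (ψ x)) (hψ : ContMDiffAt I J ∞ ψ x) :
    ContMDiffAt I 𝓘(ℝ, ℝ) ∞ (fun y => f (ψ y)) x := hf.comp x hψ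

variable {ψ : M → N} {X₀ Y₀ : ∀ x : M, TangentSpace I x} {X Y : ∀ y : N, TangentSpace J y}
  {η : ∀ y : N, Cotan J y} {x : M}

/-- Brackets of related vector fields are related. -/
theorem mlieBracket_related (hψ : ∀ᶠ y in 𝓝 x, ContMDiffAt I J ∞ ψ y)
    (hX₀ : SmoothVFAt I X₀ x) (hY₀ : SmoothVFAt I Y₀ x)
    (hX : SmoothVFAt J X (ψ x)) (hY : SmoothVFAt J Y (ψ x))
    (rX : ∀ᶠ y in 𝓝 x, mfderiv I J ψ y (X₀ y) = X (ψ y))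
    (rY : ∀ᶠ y in 𝓝 x, mfderiv I J ψ y (Y₀ y) = Y (ψ y)) :
    mfderiv I J ψ x (mlieBracket I X₀ Y₀ x) = mlieBracket J X Y (ψ x) := by
  have hψx := hψ.self_of_nhds
  refine tangent_ext fun f hf => ?_
  have hfx := hf.self_of_nhds
  have hf' : ∀ᶠ y in 𝓝 x, ContMDiffAt J 𝓘(ℝ, ℝ) ∞ f (ψ y) := hψx.continuousAt.eventually hf
  -- Relatedness in terms of functions: the derivative of `f ∘ ψ` along the source field is the
  -- derivative of `f` along the target field, composed with `ψ`.
  have key : ∀ {Z₀ : ∀ x : M, TangentSpace I x} {Z : ∀ y : N, TangentSpace J y},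
      (∀ᶠ y in 𝓝 x, mfderiv I J ψ y (Z₀ y) = Z (ψ y)) →
      ∀ᶠ y in 𝓝 x, mvfderiv I (fun y => f (ψ y)) y (Z₀ y) = mvfderiv J f (ψ y) (Z (ψ y)) := by
    intro Z₀ Z hZ
    filter_upwards [hZ, hf', hψ] with y h1 h2 h3
    rw [mvfderiv_comp_smooth h2 h3, ← h1]; rfl
  have e1 : mvfderiv J f (ψ x) (mfderiv I J ψ x (mlieBracket I X₀ Y₀ x))
      = mvfderiv I (fun y => f (ψ y)) x (mlieBracket I X₀ Y₀ x) := by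
    rw [mvfderiv_comp_smooth hfx hψx]; rfl
  rw [e1, mvfderiv_mlieBracket hX₀ hY₀ (hfx.comp_smooth hψx), mvfderiv_mlieBracket hX hY hfx,
    mvfderiv_congr (key rX), mvfderiv_congr (key rY),
    mvfderiv_comp_smooth (f := fun z => mvfderiv J f z (Y z)) (contMDiffAt_mvfderiv_apply hY hfx) hψx,
    mvfderiv_comp_smooth (f := fun z => mvfderiv J f z (X z)) (contMDiffAt_mvfderiv_apply hX hfx) hψx,
    ← rX.self_of_nhds, ← rY.self_of_nhds]
  rfl

/-- A one-form is locally a sum of terms `g df`, and the pullback of such a term is `(g ∘ ψ) d(f ∘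
ψ)`. This reduces naturality for one-forms to the chain rule for functions. -/
theorem pullback_eq_sum (hψ : ∀ᶠ y in 𝓝 x, ContMDiffAt I J ∞ ψ y)
    (hη : SmoothFormAt J η (ψ x)) :
    ∃ (n : ℕ) (g f : Fin n → N → ℝ), (∀ k, ContMDiffAt J 𝓘(ℝ, ℝ) ∞ (g k) (ψ x)) ∧
      (∀ k, ∀ᶠ y in 𝓝 (ψ x), ContMDiffAt J 𝓘(ℝ, ℝ) ∞ (f k) y) ∧
      (∀ᶠ y in 𝓝 (ψ x), η y = ∑ k, g k y • mvfderiv J (f k) y) ∧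
      ∀ᶠ y in 𝓝 x, (η (ψ y)).comp (mfderiv I J ψ y)
        = ∑ k, g k (ψ y) • mvfderiv I (fun z => f k (ψ z)) y := by
  obtain ⟨n, g, f, hg, hf, h⟩ := exists_eq_sum_smul_mvfderiv hη
  refine ⟨n, g, f, hg, hf, h, ?_⟩
  have hc := hψ.self_of_nhds.continuousAt
  filter_upwards [hψ, hc.eventually h, hc.eventually (eventually_all.2 hf)] with y h1 h2 h3
  rw [h2]
  ext v
  simp only [mvfderiv_comp_smooth (h3 _) h1]
  change (∑ k, g k (ψ y) • mvfderiv J (f k) (ψ y)) (mfderiv I J ψ y v) = _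
  simp only [sum_apply, smul_apply]
  rfl

theorem SmoothFormAt.pullback (hψ : ∀ᶠ y in 𝓝 x, ContMDiffAt I J ∞ ψ y)
    (hη : SmoothFormAt J η (ψ x)) :
    SmoothFormAt I (fun y => (η (ψ y)).comp (mfderiv I J ψ y)) x := by
  obtain ⟨n, g, f, hg, hf, -, h⟩ := pullback_eq_sum hψ hη
  have hx := hψ.self_of_nhds
  refine SmoothFormAt.congr (SmoothFormAt.sum fun k _ => ?_) h
  exact SmoothFormAt.smul ((hg k).comp_smooth hx)
    (smoothFormAt_mvfderiv ((hf k).self_of_nhds.comp_smooth hx))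

theorem lieDerivForm_sum_right {ι : Type*} {s : Finset ι} {β : ι → ∀ x : M, Cotan I x}
    (hX : SmoothVFAt I X₀ x) (hβ : ∀ i ∈ s, SmoothFormAt I (β i) x) :
    lieDerivForm I X₀ (fun y => ∑ i ∈ s, β i y) x = ∑ i ∈ s, lieDerivForm I X₀ (β i) x := by
  refine cotan_ext fun Z hZ => ?_
  have hZx := hZ.self_of_nhds
  rw [lieDerivForm_apply hX (SmoothFormAt.sum hβ) hZx]
  simp only [sum_apply]
  rw [mvfderiv_sum_of_smooth fun i hi => (hβ i hi).apply hZx, sum_apply, ← Finset.sum_sub_distrib]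
  exact Finset.sum_congr rfl fun i hi => (lieDerivForm_apply hX (hβ i hi) hZx).symm

theorem lieDerivForm_sum_smul_mvfderiv {n : ℕ} {g f : Fin n → M → ℝ} (hX : SmoothVFAt I X₀ x)
    (hg : ∀ k, ContMDiffAt I 𝓘(ℝ, ℝ) ∞ (g k) x) (hf : ∀ k, ContMDiffAt I 𝓘(ℝ, ℝ) ∞ (f k) x) :
    lieDerivForm I X₀ (fun y => ∑ k, g k y • mvfderiv I (f k) y) x
      = ∑ k, (mvfderiv I (g k) x (X₀ x) • mvfderiv I (f k) x
        + g k x • mvfderiv I (fun y => mvfderiv I (f k) y (X₀ y)) x) := by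
  rw [lieDerivForm_sum_right (β := fun k y => g k y • mvfderiv I (f k) y) hX
    fun k _ => SmoothFormAt.smul (hg k) (smoothFormAt_mvfderiv (hf k))]
  refine Finset.sum_congr rfl fun k _ => ?_
  rw [lieDerivForm_smul_right hX (hg k) (smoothFormAt_mvfderiv (hf k)),
    lieDerivForm_mvfderiv hX (hf k)]

/-- The Lie derivative of one-forms is natural with respect to related vector fields. -/
theorem lieDerivForm_related (hψ : ∀ᶠ y in 𝓝 x, ContMDiffAt I J ∞ ψ y)
    (hX₀ : SmoothVFAt I X₀ x) (hX : SmoothVFAt J X (ψ x)) (hη : SmoothFormAt J η (ψ x))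
    (rX : ∀ᶠ y in 𝓝 x, mfderiv I J ψ y (X₀ y) = X (ψ y)) :
    lieDerivForm I X₀ (fun y => (η (ψ y)).comp (mfderiv I J ψ y)) x
      = (lieDerivForm J X η (ψ x)).comp (mfderiv I J ψ x) := by
  obtain ⟨n, g, f, hg, hf, h1, h2⟩ := pullback_eq_sum hψ hη
  have hx := hψ.self_of_nhds
  have hf0 := fun k => (hf k).self_of_nhds
  have s1 : SmoothFormAt I (fun y => ∑ k, g k (ψ y) • mvfderiv I (fun z => f k (ψ z)) y) x :=
    SmoothFormAt.sum fun k _ => SmoothFormAt.smul ((hg k).comp_smooth hx)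
      (smoothFormAt_mvfderiv ((hf0 k).comp_smooth hx))
  have s2 : SmoothFormAt J (fun y => ∑ k, g k y • mvfderiv J (f k) y) (ψ x) :=
    SmoothFormAt.sum fun k _ => SmoothFormAt.smul (hg k) (smoothFormAt_mvfderiv (hf0 k))
  rw [lieDerivForm_congr hX₀ s1 (Eventually.of_forall fun _ => rfl) h2,
    lieDerivForm_congr hX s2 (Eventually.of_forall fun _ => rfl) h1,
    lieDerivForm_sum_smul_mvfderiv (g := fun k y => g k (ψ y)) hX₀
      (fun k => (hg k).comp_smooth hx) (fun k => (hf0 k).comp_smooth hx),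
    lieDerivForm_sum_smul_mvfderiv hX hg hf0]
  -- On `df` the Lie derivative is the differential of the directional derivative, so relatedness
  -- applied to each `f k` is all that is needed.
  have e1 : ∀ k, mvfderiv I (fun y => mvfderiv I (fun z => f k (ψ z)) y (X₀ y)) x
      = (mvfderiv J (fun z => mvfderiv J (f k) z (X z)) (ψ x)).comp (mfderiv I J ψ x) := fun k => by
    rw [← mvfderiv_comp_smooth (contMDiffAt_mvfderiv_apply hX (hf0 k)) hx]
    refine mvfderiv_congr ?_
    filter_upwards [rX, hx.continuousAt.eventually (hf k), hψ] with y h1 h2 h3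
    rw [mvfderiv_comp_smooth h2 h3, ← h1]; rfl
  ext v
  simp only [e1, mvfderiv_comp_smooth (hf0 _) hx, mvfderiv_comp_smooth (hg _) hx]
  change _ = (∑ k, (mvfderiv J (g k) (ψ x) (X (ψ x)) • mvfderiv J (f k) (ψ x)
        + g k (ψ x) • mvfderiv J (fun y => mvfderiv J (f k) y (X y)) (ψ x))) (mfderiv I J ψ x v)
  simp only [sum_apply, add_apply, smul_apply, ← rX.self_of_nhds]
  rfl

end Related

/-! ### The Jacobi identity and the rank of a Dirac structure. -/

section Jacobi

variable {E : Type*} [NormedAddCommGroup E] [NormedSpace ℝ E] [FiniteDimensional ℝ E]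
  {H : Type*} [TopologicalSpace H] {I : ModelWithCorners ℝ E H} [I.Boundaryless]
  {M : Type*} [TopologicalSpace M] [ChartedSpace H M] [IsManifold I ∞ M]

theorem symPairing_eq_zero_iff {x : M} {u w : GTan I x} :
    symPairing I u w = 0 ↔ w.2 u.1 = - u.2 w.1 := by
  simp only [symPairing]
  constructor <;> intro h <;> linarith

/-- For orthogonal sections the two terms under the differential coincide, which absorbs the factor
one half. -/
theorem courantBracket_snd_of_isotropic {s t : ∀ x : M, GTan I x} {x : M}
    (hs : SmoothGenAt I s x) (ht : SmoothGenAt I t x)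
    (h : ∀ᶠ y in 𝓝 x, symPairing I (s y) (t y) = 0) :
    (courantBracket I s t x).2 = lieDerivForm I (fun y => (s y).1) (fun y => (t y).2) x
      - lieDerivForm I (fun y => (t y).1) (fun y => (s y).2) x
      + mvfderiv I (fun y => (s y).2 (t y).1) x := by
  have e : ∀ᶠ y in 𝓝 x, (s y).2 (t y).1 - (t y).2 (s y).1
      = (s y).2 (t y).1 + (s y).2 (t y).1 := by
    filter_upwards [h] with y hy
    rw [symPairing_eq_zero_iff.1 hy, sub_neg_eq_add]
  have h0 := hs.snd.apply ht.fst
  simp only [courantBracket]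
  rw [mvfderiv_congr e, mvfderiv_add_of_smooth h0 h0, ← two_smul ℝ, smul_smul]
  norm_num

variable {s₁ s₂ s₃ : ∀ x : M, GTan I x} {x : M}

/-- The cyclic sum is twice the pairing of `s₁` with `[s₂, s₃]`: expanding the Lie derivatives by
`lieDerivForm_apply` and moving signs by isotropy turns one into the other. It is the obstruction
function in the Jacobi identity. -/
theorem cyclic_cotangent_sum_eq_zero (h₁ : SmoothGenAt I s₁ x) (h₂ : SmoothGenAt I s₂ x)
    (h₃ : SmoothGenAt I s₃ x)
    (i₁₂ : ∀ᶠ y in 𝓝 x, symPairing I (s₁ y) (s₂ y) = 0)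
    (i₂₃ : ∀ᶠ y in 𝓝 x, symPairing I (s₂ y) (s₃ y) = 0)
    (i : symPairing I (s₁ x) (courantBracket I s₂ s₃ x) = 0) :
    (mvfderiv I (fun y => (s₂ y).2 (s₃ y).1) x (s₁ x).1
        + (s₁ x).2 (courantBracket I s₂ s₃ x).1)
      + (mvfderiv I (fun y => (s₃ y).2 (s₁ y).1) x (s₂ x).1
        + (s₂ x).2 (courantBracket I s₃ s₁ x).1)
      + (mvfderiv I (fun y => (s₁ y).2 (s₂ y).1) x (s₃ x).1
        + (s₃ x).2 (courantBracket I s₁ s₂ x).1) = 0 := by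
  rw [symPairing_eq_zero_iff, courantBracket_snd_of_isotropic h₂ h₃ i₂₃] at i
  simp only [add_apply, sub_apply] at i
  rw [lieDerivForm_apply h₂.fst h₃.snd h₁.fst, lieDerivForm_apply h₃.fst h₂.snd h₁.fst] at i
  have e : mvfderiv I (fun y => (s₂ y).2 (s₁ y).1) x = - mvfderiv I (fun y => (s₁ y).2 (s₂ y).1) x := by
    rw [← mvfderiv_neg]
    exact mvfderiv_congr (i₁₂.mono fun y hy => symPairing_eq_zero_iff.1 hy)
  rw [e, mlieBracket_swap_apply (V := fun y => (s₂ y).1) (W := fun y => (s₁ y).1)] at i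
  simp only [neg_apply, map_neg] at i
  simp only [courantBracket] at i ⊢
  linarith

/-- The Jacobi identity of the Courant bracket for three sections of an isotropic family that is
closed under the bracket. -/
theorem courantBracket_jacobi (h₁ : ∀ y, SmoothGenAt I s₁ y) (h₂ : ∀ y, SmoothGenAt I s₂ y)
    (h₃ : ∀ y, SmoothGenAt I s₃ y)
    (i₁₂ : ∀ y, symPairing I (s₁ y) (s₂ y) = 0) (i₂₃ : ∀ y, symPairing I (s₂ y) (s₃ y) = 0)
    (i₃₁ : ∀ y, symPairing I (s₃ y) (s₁ y) = 0)
    (j₁ : ∀ y, symPairing I (s₁ y) (courantBracket I s₂ s₃ y) = 0)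
    (j₂ : ∀ y, symPairing I (s₂ y) (courantBracket I s₃ s₁ y) = 0)
    (j₃ : ∀ y, symPairing I (s₃ y) (courantBracket I s₁ s₂ y) = 0) :
    courantBracket I s₁ (courantBracket I s₂ s₃) x
      + courantBracket I s₂ (courantBracket I s₃ s₁) x
      + courantBracket I s₃ (courantBracket I s₁ s₂) x = 0 := by
  have hb : ∀ {s t : ∀ x : M, GTan I x}, (∀ y, SmoothGenAt I s y) → (∀ y, SmoothGenAt I t y) →
      ∀ y, SmoothGenAt I (courantBracket I s t) y := fun hs ht y =>
    SmoothGenAt.courantBracket (Eventually.of_forall hs) (Eventually.of_forall ht)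
  refine Prod.ext ?_ ?_
  · have e1 := mlieBracket_jacobi (h₁ x).fst (h₂ x).fst (h₃ x).fst
    have e2 : mlieBracket I (fun y => (s₂ y).1)
        (mlieBracket I (fun y => (s₃ y).1) (fun y => (s₁ y).1)) x
        = - mlieBracket I (fun y => (s₂ y).1)
          (mlieBracket I (fun y => (s₁ y).1) (fun y => (s₃ y).1)) x := by
      rw [mlieBracket_swap (V := fun y => (s₃ y).1)]
      have := mlieBracket_smul_right_apply (I := I) (x := x) (g := fun _ => (-1 : ℝ))
        (X := fun y => (s₂ y).1) (Y := mlieBracket I (fun y => (s₁ y).1) (fun y => (s₃ y).1))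
        contMDiffAt_const (SmoothVFAt.mlieBracket (h₁ x).fst (h₃ x).fst)
      simp only [mvfderiv_const, neg_smul, one_smul, zero_apply, zero_smul, zero_add] at this
      exact this
    have e3 : mlieBracket I (fun y => (s₃ y).1)
        (mlieBracket I (fun y => (s₁ y).1) (fun y => (s₂ y).1)) x
        = - mlieBracket I (mlieBracket I (fun y => (s₁ y).1) (fun y => (s₂ y).1))
          (fun y => (s₃ y).1) x := mlieBracket_swap_apply
    change mlieBracket I (fun y => (s₁ y).1)
        (mlieBracket I (fun y => (s₂ y).1) (fun y => (s₃ y).1)) x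
      + mlieBracket I (fun y => (s₂ y).1)
        (mlieBracket I (fun y => (s₃ y).1) (fun y => (s₁ y).1)) x
      + mlieBracket I (fun y => (s₃ y).1)
        (mlieBracket I (fun y => (s₁ y).1) (fun y => (s₂ y).1)) x = 0
    rw [e1, e2, e3]
    abel
  -- The cotangent part of a double bracket consists of four iterated Lie derivatives and one exact
  -- term; the Lie derivative along a bracket has been split into a commutator.
  · have key : ∀ {r s t : ∀ x : M, GTan I x}, (∀ y, SmoothGenAt I r y) →
        (∀ y, SmoothGenAt I s y) → (∀ y, SmoothGenAt I t y) →
        (∀ y, symPairing I (s y) (t y) = 0) →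
        (∀ y, symPairing I (r y) (courantBracket I s t y) = 0) →
        (courantBracket I r (courantBracket I s t) x).2
          = lieDerivForm I (fun y => (r y).1) (lieDerivForm I (fun y => (s y).1) (fun y => (t y).2)) x
          - lieDerivForm I (fun y => (r y).1) (lieDerivForm I (fun y => (t y).1) (fun y => (s y).2)) x
          - (lieDerivForm I (fun y => (s y).1) (lieDerivForm I (fun y => (t y).1) (fun y => (r y).2)) x
          - lieDerivForm I (fun y => (t y).1) (lieDerivForm I (fun y => (s y).1) (fun y => (r y).2)) x)
          + mvfderiv I (fun y => mvfderiv I (fun y => (s y).2 (t y).1) y (r y).1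
            + (r y).2 (courantBracket I s t y).1) x := by
      intro r s t hr hs ht i j
      have c1 := fun y => (hs y).snd.apply (ht y).fst
      have l1 : ∀ y, SmoothFormAt I (lieDerivForm I (fun y => (s y).1) (fun y => (t y).2)) y :=
        fun y => SmoothFormAt.lieDerivForm (Eventually.of_forall fun y => (hs y).fst)
          (Eventually.of_forall fun y => (ht y).snd)
      have l2 : ∀ y, SmoothFormAt I (lieDerivForm I (fun y => (t y).1) (fun y => (s y).2)) y :=
        fun y => SmoothFormAt.lieDerivForm (Eventually.of_forall fun y => (ht y).fst)
          (Eventually.of_forall fun y => (hs y).snd)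
      have e : ∀ y, (courantBracket I s t y).2
          = lieDerivForm I (fun y => (s y).1) (fun y => (t y).2) y
            - lieDerivForm I (fun y => (t y).1) (fun y => (s y).2) y
            + mvfderiv I (fun y => (s y).2 (t y).1) y := fun y =>
        courantBracket_snd_of_isotropic (hs y) (ht y) (Eventually.of_forall i)
      rw [courantBracket_snd_of_isotropic (hr x) (hb hs ht x) (Eventually.of_forall j),
        mvfderiv_add_of_smooth (contMDiffAt_mvfderiv_apply (hr x).fst (c1 x))
          ((hr x).snd.apply (hb hs ht x).fst)]
      simp only [e]
      rw [lieDerivForm_add_right (hr x).fst (SmoothFormAt.sub (l1 x) (l2 x))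
          (smoothFormAt_mvfderiv (c1 x)), lieDerivForm_sub_right (hr x).fst (l1 x) (l2 x),
        lieDerivForm_mvfderiv (hr x).fst (c1 x)]
      have e2 := lieDerivForm_mlieBracket (x := x) (β := fun y => (r y).2)
        (Eventually.of_forall fun y => (hs y).fst) (Eventually.of_forall fun y => (ht y).fst)
        (Eventually.of_forall fun y => (hr y).snd)
      rw [← e2]
      change _ - lieDerivForm I (mlieBracket I (fun y => (s y).1) (fun y => (t y).1))
        (fun y => (r y).2) x + _ = _
      abel
    have f : ∀ {r s t : ∀ x : M, GTan I x}, (∀ y, SmoothGenAt I r y) →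
        (∀ y, SmoothGenAt I s y) → (∀ y, SmoothGenAt I t y) →
        ContMDiffAt I 𝓘(ℝ, ℝ) ∞ (fun y => mvfderiv I (fun y => (s y).2 (t y).1) y (r y).1
            + (r y).2 (courantBracket I s t y).1) x := fun hr hs ht =>
      (contMDiffAt_mvfderiv_apply (hr x).fst ((hs x).snd.apply (ht x).fst)).add
        ((hr x).snd.apply (hb hs ht x).fst)
    change (courantBracket I s₁ (courantBracket I s₂ s₃) x).2
      + (courantBracket I s₂ (courantBracket I s₃ s₁) x).2
      + (courantBracket I s₃ (courantBracket I s₁ s₂) x).2 = 0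
    rw [key h₁ h₂ h₃ i₂₃ j₁, key h₂ h₃ h₁ i₃₁ j₂, key h₃ h₁ h₂ i₁₂ j₃]
    -- In the cyclic sum each iterated Lie derivative occurs twice with opposite signs. What is left
    -- is the differential of the function of `cyclic_cotangent_sum_eq_zero`, which vanishes
    -- identically.
    have z := mvfderiv_congr (I := I) (x := x) (Eventually.of_forall fun y =>
      cyclic_cotangent_sum_eq_zero (h₁ y) (h₂ y) (h₃ y) (Eventually.of_forall i₁₂)
        (Eventually.of_forall i₂₃) (j₁ y))
    have z' := mvfderiv_add_of_smooth ((f h₁ h₂ h₃).add (f h₂ h₃ h₁)) (f h₃ h₁ h₂)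
    have z'' := mvfderiv_add_of_smooth (f h₁ h₂ h₃) (f h₂ h₃ h₁)
    have z₀ := (z'.symm.trans z).trans (mvfderiv_const 0)
    rw [show mvfderiv I (_ + _) x = _ from z''] at z₀
    rw [← z₀]
    abel

theorem DiracStructure.smoothGenAt (L : DiracStructure I M)
    (s : smoothSections I (GModel E) L.fiber) (x : M) : SmoothGenAt I s.1 x := s.2.1 x

theorem DiracStructure.symPairing_eq_zero (L : DiracStructure I M)
    (s t : smoothSections I (GModel E) L.fiber) (x : M) : symPairing I (s.1 x) (t.1 x) = 0 :=
  (L.maximal_isotropic x _).1 (s.2.2 x) _ (t.2.2 x)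

/-- A Dirac structure is a Lie algebroid. -/
theorem DiracStructure.isLieAlgebroid (L : DiracStructure I M) : IsLieAlgebroid L.algebroid where
  subbundle := L.subbundle
  anchor_smooth s x := (L.smoothGenAt s x).fst
  add_bracket s s' t := by
    ext1; funext x
    exact courantBracket_add_left (L.smoothGenAt t x) (L.smoothGenAt s x) (L.smoothGenAt s' x)
  smul_bracket c s t := by
    ext1; funext x
    have := courantBracket_smul_left (g := fun _ => c) (L.smoothGenAt s x) (L.smoothGenAt t x)
      contMDiffAt_const (L.symPairing_eq_zero s t x)
    simp only [mvfderiv_const, zero_apply, zero_smul, sub_zero] at this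
    exact this
  skew s t := by
    ext1; funext x
    exact courantBracket_skew s.1 t.1 x
  jacobi s t u := by
    ext1; funext x
    exact courantBracket_jacobi (L.smoothGenAt s) (L.smoothGenAt t) (L.smoothGenAt u)
      (L.symPairing_eq_zero s t) (L.symPairing_eq_zero t u) (L.symPairing_eq_zero u s)
      (L.symPairing_eq_zero s (L.algebroid.bracket t u))
      (L.symPairing_eq_zero t (L.algebroid.bracket u s))
      (L.symPairing_eq_zero u (L.algebroid.bracket s t))
  leibniz s t ft f hf hft x := by
    change courantBracket I s.1 ft.1 x = _
    rw [show ft.1 = fun y => f y • t.1 y from funext hft,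
      courantBracket_smul_right (L.smoothGenAt s x) (L.smoothGenAt t x) (hf x)
        (L.symPairing_eq_zero s t x)]
    rfl
  anchor_bracket s t x := rfl

/-- The symmetric pairing as a bilinear form. -/
def symPairingForm (x : M) : LinearMap.BilinForm ℝ (GTan I x) :=
  LinearMap.mk₂ ℝ (fun u w => symPairing I u w)
    (fun u u' w => by simp only [symPairing, Prod.snd_add, Prod.fst_add, map_add, add_apply]; ring)
    (fun c u w => by
      simp only [symPairing, Prod.smul_snd, Prod.smul_fst, map_smul, smul_apply, smul_eq_mul]; ring)
    (fun u w w' => by simp only [symPairing, Prod.snd_add, Prod.fst_add, map_add, add_apply]; ring)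
    (fun c u w => by
      simp only [symPairing, Prod.smul_snd, Prod.smul_fst, map_smul, smul_apply, smul_eq_mul]; ring)

theorem exists_cotan_ne_zero {x : M} {v : TangentSpace I x} (hv : v ≠ 0) :
    ∃ α : Cotan I x, α v ≠ 0 :=
  SeparatingDual.exists_ne_zero (R := ℝ) (V := E) hv

/-- A subspace equal to its own orthogonal for a nondegenerate form on a space of dimension `2n` has
dimension `n`. This supplies the rank needed for the top exterior power in the modular class. -/
theorem DiracStructure.finrank_fiber (L : DiracStructure I M) (x : M) :
    Module.finrank ℝ (L.fiber x) = Module.finrank ℝ E := by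
  have : FiniteDimensional ℝ (TangentSpace I x) := inferInstanceAs (FiniteDimensional ℝ E)
  have : FiniteDimensional ℝ (Cotan I x) := inferInstanceAs (FiniteDimensional ℝ (E →L[ℝ] ℝ))
  have hrefl : (symPairingForm x : LinearMap.BilinForm ℝ (GTan I x)).IsRefl := fun u w h => by
    change symPairing I u w = 0 at h
    change symPairing I w u = 0
    rw [← h]; simp only [symPairing]; ring
  have hnd : (symPairingForm x : LinearMap.BilinForm ℝ (GTan I x)).Nondegenerate := by
    refine hrefl.nondegenerate_iff_separatingLeft.2 fun u hu => ?_
    have hu' : ∀ w : GTan I x, w.2 u.1 + u.2 w.1 = 0 := fun w => by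
      have : symPairing I u w = 0 := hu w
      simp only [symPairing] at this
      linarith
    refine Prod.ext ?_ ?_
    · by_contra h
      obtain ⟨α, hα⟩ := exists_cotan_ne_zero h
      have := hu' (0, α)
      simp only [map_zero, add_zero] at this
      exact hα this
    · refine ContinuousLinearMap.ext fun v => ?_
      have := hu' (v, 0)
      simp only [zero_apply, zero_add] at this
      exact this
  have horth : (symPairingForm x).orthogonal (L.fiber x) = L.fiber x := by
    ext u
    rw [LinearMap.BilinForm.mem_orthogonal_iff, L.maximal_isotropic x u]
    refine forall₂_congr fun w _ => ?_
    change symPairing I w u = 0 ↔ _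
    simp only [symPairing]
    rw [add_comm]
  have h := LinearMap.BilinForm.finrank_orthogonal hnd (L.fiber x)
  rw [horth] at h
  have h2 : Module.finrank ℝ (GTan I x) = Module.finrank ℝ E + Module.finrank ℝ E := by
    rw [Module.finrank_prod]
    congr 1
    exact (LinearEquiv.finrank_eq (LinearMap.toContinuousLinearMap (𝕜 := ℝ) (E := E) (F' := ℝ))).symm.trans
      Subspace.dual_finrank_eq
  have h3 : Module.finrank ℝ (L.fiber x) ≤ Module.finrank ℝ (GTan I x) := Submodule.finrank_le _
  omega

end Jacobi

/-! ### Sections along a map, and the generalized tangent spaces of a product. -/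

section Along

variable {E : Type*} [NormedAddCommGroup E] [NormedSpace ℝ E] [FiniteDimensional ℝ E]
  {H : Type*} [TopologicalSpace H] {I : ModelWithCorners ℝ E H} [I.Boundaryless]
  {M : Type*} [TopologicalSpace M] [ChartedSpace H M] [IsManifold I ∞ M]
  {E' : Type*} [NormedAddCommGroup E'] [NormedSpace ℝ E'] [FiniteDimensional ℝ E']
  {H' : Type*} [TopologicalSpace H'] {J : ModelWithCorners ℝ E' H'} [J.Boundaryless]
  {N : Type*} [TopologicalSpace N] [ChartedSpace H' N] [IsManifold J ∞ N]
  {E'' : Type*} [NormedAddCommGroup E''] [NormedSpace ℝ E'']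
  {H'' : Type*} [TopologicalSpace H''] {K : ModelWithCorners ℝ E'' H''}
  {Q : Type*} [TopologicalSpace Q] [ChartedSpace H'' Q]

variable (K I) in
/-- The vector field `X` along the map `f` is smooth at `q`. -/
abbrev SmoothVFAlong (f : Q → M) (X : ∀ q, TangentSpace I (f q)) (q : Q) : Prop :=
  ContMDiffAt K (I.prod 𝓘(ℝ, E)) ∞
    (fun q => TotalSpace.mk' E (E := fun x : M => TangentSpace I x) (f q) (X q)) q

variable (K I) in
/-- The one-form `β` along the map `f` is smooth at `q`. -/
abbrev SmoothFormAlong (f : Q → M) (β : ∀ q, Cotan I (f q)) (q : Q) : Prop :=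
  ContMDiffAt K (I.prod 𝓘(ℝ, E →L[ℝ] ℝ)) ∞
    (fun q => TotalSpace.mk' (E →L[ℝ] ℝ) (E := fun x : M => Cotan I x) (f q) (β q)) q

variable (K I) in
/-- The section `s` of the generalized tangent bundle along the map `f` is smooth at `q`. -/
abbrev SmoothGenAlong (f : Q → M) (s : ∀ q, GTan I (f q)) (q : Q) : Prop :=
  ContMDiffAt K (I.prod 𝓘(ℝ, GModel E)) ∞
    (fun q => TotalSpace.mk' (GModel E) (E := fun x : M => GTan I x) (f q) (s q)) q

theorem smoothGenAlong_iff {f : Q → M} {s : ∀ q, GTan I (f q)} {q : Q} :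
    SmoothGenAlong I K f s q ↔
      SmoothVFAlong I K f (fun q => (s q).1) q ∧ SmoothFormAlong I K f (fun q => (s q).2) q :=
  contMDiffAt_prod_bundle_iff

theorem SmoothFormAlong.apply {f : Q → M} {β : ∀ q, Cotan I (f q)}
    {X : ∀ q, TangentSpace I (f q)} {q : Q} (hβ : SmoothFormAlong I K f β q)
    (hX : SmoothVFAlong I K f X q) : ContMDiffAt K 𝓘(ℝ, ℝ) ∞ (fun q => β q (X q)) q := by
  have h := ContMDiffAt.clm_bundle_apply (F₁ := E) (E₁ := fun x : M => TangentSpace I x)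
    (F₂ := ℝ) (E₂ := Bundle.Trivial M ℝ) (b := f) hβ hX
  exact (contMDiffAt_totalSpace.1 h).2

theorem SmoothVFAlong.comp {f : Q → M} {X : ∀ x, TangentSpace I x} {q : Q}
    (hX : SmoothVFAt I X (f q)) (hf : ContMDiffAt K I ∞ f q) :
    SmoothVFAlong I K f (fun q => X (f q)) q :=
  ContMDiffAt.comp q (g := fun x => TotalSpace.mk' E (E := fun x : M => TangentSpace I x) x (X x))
    hX hf

theorem SmoothGenAlong.comp {f : Q → M} {X : ∀ x, GTan I x} {q : Q}
    (hX : SmoothGenAt I X (f q)) (hf : ContMDiffAt K I ∞ f q) :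
    SmoothGenAlong I K f (fun q => X (f q)) q :=
  ContMDiffAt.comp q
    (g := fun x => TotalSpace.mk' (GModel E) (E := fun x : M => GTan I x) x (X x)) hX hf

/-- The components of a form along `f` are its values on the coordinate fields of one chart of `M`,
so testing against vector fields smooth at the image point suffices. -/
theorem smoothFormAlong_of_apply {f : Q → M} {β : ∀ q, Cotan I (f q)} {q : Q}
    (hf : ContMDiffAt K I ∞ f q)
    (h : ∀ Z : ∀ x : M, TangentSpace I x, SmoothVFAt I Z (f q) →
      ContMDiffAt K 𝓘(ℝ, ℝ) ∞ (fun y => β y (Z (f y))) q) : SmoothFormAlong I K f β q := by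
  rw [SmoothFormAlong, contMDiffAt_hom_bundle]
  refine ⟨hf, ?_⟩
  let b := Module.finBasis ℝ E
  have h1 : ∀ᶠ y in 𝓝 q, ContinuousLinearMap.inCoordinates E (fun x : M => TangentSpace I x) ℝ
      (Bundle.Trivial M ℝ) (f q) (f y) (f q) (f y) (β y)
      = ∑ i, (β y (coordVF (f q) (b i) (f y))) • LinearMap.toContinuousLinearMap (b.coord i) := by
    filter_upwards [hf.continuousAt.eventually (eventually_mem_chart (H := H) (f q))] with y hy
    ext v
    have e : ContinuousLinearMap.inCoordinates E (fun x : M => TangentSpace I x) ℝ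
      (Bundle.Trivial M ℝ) (f q) (f y) (f q) (f y) (β y) v = β y (coordVF (f q) v (f y)) := by
      simp [ContinuousLinearMap.inCoordinates, coordVF]
    rw [e]
    have : coordVF (I := I) (f q) v (f y)
        = ∑ i, b.repr v i • coordVF (I := I) (f q) (b i) (f y) := by
      conv_lhs => rw [← b.sum_repr v]
      simp only [coordVF, map_sum, map_smul]
    rw [this]
    simp only [map_sum, map_smul, sum_apply, smul_eq_mul]
    refine Finset.sum_congr rfl fun i _ => ?_
    exact mul_comm _ _
  refine ContMDiffAt.congr_of_eventuallyEq ?_ h1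
  refine ContMDiffAt.sum fun i _ => ?_
  exact (h _ (smoothVFAt_coordVF (mem_chart_source H (f q)) (b i))).smul contMDiffAt_const

theorem SmoothVFAlong.mfderiv {ψ : M → N} (hψ : ContMDiff I J ∞ ψ) {f : Q → M}
    {X : ∀ q, TangentSpace I (f q)} {q : Q} (hX : SmoothVFAlong I K f X q) :
    SmoothVFAlong J K (fun q => ψ (f q)) (fun q => mfderiv I J ψ (f q) (X q)) q :=
  ContMDiffAt.comp q (g := tangentMap I J ψ)
    (hψ.contMDiff_tangentMap (m := ∞) (n := ∞) (by simp)).contMDiffAt hX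

theorem SmoothVFAlong.prodMk {f : Q → M} {g : Q → N} {X : ∀ q, TangentSpace I (f q)}
    {Y : ∀ q, TangentSpace J (g q)} {q : Q} (hX : SmoothVFAlong I K f X q)
    (hY : SmoothVFAlong J K g Y q) :
    SmoothVFAlong (I.prod J) K (fun q => (f q, g q))
      (fun q => (show TangentSpace (I.prod J) ((f q, g q) : M × N) from (X q, Y q))) q :=
  ContMDiffAt.comp q (g := (equivTangentBundleProd I M J N).symm)
    (contMDiff_equivTangentBundleProd_symm (n := ∞)).contMDiffAt (ContMDiffAt.prodMk hX hY)

section toProd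

variable {x : M} {y : N}

theorem toProdGTan_snd_apply (u : GTan I x) (w : GTan J y) (v : TangentSpace I x)
    (v' : TangentSpace J y) :
    (toProdGTan u w).2 (show TangentSpace (I.prod J) ((x, y) : M × N) from (v, v'))
      = u.2 v - w.2 v' := by
  simp only [toProdGTan, mfderiv_fst, mfderiv_snd]
  rfl

theorem toProdGTan_add (u u' : GTan I x) (w w' : GTan J y) :
    toProdGTan (u + u') (w + w') = toProdGTan u w + toProdGTan u' w' := by
  refine Prod.ext rfl ?_
  refine ContinuousLinearMap.ext fun ⟨v, v'⟩ => ?_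
  refine (toProdGTan_snd_apply _ _ v v').trans ?_
  refine Eq.trans ?_ (congrArg₂ (· + ·) (toProdGTan_snd_apply u w v v')
    (toProdGTan_snd_apply u' w' v v')).symm
  change u.2 v + u'.2 v - (w.2 v' + w'.2 v') = (u.2 v - w.2 v') + (u'.2 v - w'.2 v')
  ring

theorem toProdGTan_smul (c : ℝ) (u : GTan I x) (w : GTan J y) :
    toProdGTan (c • u) (c • w) = c • toProdGTan u w := by
  refine Prod.ext rfl ?_
  refine ContinuousLinearMap.ext fun ⟨v, v'⟩ => ?_
  refine (toProdGTan_snd_apply _ _ v v').trans ?_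
  refine Eq.trans ?_ (congrArg (c * ·) (toProdGTan_snd_apply u w v v')).symm
  change c * u.2 v - c * w.2 v' = c * (u.2 v - w.2 v')
  ring

variable (I J x y) in
/-- The identification of generalized tangent spaces of a product as a linear equivalence. -/
def toProdEquiv : (GTan I x × GTan J y) ≃ₗ[ℝ] GTan (I.prod J) ((x, y) : M × N) where
  toFun p := toProdGTan p.1 p.2
  map_add' p p' := toProdGTan_add p.1 p'.1 p.2 p'.2
  map_smul' c p := toProdGTan_smul c p.1 p.2
  invFun Z := (((show E × E' from Z.1).1,
      (show E × E' →L[ℝ] ℝ from Z.2).comp (ContinuousLinearMap.inl ℝ E E')),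
    ((show E × E' from Z.1).2, - (show E × E' →L[ℝ] ℝ from Z.2).comp (ContinuousLinearMap.inr ℝ E E')))
  left_inv p := by
    obtain ⟨⟨a, α⟩, ⟨b, β⟩⟩ := p
    refine Prod.ext (Prod.ext rfl ?_) (Prod.ext rfl ?_)
    · refine ContinuousLinearMap.ext fun v => ?_
      have := toProdGTan_snd_apply (a, α) (b, β) v 0
      simp only [map_zero, sub_zero] at this
      exact this
    · refine ContinuousLinearMap.ext fun v => ?_
      have := toProdGTan_snd_apply (a, α) (b, β) 0 v
      simp only [map_zero, zero_sub] at this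
      exact neg_eq_iff_eq_neg.2 this
  right_inv Z := by
    refine Prod.ext rfl ?_
    refine ContinuousLinearMap.ext fun ⟨v, v'⟩ => ?_
    refine (toProdGTan_snd_apply _ _ v v').trans ?_
    change (show E × E' →L[ℝ] ℝ from Z.2) (v, 0) - -((show E × E' →L[ℝ] ℝ from Z.2) (0, v'))
      = (show E × E' →L[ℝ] ℝ from Z.2) (v, v')
    rw [sub_neg_eq_add, ← map_add]
    simp

theorem toProdGTan_injective {u u' : GTan I x} {w w' : GTan J y}
    (h : toProdGTan u w = toProdGTan u' w') : u = u' ∧ w = w' := by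
  have := (toProdEquiv I J x y).injective (a₁ := (u, w)) (a₂ := (u', w')) h
  exact ⟨congrArg Prod.fst this, congrArg Prod.snd this⟩

theorem exists_toProdGTan_eq (Z : GTan (I.prod J) ((x, y) : M × N)) :
    ∃ (u : GTan I x) (w : GTan J y), toProdGTan u w = Z := by
  obtain ⟨p, hp⟩ := (toProdEquiv I J x y).surjective Z
  exact ⟨p.1, p.2, hp⟩

/-- The sign in the identification makes the pairing of the product a difference. Hence `Γ^φ` is
isotropic, while a product of two self-orthogonal subspaces is still self-orthogonal. -/
theorem symPairing_toProdGTan (u u' : GTan I x) (w w' : GTan J y) :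
    symPairing (I.prod J) (toProdGTan u w) (toProdGTan u' w')
      = symPairing I u u' - symPairing J w w' := by
  have e1 := toProdGTan_snd_apply u w u'.1 w'.1
  have e2 := toProdGTan_snd_apply u' w' u.1 w.1
  change (1 / 2 : ℝ) * ((toProdGTan u' w').2 (show TangentSpace (I.prod J) ((x, y) : M × N) from
    (u.1, w.1)) + (toProdGTan u w).2 (show TangentSpace (I.prod J) ((x, y) : M × N) from
    (u'.1, w'.1))) = _
  rw [e1, e2]
  simp only [symPairing]
  ring

end toProd

theorem smoothGenAlong_toProdGTan {f : Q → M} {g : Q → N} {u : ∀ q, GTan I (f q)}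
    {w : ∀ q, GTan J (g q)} {q : Q} (hu : SmoothGenAlong I K f u q)
    (hw : SmoothGenAlong J K g w q) :
    SmoothGenAlong (I.prod J) K (fun q => ((f q, g q) : M × N)) (fun q => toProdGTan (u q) (w q)) q := by
  obtain ⟨hu1, hu2⟩ := smoothGenAlong_iff.1 hu
  obtain ⟨hw1, hw2⟩ := smoothGenAlong_iff.1 hw
  have hf : ContMDiffAt K I ∞ f q := (contMDiffAt_totalSpace.1 hu1).1
  have hg : ContMDiffAt K J ∞ g q := (contMDiffAt_totalSpace.1 hw1).1
  refine smoothGenAlong_iff.2 ⟨SmoothVFAlong.prodMk hu1 hw1, ?_⟩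
  refine smoothFormAlong_of_apply (hf.prodMk hg) fun Z hZ => ?_
  have hZ' : SmoothVFAlong (I.prod J) K (fun q => ((f q, g q) : M × N)) (fun q => Z (f q, g q)) q :=
    SmoothVFAlong.comp (f := fun q => ((f q, g q) : M × N)) hZ (hf.prodMk hg)
  have h1 := SmoothVFAlong.mfderiv (ψ := (Prod.fst : M × N → M)) contMDiff_fst hZ'
  have h2 := SmoothVFAlong.mfderiv (ψ := (Prod.snd : M × N → N)) contMDiff_snd hZ'
  have h3 := SmoothFormAlong.apply hu2 h1
  have h4 := SmoothFormAlong.apply hw2 h2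
  exact h3.sub h4

/-- The vector parts are recovered by the differentials of the two projections, and the covector
parts by evaluating on fields that are zero in the other factor. -/
theorem smoothGenAlong_of_toProdGTan {f : Q → M} {g : Q → N} {u : ∀ q, GTan I (f q)}
    {w : ∀ q, GTan J (g q)} {q : Q}
    (h : SmoothGenAlong (I.prod J) K (fun q => ((f q, g q) : M × N))
      (fun q => toProdGTan (u q) (w q)) q) :
    SmoothGenAlong I K f u q ∧ SmoothGenAlong J K g w q := by
  obtain ⟨h1, h2⟩ := smoothGenAlong_iff.1 h
  have hfg : ContMDiffAt K (I.prod J) ∞ (fun q => ((f q, g q) : M × N)) q :=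
    (contMDiffAt_totalSpace.1 h1).1
  have hf : ContMDiffAt K I ∞ f q := contMDiffAt_fst.comp q hfg
  have hg : ContMDiffAt K J ∞ g q := contMDiffAt_snd.comp q hfg
  have v1 := SmoothVFAlong.mfderiv (ψ := (Prod.fst : M × N → M)) contMDiff_fst h1
  have v2 := SmoothVFAlong.mfderiv (ψ := (Prod.snd : M × N → N)) contMDiff_snd h1
  have z1 : SmoothVFAlong I K f (fun q => (0 : TangentSpace I (f q))) q :=
    SmoothVFAlong.comp (X := fun x => (0 : TangentSpace I x))
      (contMDiff_zeroSection ℝ (TangentSpace I : M → Type _)).contMDiffAt hf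
  have z2 : SmoothVFAlong J K g (fun q => (0 : TangentSpace J (g q))) q :=
    SmoothVFAlong.comp (X := fun x => (0 : TangentSpace J x))
      (contMDiff_zeroSection ℝ (TangentSpace J : N → Type _)).contMDiffAt hg
  refine ⟨smoothGenAlong_iff.2 ⟨?_, smoothFormAlong_of_apply hf fun Z hZ => ?_⟩,
    smoothGenAlong_iff.2 ⟨?_, smoothFormAlong_of_apply hg fun Z hZ => ?_⟩⟩
  · simp only [mfderiv_fst] at v1; exact v1
  · have := SmoothFormAlong.apply h2 (SmoothVFAlong.prodMk (SmoothVFAlong.comp hZ hf) z2)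
    refine this.congr_of_eventuallyEq (Eventually.of_forall fun q => ?_)
    refine Eq.trans ?_ (toProdGTan_snd_apply (u q) (w q) (Z (f q)) 0).symm
    simp
  · simp only [mfderiv_snd] at v2; exact v2
  · have := (SmoothFormAlong.apply h2 (SmoothVFAlong.prodMk z1 (SmoothVFAlong.comp hZ hg))).neg
    refine this.congr_of_eventuallyEq (Eventually.of_forall fun q => ?_)
    refine Eq.trans ?_ (congrArg Neg.neg (toProdGTan_snd_apply (u q) (w q) 0 (Z (g q)))).symm
    simp

end Along

section ProductBracket

variable {E : Type*} [NormedAddCommGroup E] [NormedSpace ℝ E] [FiniteDimensional ℝ E]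
  {H : Type*} [TopologicalSpace H] {I : ModelWithCorners ℝ E H} [I.Boundaryless]
  {M : Type*} [TopologicalSpace M] [ChartedSpace H M] [IsManifold I ∞ M]
  {E' : Type*} [NormedAddCommGroup E'] [NormedSpace ℝ E'] [FiniteDimensional ℝ E']
  {H' : Type*} [TopologicalSpace H'] {J : ModelWithCorners ℝ E' H'} [J.Boundaryless]
  {N : Type*} [TopologicalSpace N] [ChartedSpace H' N] [IsManifold J ∞ N]

/-! ### The graph and `Γ^φ` -/

/-- The embedding of `M` as the graph of `φ`. -/
def graphMap (φ : C^∞⟮I, M; J, N⟯) (x : M) : M × N := (x, φ x)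

theorem contMDiff_graphMap (φ : C^∞⟮I, M; J, N⟯) : ContMDiff I (I.prod J) ∞ (graphMap φ) :=
  contMDiff_id.prodMk φ.contMDiff

theorem mfderiv_graphMap (φ : C^∞⟮I, M; J, N⟯) (x : M) (v : TangentSpace I x) :
    mfderiv I (I.prod J) (graphMap φ) x v
      = (show TangentSpace (I.prod J) ((x, φ x) : M × N) from (v, mfderiv I J φ x v)) := by
  have h : mfderiv I (I.prod J) (graphMap φ) x
      = (mfderiv I I (fun x : M => x) x).prod (mfderiv I J φ x) :=
    mfderiv_prodMk (f := fun x : M => x) mdifferentiableAt_id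
      (φ.contMDiff.contMDiffAt.mdifferentiableAt (by simp))
  rw [h]
  have h2 : mfderiv I I (fun x : M => x) x = ContinuousLinearMap.id ℝ (TangentSpace I x) :=
    mfderiv_id
  rw [h2]
  rfl

/-- `Z` is the sum of a vector tangent to the graph of `φ` and a covector vanishing on it. -/
def GraphTangent (φ : C^∞⟮I, M; J, N⟯) (x : M) (Z : GTan (I.prod J) ((x, φ x) : M × N)) : Prop :=
  (∃ v : TangentSpace I x, Z.1 = mfderiv I (I.prod J) (graphMap φ) x v) ∧
    (Z.2 : TangentSpace (I.prod J) (graphMap φ x) →L[ℝ] ℝ).comp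
      (mfderiv I (I.prod J) (graphMap φ) x) = 0

/-- The covector of the product attached to `a` and `α` takes the value `a(v) - α(φ_* v)` on the
tangent vector `(v, φ_* v)` of the graph, so it annihilates the graph exactly when `a = φ^*α`. -/
theorem graphTangent_iff {φ : C^∞⟮I, M; J, N⟯} {x : M} {s : GTanGraph φ x} :
    GraphTangent φ x (toProdGTan s.1 s.2) ↔ s ∈ gammaGraph φ x := by
  obtain ⟨⟨v, a⟩, ⟨w, α⟩⟩ := s
  have hc : ∀ v' : TangentSpace I x, ((toProdGTan (x := x) (y := φ x) ((v, a) : GTan I x)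
      ((w, α) : GTan J (φ x))).2 :
      TangentSpace (I.prod J) (graphMap φ x) →L[ℝ] ℝ) (mfderiv I (I.prod J) (graphMap φ) x v')
      = a v' - α (mfderiv I J φ x v') := fun v' => by
    rw [mfderiv_graphMap]
    exact toProdGTan_snd_apply ((v, a) : GTan I x) ((w, α) : GTan J (φ x)) v' (mfderiv I J φ x v')
  constructor
  · rintro ⟨⟨v', h1⟩, h2⟩
    rw [mfderiv_graphMap] at h1
    have h1' : ((v, w) : E × E') = (v', mfderiv I J φ x v') := h1
    have h1a : v = v' := congrArg Prod.fst h1'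
    have h1b : w = mfderiv I J φ x v' := congrArg Prod.snd h1'
    subst h1a
    have h3 : a = coPull φ x α := ContinuousLinearMap.ext fun v' => by
      have := (hc v').symm.trans (congrArg (fun T => T v') h2)
      exact sub_eq_zero.1 this
    exact ⟨v, α, by rw [h3, h1b]; rfl⟩
  · rintro ⟨v', β, h⟩
    obtain ⟨h1, h2⟩ := Prod.ext_iff.1 h
    obtain ⟨rfl, h1⟩ := Prod.ext_iff.1 h1
    obtain ⟨h3, h4⟩ := Prod.ext_iff.1 h2
    have h3' : w = mfderiv I J φ x v := h3
    have h4' : α = β := h4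
    have h1' : a = coPull φ x β := h1
    subst h4'
    refine ⟨⟨v, ?_⟩, ContinuousLinearMap.ext fun v' => ?_⟩
    · rw [mfderiv_graphMap]
      change ((v, w) : E × E') = (v, mfderiv I J φ x v)
      rw [h3']
      rfl
    · refine (hc v').trans ?_
      rw [h1']
      exact sub_self _

theorem lieDerivForm_zero_right {X : ∀ x : M, TangentSpace I x} {x : M} (hX : SmoothVFAt I X x) :
    lieDerivForm I X (fun _ => 0) x = 0 := by
  have := lieDerivForm_smul_right (I := I) (x := x) (X := X) (g := fun _ => (0 : ℝ))
    (β := fun _ => 0) hX contMDiffAt_const (contMDiff_zeroSection ℝ (fun x : M => Cotan I x) x)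
  simpa using this

/-- The bracket of sections tangent to the graph is tangent to the graph. -/
theorem GraphTangent.courantBracket {φ : C^∞⟮I, M; J, N⟯} {x : M}
    {S T : ∀ p : M × N, GTan (I.prod J) p} (hS : SmoothGenAt (I.prod J) S (x, φ x))
    (hT : SmoothGenAt (I.prod J) T (x, φ x))
    (tS : ∀ᶠ y in 𝓝 x, GraphTangent φ y (S (y, φ y)))
    (tT : ∀ᶠ y in 𝓝 x, GraphTangent φ y (T (y, φ y))) :
    GraphTangent φ x (courantBracket (I.prod J) S T (x, φ x)) := by
  have hι : ∀ y, ContMDiffAt I (I.prod J) ∞ (graphMap φ) y := contMDiff_graphMap φ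
  have hι' : ∀ᶠ y in 𝓝 x, ContMDiffAt I (I.prod J) ∞ (graphMap φ) y := Eventually.of_forall hι
  have key : ∀ {Z : ∀ p : M × N, GTan (I.prod J) p}, SmoothGenAt (I.prod J) Z (x, φ x) →
      (∀ᶠ y in 𝓝 x, GraphTangent φ y (Z (y, φ y))) →
      ∃ X₀ : ∀ x : M, TangentSpace I x, SmoothVFAt I X₀ x ∧
        ∀ᶠ y in 𝓝 x, mfderiv I (I.prod J) (graphMap φ) y (X₀ y) = (Z (graphMap φ y)).1 := by
    intro Z hZ tZ
    -- The related vector field on `M` is read off by the first projection, a left inverse of the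
    -- graph embedding.
    refine ⟨fun y => mfderiv (I.prod J) I Prod.fst (y, φ y) (Z (y, φ y)).1, ?_, ?_⟩
    · exact SmoothVFAlong.mfderiv (ψ := (Prod.fst : M × N → M)) contMDiff_fst
        (SmoothVFAlong.comp (f := graphMap φ) hZ.fst (hι x))
    · filter_upwards [tZ] with y hy
      obtain ⟨⟨v, hv⟩, -⟩ := hy
      have e : mfderiv (I.prod J) I Prod.fst (y, φ y) (Z (y, φ y)).1 = v := by
        rw [hv, mfderiv_fst, mfderiv_graphMap]
        rfl
      rw [e]
      exact hv.symm
  obtain ⟨X₀, sX₀, rX⟩ := key hS tS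
  obtain ⟨Y₀, sY₀, rY⟩ := key hT tT
  have kf : ∀ {Z : ∀ p : M × N, GTan (I.prod J) p},
      (∀ᶠ y in 𝓝 x, GraphTangent φ y (Z (y, φ y))) → ∀ᶠ y in 𝓝 x,
        ((Z (graphMap φ y)).2).comp (mfderiv I (I.prod J) (graphMap φ) y) = 0 :=
    fun tZ => tZ.mono fun y hy => hy.2
  have z0 : ∀ x : M, SmoothFormAt I (fun _ => 0) x :=
    contMDiff_zeroSection ℝ (fun x : M => Cotan I x)
  -- By naturality the pullback of this Lie derivative to `M` is a Lie derivative of the pulled back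
  -- form, which is zero near `x`.
  have e1 : (lieDerivForm (I.prod J) (fun p => (S p).1) (fun p => (T p).2) (graphMap φ x)).comp
      (mfderiv I (I.prod J) (graphMap φ) x) = 0 := by
    rw [← lieDerivForm_related hι' sX₀ hS.fst hT.snd rX,
      lieDerivForm_congr sX₀ (z0 x) (Eventually.of_forall fun _ => rfl) (kf tT),
      lieDerivForm_zero_right sX₀]
  have e2 : (lieDerivForm (I.prod J) (fun p => (T p).1) (fun p => (S p).2) (graphMap φ x)).comp
      (mfderiv I (I.prod J) (graphMap φ) x) = 0 := by
    rw [← lieDerivForm_related hι' sY₀ hT.fst hS.snd rY,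
      lieDerivForm_congr sY₀ (z0 x) (Eventually.of_forall fun _ => rfl) (kf tS),
      lieDerivForm_zero_right sY₀]
  -- Along the graph the covector parts annihilate the tangent vector parts, so the function being
  -- differentiated vanishes there.
  have e3 : (mvfderiv (I.prod J) (fun p => (S p).2 (T p).1 - (T p).2 (S p).1) (graphMap φ x)).comp
      (mfderiv I (I.prod J) (graphMap φ) x) = 0 := by
    rw [← mvfderiv_comp_smooth (ψ := graphMap φ) (SmoothGenAt.pair hS hT) (hι x)]
    have : ∀ᶠ y in 𝓝 x, (S (graphMap φ y)).2 (T (graphMap φ y)).1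
        - (T (graphMap φ y)).2 (S (graphMap φ y)).1 = 0 := by
      filter_upwards [rX, rY, kf tS, kf tT] with y h1 h2 h3 h4
      rw [← h1, ← h2]
      have h3' := congrArg (fun T => T (Y₀ y)) h3
      have h4' := congrArg (fun T => T (X₀ y)) h4
      exact (congrArg₂ (· - ·) h3' h4').trans (sub_zero _)
    rw [mvfderiv_congr this, mvfderiv_const]
  refine ⟨⟨mlieBracket I X₀ Y₀ x, ?_⟩, ?_⟩
  · exact (mlieBracket_related hι' sX₀ sY₀ hS.fst hT.fst rX rY).symm
  · refine ContinuousLinearMap.ext fun v => ?_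
    have h1 := congrArg (fun T => T v) e1
    have h2 := congrArg (fun T => T v) e2
    have h3 := congrArg (fun T => T v) e3
    refine (congrArg₂ (· + ·) (congrArg₂ (· - ·) h1 h2)
      (congrArg (fun r => (1 / 2 : ℝ) * r) h3)).trans ?_
    simp

theorem gammaInvolutive (φ : C^∞⟮I, M; J, N⟯) : GammaInvolutive φ := by
  rintro S T hS hT ⟨s, hs, rs⟩ ⟨t, ht, rt⟩
  have h : ∀ x, GraphTangent φ x (_root_.courantBracket (I.prod J) S T (x, φ x)) := fun x =>
    GraphTangent.courantBracket (hS (x, φ x)) (hT (x, φ x))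
      (Eventually.of_forall fun y => by rw [rs y]; exact graphTangent_iff.2 (hs y))
      (Eventually.of_forall fun y => by rw [rt y]; exact graphTangent_iff.2 (ht y))
  choose u w huw using fun x => exists_toProdGTan_eq (courantBracket (I.prod J) S T (x, φ x))
  refine ⟨fun x => (u x, w x), fun x => ?_, fun x => (huw x).symm⟩
  rw [← graphTangent_iff]
  change GraphTangent φ x (toProdGTan (u x) (w x))
  rw [huw]
  exact h x

/-! ### Courant brackets on a product -/

/-- Each projection relates the vector part on the product to that on a factor, and the covector
part is the difference of the two pullbacks, so naturality under both projections gives the bracket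
componentwise. -/
theorem courantBracket_toProdGTan {u u' : ∀ x : M, GTan I x} {w w' : ∀ y : N, GTan J y}
    {p : M × N} (hu : ∀ᶠ x in 𝓝 p.1, SmoothGenAt I u x) (hu' : ∀ᶠ x in 𝓝 p.1, SmoothGenAt I u' x)
    (hw : ∀ᶠ y in 𝓝 p.2, SmoothGenAt J w y) (hw' : ∀ᶠ y in 𝓝 p.2, SmoothGenAt J w' y) :
    courantBracket (I.prod J) (fun p => toProdGTan (u p.1) (w p.2))
        (fun p => toProdGTan (u' p.1) (w' p.2)) p
      = toProdGTan (courantBracket I u u' p.1) (courantBracket J w w' p.2) := by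
  have hf : ∀ᶠ q in 𝓝 p, ContMDiffAt (I.prod J) I ∞ (Prod.fst : M × N → M) q :=
    Eventually.of_forall fun _ => contMDiffAt_fst
  have hg : ∀ᶠ q in 𝓝 p, ContMDiffAt (I.prod J) J ∞ (Prod.snd : M × N → N) q :=
    Eventually.of_forall fun _ => contMDiffAt_snd
  have sm : ∀ {u : ∀ x : M, GTan I x} {w : ∀ y : N, GTan J y}, SmoothGenAt I u p.1 →
      SmoothGenAt J w p.2 → SmoothGenAt (I.prod J) (fun p => toProdGTan (u p.1) (w p.2)) p :=
    fun hu hw => smoothGenAlong_toProdGTan (f := (Prod.fst : M × N → M))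
      (g := (Prod.snd : M × N → N)) (SmoothGenAlong.comp hu contMDiffAt_fst)
      (SmoothGenAlong.comp hw contMDiffAt_snd)
  have rf : ∀ (u : ∀ x : M, GTan I x) (w : ∀ y : N, GTan J y), ∀ᶠ q in 𝓝 p,
      mfderiv (I.prod J) I Prod.fst q (toProdGTan (u q.1) (w q.2)).1 = (u q.1).1 := fun u w =>
    Eventually.of_forall fun q => by rw [mfderiv_fst]; rfl
  have rg : ∀ (u : ∀ x : M, GTan I x) (w : ∀ y : N, GTan J y), ∀ᶠ q in 𝓝 p,
      mfderiv (I.prod J) J Prod.snd q (toProdGTan (u q.1) (w q.2)).1 = (w q.2).1 := fun u w =>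
    Eventually.of_forall fun q => by rw [mfderiv_snd]; rfl
  have s1 := sm hu.self_of_nhds hw.self_of_nhds
  have s2 := sm hu'.self_of_nhds hw'.self_of_nhds
  refine Prod.ext ?_ ?_
  · have h1 := mlieBracket_related hf s1.fst s2.fst hu.self_of_nhds.fst hu'.self_of_nhds.fst
      (rf u w) (rf u' w')
    have h2 := mlieBracket_related hg s1.fst s2.fst hw.self_of_nhds.fst hw'.self_of_nhds.fst
      (rg u w) (rg u' w')
    rw [mfderiv_fst] at h1
    rw [mfderiv_snd] at h2
    exact Prod.ext h1 h2
  · have l : ∀ {u u' : ∀ x : M, GTan I x} {w w' : ∀ y : N, GTan J y},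
        SmoothGenAt I u p.1 → SmoothGenAt I u' p.1 →
        SmoothGenAt J w p.2 → SmoothGenAt J w' p.2 →
        lieDerivForm (I.prod J) (fun q => (toProdGTan (u q.1) (w q.2)).1)
          (fun q => (toProdGTan (u' q.1) (w' q.2)).2) p
        = (lieDerivForm I (fun x => (u x).1) (fun x => (u' x).2) p.1).comp
            (mfderiv (I.prod J) I Prod.fst p)
          - (lieDerivForm J (fun x => (w x).1) (fun x => (w' x).2) p.2).comp
            (mfderiv (I.prod J) J Prod.snd p) := by
      intro u u' w w' hu hu' hw hw'
      have s1 := sm hu hw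
      rw [← lieDerivForm_related hf s1.fst hu.fst hu'.snd (rf u w),
        ← lieDerivForm_related hg s1.fst hw.fst hw'.snd (rg u w)]
      exact lieDerivForm_sub_right s1.fst (SmoothFormAt.pullback hf hu'.snd)
        (SmoothFormAt.pullback hg hw'.snd)
    have c1 := SmoothGenAt.pair hu.self_of_nhds hu'.self_of_nhds
    have c2 := SmoothGenAt.pair hw.self_of_nhds hw'.self_of_nhds
    have d : mvfderiv (I.prod J) (fun q : M × N =>
          (toProdGTan (u q.1) (w q.2)).2 (toProdGTan (u' q.1) (w' q.2)).1
          - (toProdGTan (u' q.1) (w' q.2)).2 (toProdGTan (u q.1) (w q.2)).1) p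
        = (mvfderiv I (fun x => (u x).2 (u' x).1 - (u' x).2 (u x).1) p.1).comp
            (mfderiv (I.prod J) I Prod.fst p)
          - (mvfderiv J (fun x => (w x).2 (w' x).1 - (w' x).2 (w x).1) p.2).comp
            (mfderiv (I.prod J) J Prod.snd p) := by
      rw [← mvfderiv_comp_smooth c1 contMDiffAt_fst, ← mvfderiv_comp_smooth c2 contMDiffAt_snd,
        ← mvfderiv_sub_of_smooth (c1.comp_smooth contMDiffAt_fst) (c2.comp_smooth contMDiffAt_snd)]
      refine mvfderiv_congr (Eventually.of_forall fun q => ?_)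
      have e1 := toProdGTan_snd_apply (u q.1) (w q.2) (u' q.1).1 (w' q.2).1
      have e2 := toProdGTan_snd_apply (u' q.1) (w' q.2) (u q.1).1 (w q.2).1
      refine (congrArg₂ (· - ·) e1 e2).trans ?_
      ring
    simp only [courantBracket]
    rw [l hu.self_of_nhds hu'.self_of_nhds hw.self_of_nhds hw'.self_of_nhds,
      l hu'.self_of_nhds hu.self_of_nhds hw'.self_of_nhds hw.self_of_nhds, d]
    refine ContinuousLinearMap.ext fun v => ?_
    simp only [toProdGTan, add_apply, sub_apply, smul_apply, ContinuousLinearMap.comp_apply,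
      smul_eq_mul]
    ring

end ProductBracket

/-! ### The product of two Dirac structures. -/

section ProductDirac

variable {E : Type*} [NormedAddCommGroup E] [NormedSpace ℝ E] [FiniteDimensional ℝ E]
  {H : Type*} [TopologicalSpace H] {I : ModelWithCorners ℝ E H} [I.Boundaryless]
  {M : Type*} [TopologicalSpace M] [ChartedSpace H M] [IsManifold I ∞ M] [T2Space M]
  {E' : Type*} [NormedAddCommGroup E'] [NormedSpace ℝ E'] [FiniteDimensional ℝ E']
  {H' : Type*} [TopologicalSpace H'] {J : ModelWithCorners ℝ E' H'} [J.Boundaryless]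
  {N : Type*} [TopologicalSpace N] [ChartedSpace H' N] [IsManifold J ∞ N] [T2Space N]

theorem IsSubbundle.of_sectionFrame {F : Type*} [NormedAddCommGroup F] [NormedSpace ℝ F]
    {V : M → Type*} [∀ x, AddCommGroup (V x)] [∀ x, Module ℝ (V x)] [∀ x, TopologicalSpace (V x)]
    [TopologicalSpace (TotalSpace F V)] [FiberBundle F V] [VectorBundle ℝ F V]
    {A : ∀ x : M, Submodule ℝ (V x)}
    (h : ∀ x₀ : M, ∃ (k : ℕ) (e : Fin k → smoothSections I F A) (U : Set M), IsOpen U ∧ x₀ ∈ U ∧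
      IsSectionFrame e U) : IsSubbundle I F A := fun x₀ => by
  obtain ⟨k, e, U, hU, hx, he⟩ := h x₀
  exact ⟨k, U, fun i => (e i).1, hU, hx, fun i => (e i).2.1.contMDiffOn,
    fun x hx => ⟨he.indep x hx, he.span x hx⟩⟩

variable (L : DiracStructure I M) (K : DiracStructure J N)

/-- The fibers of the product of two Dirac structures. -/
def prodFiber (p : M × N) : Submodule ℝ (GTan (I.prod J) p) :=
  ((L.fiber p.1).prod (K.fiber p.2)).map (toProdEquiv I J p.1 p.2).toLinearMap

variable {L K}

theorem toProdGTan_mem_prodFiber {p : M × N} {u : GTan I p.1} {w : GTan J p.2} :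
    toProdGTan u w ∈ prodFiber L K p ↔ u ∈ L.fiber p.1 ∧ w ∈ K.fiber p.2 := by
  constructor
  · rintro ⟨⟨u', w'⟩, ⟨h1, h2⟩, h⟩
    obtain ⟨rfl, rfl⟩ := toProdGTan_injective h
    exact ⟨h1, h2⟩
  · rintro ⟨h1, h2⟩
    exact ⟨(u, w), ⟨h1, h2⟩, rfl⟩

theorem inProdDirac_iff {S : ∀ p : M × N, GTan (I.prod J) p} :
    InProdDirac L K S ↔ ∀ p, S p ∈ prodFiber L K p := by
  constructor
  · intro h p
    obtain ⟨u, hu, w, hw, e⟩ := h p.1 p.2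
    have e' : S p = toProdGTan u w := e
    rw [e']
    exact toProdGTan_mem_prodFiber.2 ⟨hu, hw⟩
  · intro h x y
    obtain ⟨⟨u, w⟩, ⟨h1, h2⟩, e⟩ := h (x, y)
    exact ⟨u, h1, w, h2, e.symm⟩

/-- The section `pr_M^* s - pr_N^* t` of the product. -/
def prodSection (s : smoothSections I (GModel E) L.fiber) (t : smoothSections J (GModel E') K.fiber) :
    smoothSections (I.prod J) (GModel (E × E')) (prodFiber L K) :=
  ⟨fun p => toProdGTan (s.1 p.1) (t.1 p.2), fun p =>
    smoothGenAlong_toProdGTan (f := (Prod.fst : M × N → M)) (g := (Prod.snd : M × N → N))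
      (SmoothGenAlong.comp (L.smoothGenAt s p.1) contMDiffAt_fst)
      (SmoothGenAlong.comp (K.smoothGenAt t p.2) contMDiffAt_snd),
    fun p => toProdGTan_mem_prodFiber.2 ⟨s.2.2 p.1, t.2.2 p.2⟩⟩

theorem courantBracket_prodSection (s s' : smoothSections I (GModel E) L.fiber)
    (t t' : smoothSections J (GModel E') K.fiber) (p : M × N) :
    courantBracket (I.prod J) (prodSection s t).1 (prodSection s' t').1 p
      = (prodSection (L.algebroid.bracket s s') (K.algebroid.bracket t t')).1 p :=
  courantBracket_toProdGTan (Eventually.of_forall (L.smoothGenAt s))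
    (Eventually.of_forall (L.smoothGenAt s')) (Eventually.of_forall (K.smoothGenAt t))
    (Eventually.of_forall (K.smoothGenAt t'))

/-- The sections of the product given by sections of the factors. -/
def prodFrame {k l : ℕ} (e : Fin k → smoothSections I (GModel E) L.fiber)
    (g : Fin l → smoothSections J (GModel E') K.fiber) (i : Fin (k + l)) :
    smoothSections (I.prod J) (GModel (E × E')) (prodFiber L K) :=
  Sum.elim (fun i => prodSection (e i) 0) (fun j => prodSection 0 (g j)) (finSumFinEquiv.symm i)

theorem isSectionFrame_prodFrame {k l : ℕ} {e : Fin k → smoothSections I (GModel E) L.fiber}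
    {g : Fin l → smoothSections J (GModel E') K.fiber} {U : Set M} {W : Set N}
    (he : IsSectionFrame e U) (hg : IsSectionFrame g W) :
    IsSectionFrame (prodFrame e g) (U ×ˢ W) := by
  have key : ∀ p : M × N, (fun i => (prodFrame e g i).1 p)
      = (toProdEquiv I J p.1 p.2).toLinearMap ∘ (Sum.elim
          (LinearMap.inl ℝ (GTan I p.1) (GTan J p.2) ∘ fun i => (e i).1 p.1)
          (LinearMap.inr ℝ (GTan I p.1) (GTan J p.2) ∘ fun j => (g j).1 p.2))
        ∘ finSumFinEquiv.symm := by
    intro p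
    funext i
    simp only [prodFrame, Function.comp]
    rcases finSumFinEquiv.symm i with i | j <;> rfl
  constructor
  · rintro p ⟨h1, h2⟩
    rw [key]
    refine LinearIndependent.map' ?_ _ (LinearEquiv.ker _)
    exact (linearIndependent_inl_union_inr' (he.indep _ h1) (hg.indep _ h2)).comp _
      finSumFinEquiv.symm.injective
  · rintro p ⟨h1, h2⟩
    rw [key, Set.range_comp, Set.range_comp, Equiv.range_eq_univ, Set.image_univ,
      Set.Sum.elim_range, Set.range_comp, Set.range_comp, Submodule.span_image,
      LinearMap.span_inl_union_inr, he.span _ h1, hg.span _ h2]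
    rfl

theorem exists_prodFrame (p : M × N) :
    ∃ (k l : ℕ) (e : Fin k → smoothSections I (GModel E) L.fiber)
      (g : Fin l → smoothSections J (GModel E') K.fiber) (U : Set (M × N)), IsOpen U ∧ p ∈ U ∧
      IsSectionFrame (prodFrame e g) U := by
  obtain ⟨k, e, U, hU, hx, he⟩ := L.subbundle.exists_sectionFrame p.1
  obtain ⟨l, g, W, hW, hy, hg⟩ := K.subbundle.exists_sectionFrame p.2
  exact ⟨k, l, e, g, U ×ˢ W, hU.prod hW, ⟨hx, hy⟩, isSectionFrame_prodFrame he hg⟩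

/-- Pairing with elements that have one component zero separates the two factors, and maximality of
`L` and of `K` can be used one at a time. -/
theorem prodFiber_isotropic {p : M × N} (Z : GTan (I.prod J) p) :
    Z ∈ prodFiber L K p ↔ ∀ W ∈ prodFiber L K p, symPairing (I.prod J) Z W = 0 := by
  obtain ⟨u, w, rfl⟩ := exists_toProdGTan_eq (x := p.1) (y := p.2) Z
  constructor
  · rintro h W ⟨⟨u', w'⟩, ⟨h1, h2⟩, rfl⟩
    obtain ⟨hu, hw⟩ := toProdGTan_mem_prodFiber.1 h
    refine (symPairing_toProdGTan u u' w w').trans ?_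
    rw [(L.maximal_isotropic _ _).1 hu _ h1, (K.maximal_isotropic _ _).1 hw _ h2, sub_zero]
  · intro h
    refine toProdGTan_mem_prodFiber.2 ⟨(L.maximal_isotropic _ _).2 fun u' hu' => ?_,
      (K.maximal_isotropic _ _).2 fun w' hw' => ?_⟩
    · have := (symPairing_toProdGTan u u' w 0).symm.trans
        (h _ (toProdGTan_mem_prodFiber.2 ⟨hu', zero_mem _⟩))
      simpa [symPairing] using this
    · have := (symPairing_toProdGTan u 0 w w').symm.trans
        (h _ (toProdGTan_mem_prodFiber.2 ⟨zero_mem _, hw'⟩))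
      simpa [symPairing] using this

/-- Closure under the bracket is checked on frame sections only, where it is componentwise. The
Leibniz rule extends it to all sections in `DiracStructure.prod`. -/
theorem exists_prodSection_bracket {k l : ℕ} (e : Fin k → smoothSections I (GModel E) L.fiber)
    (g : Fin l → smoothSections J (GModel E') K.fiber) (i j : Fin (k + l)) (p : M × N) :
    courantBracket (I.prod J) (prodFrame e g i).1 (prodFrame e g j).1 p ∈ prodFiber L K p := by
  simp only [prodFrame]
  rcases finSumFinEquiv.symm i with i | i <;> rcases finSumFinEquiv.symm j with j | j <;>
  · simp only [Sum.elim_inl, Sum.elim_inr]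
    rw [courantBracket_prodSection]
    exact (prodSection _ _).2.2 p

variable (L K) in
/-- The product of two Dirac structures. -/
def DiracStructure.prod : DiracStructure (I.prod J) (M × N) where
  fiber := prodFiber L K
  subbundle := IsSubbundle.of_sectionFrame fun p => by
    obtain ⟨k, l, e, g, U, hU, hp, h⟩ := exists_prodFrame (L := L) (K := K) p
    exact ⟨k + l, prodFrame e g, U, hU, hp, h⟩
  maximal_isotropic _ := prodFiber_isotropic
  integrable S hS T hT := by
    refine ⟨fun p => SmoothGenAt.courantBracket (Eventually.of_forall hS.1)
      (Eventually.of_forall hT.1), fun p => ?_⟩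
    obtain ⟨k, l, e, g, U, hU, hp, h⟩ := exists_prodFrame (L := L) (K := K) p
    obtain ⟨c, hc, hc'⟩ := h.exists_smooth_coeff (J := I.prod J) hU id S hS.2
    obtain ⟨d, hd, hd'⟩ := h.exists_smooth_coeff (J := I.prod J) hU id T hT.2
    -- The coefficients are arbitrary smooth functions on `M × N`. Isotropy removes the terms in
    -- their differentials that would leave the bundle, and every remaining term is a multiple of a
    -- frame section or of a bracket of frame sections.
    rw [courantBracket_expand (c := c) (d := d) (s := fun i => (prodFrame e g i).1)
      (t := fun i => (prodFrame e g i).1) (hc' p hp contMDiffAt_id (hS.1 p))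
      (hd' p hp contMDiffAt_id (hT.1 p)) (fun i => (prodFrame e g i).2.1 p)
      (fun i => (prodFrame e g i).2.1 p)
      (fun i j => (prodFiber_isotropic _).1 ((prodFrame e g i).2.2 p) _ ((prodFrame e g j).2.2 p))
      ((hU.eventually_mem hp).mono hc)
      ((hU.eventually_mem hp).mono hd)]
    refine Submodule.sub_mem _ (Submodule.add_mem _ (Submodule.sum_mem _ fun i _ =>
      Submodule.sum_mem _ fun j _ => Submodule.smul_mem _ _ (exists_prodSection_bracket e g i j p))
      (Submodule.sum_mem _ fun j _ => Submodule.smul_mem _ _ ((prodFrame e g j).2.2 p)))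
      (Submodule.sum_mem _ fun i _ => Submodule.smul_mem _ _ ((prodFrame e g i).2.2 p))

end ProductDirac

section GraphSections

variable {E : Type*} [NormedAddCommGroup E] [NormedSpace ℝ E] [FiniteDimensional ℝ E]
  {H : Type*} [TopologicalSpace H] {I : ModelWithCorners ℝ E H} [I.Boundaryless]
  {M : Type*} [TopologicalSpace M] [ChartedSpace H M] [IsManifold I ∞ M] [T2Space M]
  {E' : Type*} [NormedAddCommGroup E'] [NormedSpace ℝ E'] [FiniteDimensional ℝ E']
  {H' : Type*} [TopologicalSpace H'] {J : ModelWithCorners ℝ E' H'} [J.Boundaryless]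
  {N : Type*} [TopologicalSpace N] [ChartedSpace H' N] [IsManifold J ∞ N] [T2Space N]
  {L : DiracStructure I M} {K : DiracStructure J N} {φ : C^∞⟮I, M; J, N⟯}

/-! ### Sections of a product Dirac structure over the graph -/

/-- The bracket of two sections of a product Dirac structure vanishes at a point of the graph if
one of them vanishes along the graph and the other one is tangent to the graph at this point. -/
theorem courantBracket_eq_zero_of_graph {S T : ∀ p : M × N, GTan (I.prod J) p} {x : M}
    (hS : SmoothGenAt (I.prod J) S (x, φ x)) (hT : SmoothGenAt (I.prod J) T (x, φ x))
    (mS : S (x, φ x) ∈ prodFiber L K (x, φ x)) (mT : ∀ p, T p ∈ prodFiber L K p)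
    (tS : ∃ v : TangentSpace I x, (S (x, φ x)).1 = mfderiv I (I.prod J) (graphMap φ) x v)
    (zT : ∀ᶠ y in 𝓝 x, T (y, φ y) = 0) :
    courantBracket (I.prod J) S T (x, φ x) = 0 := by
  obtain ⟨k, l, e, g, U, hU, hp, h⟩ := exists_prodFrame (L := L) (K := K) (x, φ x)
  obtain ⟨d, hd, hd'⟩ := h.exists_smooth_coeff (J := I.prod J) hU id T mT
  have hι := (contMDiff_graphMap φ).contMDiffAt (x := x)
  have sd := hd' _ hp contMDiffAt_id hT
  have sE := fun i => (prodFrame e g i).2.1 (x, φ x)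
  -- The frame is independent at each point, so the coefficients of `T` vanish wherever `T` does, in
  -- particular along the graph.
  have hz : ∀ i, ∀ᶠ y in 𝓝 x, d i (graphMap φ y) = 0 := fun i => by
    filter_upwards [zT, hι.continuousAt.eventually (hU.eventually_mem hp)] with y h1 h2
    exact Fintype.linearIndependent_iff.1 (h.indep _ h2) (fun i => d i (graphMap φ y))
      ((hd _ h2).symm.trans h1) i
  rw [courantBracket_congr (s := S) (t := fun q => ∑ i, d i q • (prodFrame e g i).1 q) hS
    (SmoothGenAt.sum fun i _ => SmoothGenAt.smul (sd i) (sE i)) (Eventually.of_forall fun _ => rfl)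
    ((hU.eventually_mem hp).mono hd), courantBracket_sum_smul_right hS sd sE
    (fun i => (prodFiber_isotropic _).1 mS _ ((prodFrame e g i).2.2 _))]
  obtain ⟨v, hv⟩ := tS
  have h1 : ∀ i, d i (x, φ x) = 0 := fun i => (hz i).self_of_nhds
  -- The vector part of `S` is tangent to the graph, and a function that vanishes along the graph
  -- has zero derivative in tangent directions.
  have h2 : ∀ i, mvfderiv (I.prod J) (d i) (x, φ x) (S (x, φ x)).1 = 0 := fun i => by
    rw [hv]
    have := congrArg (fun T => T v) (mvfderiv_comp_smooth (ψ := graphMap φ) (sd i) hι)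
    refine this.symm.trans ?_
    simp only [mvfderiv_congr (hz i), mvfderiv_const]
    rfl
  simp [h1, h2]

/-- The value of the bracket at a point of the graph only depends on the restrictions to the
graph. -/
theorem courantBracket_eq_of_graph {S S' T T' : ∀ p : M × N, GTan (I.prod J) p} {x : M}
    (hS : SmoothGenAt (I.prod J) S (x, φ x)) (hS' : SmoothGenAt (I.prod J) S' (x, φ x))
    (hT : SmoothGenAt (I.prod J) T (x, φ x)) (hT' : SmoothGenAt (I.prod J) T' (x, φ x))
    (mS : ∀ p, S p ∈ prodFiber L K p) (mS' : ∀ p, S' p ∈ prodFiber L K p)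
    (mT : ∀ p, T p ∈ prodFiber L K p) (mT' : ∀ p, T' p ∈ prodFiber L K p)
    (tS : ∃ v : TangentSpace I x, (S (x, φ x)).1 = mfderiv I (I.prod J) (graphMap φ) x v)
    (tT : ∃ v : TangentSpace I x, (T (x, φ x)).1 = mfderiv I (I.prod J) (graphMap φ) x v)
    (eS : ∀ᶠ y in 𝓝 x, S' (y, φ y) = S (y, φ y)) (eT : ∀ᶠ y in 𝓝 x, T' (y, φ y) = T (y, φ y)) :
    courantBracket (I.prod J) S' T' (x, φ x) = courantBracket (I.prod J) S T (x, φ x) := by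
  have diff : ∀ {A B : ∀ p : M × N, GTan (I.prod J) p}, SmoothGenAt (I.prod J) A (x, φ x) →
      SmoothGenAt (I.prod J) B (x, φ x) →
      SmoothGenAt (I.prod J) (fun p => A p + (-1 : ℝ) • B p) (x, φ x) := fun hA hB =>
    SmoothGenAt.add hA (SmoothGenAt.smul (g := fun _ => (-1 : ℝ)) contMDiffAt_const hB)
  have mdiff : ∀ {A B : ∀ p : M × N, GTan (I.prod J) p}, (∀ p, A p ∈ prodFiber L K p) →
      (∀ p, B p ∈ prodFiber L K p) → ∀ p, A p + (-1 : ℝ) • B p ∈ prodFiber L K p :=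
    fun hA hB p => add_mem (hA p) (Submodule.smul_mem _ _ (hB p))
  have zdiff : ∀ {A B : ∀ p : M × N, GTan (I.prod J) p},
      (∀ᶠ y in 𝓝 x, A (y, φ y) = B (y, φ y)) →
      ∀ᶠ y in 𝓝 x, A (y, φ y) + (-1 : ℝ) • B (y, φ y) = 0 := fun h => h.mono fun y hy => by
    rw [hy, neg_one_smul, add_neg_cancel]
  -- Each argument is written as the other extension plus a difference that vanishes along the
  -- graph; the arguments are then exchanged one after the other.
  have eqd : ∀ (A B : ∀ p : M × N, GTan (I.prod J) p),
      A = fun p => B p + (A p + (-1 : ℝ) • B p) := fun A B => by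
    funext p
    rw [neg_one_smul]
    abel
  rw [eqd T' T, courantBracket_add_right hS' hT (diff hT' hT),
    courantBracket_eq_zero_of_graph hS' (diff hT' hT) (mS' _) (mdiff mT' mT)
      (by rw [eS.self_of_nhds]; exact tS) (zdiff eT), add_zero, eqd S' S,
    courantBracket_add_left hT hS (diff hS' hS), courantBracket_skew (fun p => S' p + (-1 : ℝ) • S p),
    courantBracket_eq_zero_of_graph hT (diff hS' hS) (mT _) (mdiff mS' mS) tT (zdiff eS), neg_zero,
    add_zero]

theorem contMDiffAt_graphSection_iff {s : ∀ x : M, GTanGraph φ x} {x : M} :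
    ContMDiffAt I (I.prod 𝓘(ℝ, GModel E × GModel E')) ∞
      (fun x => TotalSpace.mk' (GModel E × GModel E') (E := GTanGraph φ) x (s x)) x ↔
    SmoothGenAt I (fun x => (s x).1) x ∧ SmoothGenAlong J I φ (fun x => (s x).2) x := by
  refine (contMDiffAt_prod_bundle_iff (φ := fun x : M => x)).trans (and_congr_right fun _ => ?_)
  exact contMDiffAt_pullback_iff (V := GTan J (M := N)) φ

/-- The component in `L` of a section of `R`. -/
def sectionFst (s : smoothSections I (GModel E × GModel E') (diracR L K φ)) :
    smoothSections I (GModel E) L.fiber :=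
  ⟨fun x => (s.1 x).1, fun x => (contMDiffAt_graphSection_iff.1 (s.2.1 x)).1,
    fun x => (s.2.2 x).2.1⟩

theorem sectionSnd_smooth (s : smoothSections I (GModel E × GModel E') (diracR L K φ)) (x : M) :
    SmoothGenAlong J I φ (fun x => (s.1 x).2) x :=
  (contMDiffAt_graphSection_iff.1 (s.2.1 x)).2

/-- The vector field and the section of the product given by combinations of sections of the
factors with coefficients that are functions on the first factor. -/
theorem smoothGenAt_sum_prodSection {ι κ : Type*} [Fintype ι] [Fintype κ] {a : ι → M → ℝ}
    {f : κ → M → ℝ} (lam : ι → smoothSections I (GModel E) L.fiber)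
    (σ : κ → smoothSections J (GModel E') K.fiber) {p : M × N}
    (ha : ∀ i, ContMDiffAt I 𝓘(ℝ, ℝ) ∞ (a i) p.1) (hf : ∀ i, ContMDiffAt I 𝓘(ℝ, ℝ) ∞ (f i) p.1) :
    SmoothGenAt (I.prod J) (fun p => toProdGTan (∑ i, a i p.1 • (lam i).1 p.1)
      (∑ j, f j p.1 • (σ j).1 p.2)) p := by
  refine smoothGenAlong_toProdGTan (f := (Prod.fst : M × N → M)) (g := (Prod.snd : M × N → N)) ?_ ?_
  · exact contMDiffAt_sum_smul_along contMDiffAt_fst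
      (fun i => (ha i).comp_smooth contMDiffAt_fst)
      fun i => SmoothGenAlong.comp (L.smoothGenAt (lam i) p.1) contMDiffAt_fst
  · exact contMDiffAt_sum_smul_along contMDiffAt_snd
      (fun i => (hf i).comp_smooth contMDiffAt_fst)
      fun i => SmoothGenAlong.comp (K.smoothGenAt (σ i) p.2) contMDiffAt_snd

theorem exists_local_coeff {B : DiracStructure J N} {ψ : M → N} (hψ : ContMDiff I J ∞ ψ)
    {w : ∀ x : M, GTan J (ψ x)} (hw : ∀ x, SmoothGenAlong J I ψ w x)
    (mw : ∀ x, w x ∈ B.fiber (ψ x)) (x₀ : M) :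
    ∃ (l : ℕ) (f : Fin l → M → ℝ) (σ : Fin l → smoothSections J (GModel E') B.fiber) (U : Set M),
      IsOpen U ∧ x₀ ∈ U ∧ (∀ i, ∀ x ∈ U, ContMDiffAt I 𝓘(ℝ, ℝ) ∞ (f i) x) ∧
      ∀ x ∈ U, w x = ∑ i, f i x • (σ i).1 (ψ x) := by
  obtain ⟨l, σ, W, hW, hx, h⟩ := B.subbundle.exists_sectionFrame (ψ x₀)
  obtain ⟨f, hf, hf'⟩ := h.exists_smooth_coeff (J := I) hW ψ w mw
  exact ⟨l, f, σ, ψ ⁻¹' W, hW.preimage hψ.continuous, hx,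
    fun i x hx => hf' x hx (hψ x) (hw x) i, hf⟩

/-- A section of `R` extends to a section of the product Dirac structure. -/
theorem exists_extension [SigmaCompactSpace M] [SigmaCompactSpace N]
    (s : smoothSections I (GModel E × GModel E') (diracR L K φ)) :
    ∃ S : smoothSections (I.prod J) (GModel (E × E')) (prodFiber L K), RestrictsTo φ S.1 s.1 := by
  -- The constraint is membership in the product Dirac structure, together with a prescribed value
  -- at points of the graph. It is convex in each fiber, so local solutions can be glued by a
  -- partition of unity.
  let t : ∀ p : M × N, Set (GTan (I.prod J) p) := fun p =>
    {Z | Z ∈ prodFiber L K p ∧ (p.2 = φ p.1 →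
      Z = toProdGTan (x := p.1) (y := p.2) (s.1 p.1).1 (show GModel E' from (s.1 p.1).2))}
  have hconv : ∀ p, Convex ℝ (t p) := fun p => by
    rintro Z ⟨h1, h2⟩ Z' ⟨h1', h2'⟩ a b - - hab
    refine ⟨add_mem (Submodule.smul_mem _ _ h1) (Submodule.smul_mem _ _ h1'), fun hp => ?_⟩
    rw [h2 hp, h2' hp, ← add_smul, hab, one_smul]
  have hloc : ∀ p₀ : M × N, ∃ U ∈ 𝓝 p₀, ∃ S : ∀ p : M × N, GTan (I.prod J) p,
      ContMDiffOn (I.prod J) ((I.prod J).prod 𝓘(ℝ, GModel (E × E'))) ∞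
        (fun p => TotalSpace.mk' (GModel (E × E')) p (S p)) U ∧ ∀ p ∈ U, S p ∈ t p := fun p₀ => by
    by_cases hp : p₀.2 = φ p₀.1
    -- Near the graph the component in `L` is taken independent of the point of `N`. The component
    -- in `K` is extended by letting the sections `σ j` move in `N` while their coefficients depend
    -- on the point of `M` alone.
    · obtain ⟨l, f, σ, U, hU, hx, hf, h⟩ := exists_local_coeff (B := K) φ.contMDiff
        (sectionSnd_smooth s) (fun x => (s.2.2 x).2.2) p₀.1
      refine ⟨Prod.fst ⁻¹' U, (hU.preimage continuous_fst).mem_nhds hx,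
        fun p => toProdGTan (∑ i : Fin 1, (fun (_ : M) => (1 : ℝ)) p.1 • (sectionFst s).1 p.1)
          (∑ j, f j p.1 • (σ j).1 p.2), fun p hpU => ?_, fun p hpU => ⟨?_, fun hp' => ?_⟩⟩
      · exact (smoothGenAt_sum_prodSection (fun _ => sectionFst s) σ (fun _ => contMDiffAt_const)
          fun i => hf i _ hpU).contMDiffWithinAt
      · exact toProdGTan_mem_prodFiber.2 ⟨sum_mem fun i _ => Submodule.smul_mem _ _
          ((sectionFst s).2.2 _), sum_mem fun i _ => Submodule.smul_mem _ _ ((σ i).2.2 _)⟩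
      · obtain ⟨x, y⟩ := p
        change y = φ x at hp'
        subst hp'
        have e1 : (∑ i : Fin 1, (fun (_ : M) => (1 : ℝ)) x • (sectionFst s).1 x) = (s.1 x).1 := by
          simp only [Finset.univ_unique, Finset.sum_const, Finset.card_singleton, one_smul]
          rfl
        exact congrArg₂ (fun u w => toProdGTan (x := x) (y := φ x) u w) e1 (h x hpU).symm
    -- The graph is closed because `N` is Hausdorff, and away from it the zero section satisfies the
    -- constraint.
    · have hc : IsClosed {p : M × N | p.2 = φ p.1} :=
        isClosed_eq continuous_snd (φ.contMDiff.continuous.comp continuous_fst)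
      refine ⟨{p : M × N | p.2 = φ p.1}ᶜ, hc.isOpen_compl.mem_nhds hp, fun p => 0,
        (contMDiff_zeroSection ℝ (GTan (I.prod J) (M := M × N))).contMDiffOn,
        fun p hp => ⟨zero_mem _, fun h => absurd h hp⟩⟩
  obtain ⟨S, hS⟩ := exists_contMDiffSection_forall_mem_convex_of_local (I.prod J) (n := ⊤)
    (F_fiber := GModel (E × E')) (GTan (I.prod J) (M := M × N)) t hconv hloc
  exact ⟨⟨fun p => S p, S.contMDiff, fun p => (hS p).1⟩, fun x => (hS (x, φ x)).2 rfl⟩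

end GraphSections

section GraphAlgebroid

variable {E : Type*} [NormedAddCommGroup E] [NormedSpace ℝ E] [FiniteDimensional ℝ E]
  {H : Type*} [TopologicalSpace H] {I : ModelWithCorners ℝ E H} [I.Boundaryless]
  {M : Type*} [TopologicalSpace M] [ChartedSpace H M] [IsManifold I ∞ M] [T2Space M]
  [SigmaCompactSpace M]
  {E' : Type*} [NormedAddCommGroup E'] [NormedSpace ℝ E'] [FiniteDimensional ℝ E']
  {H' : Type*} [TopologicalSpace H'] {J : ModelWithCorners ℝ E' H'} [J.Boundaryless]
  {N : Type*} [TopologicalSpace N] [ChartedSpace H' N] [IsManifold J ∞ N] [T2Space N]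
  [SigmaCompactSpace N]
  {L : DiracStructure I M} {K : DiracStructure J N} {φ : C^∞⟮I, M; J, N⟯}

/-! ### The Lie algebroid `R` -/

section

variable {S T S' T' : smoothSections (I.prod J) (GModel (E × E')) (L.prod K).fiber}
  {s t s' t' : smoothSections I (GModel E × GModel E') (diracR L K φ)}

theorem RestrictsTo.tangent (h : RestrictsTo φ S.1 s.1) (x : M) :
    GraphTangent φ x (S.1 (x, φ x)) := by
  rw [h x]
  exact graphTangent_iff.2 (s.2.2 x).1

theorem RestrictsTo.fst_eq (h : RestrictsTo φ S.1 s.1) (x : M) :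
    (S.1 (x, φ x)).1 = mfderiv I (I.prod J) (graphMap φ) x (s.1 x).1.1 := by
  obtain ⟨v, hv⟩ := (h.tangent x).1
  have h1 : (S.1 (x, φ x)).1 = (show E × E' from ((s.1 x).1.1, (s.1 x).2.1)) :=
    congrArg Prod.fst (h x)
  have h2 : v = (s.1 x).1.1 := by
    have := hv.symm.trans h1
    rw [mfderiv_graphMap] at this
    exact congrArg (fun z : E × E' => z.1) this
  rw [hv, h2]

theorem RestrictsTo.bracket_eq (hS : RestrictsTo φ S.1 s.1) (hS' : RestrictsTo φ S'.1 s.1)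
    (hT : RestrictsTo φ T.1 t.1) (hT' : RestrictsTo φ T'.1 t.1) (x : M) :
    courantBracket (I.prod J) S'.1 T'.1 (x, φ x) = courantBracket (I.prod J) S.1 T.1 (x, φ x) :=
  courantBracket_eq_of_graph (L := L) (K := K) (S.2.1 _) (S'.2.1 _) (T.2.1 _) (T'.2.1 _) S.2.2 S'.2.2
    T.2.2 T'.2.2 (hS.tangent x).1 (hT.tangent x).1
    (Eventually.of_forall fun y => (hS' y).trans (hS y).symm)
    (Eventually.of_forall fun y => (hT' y).trans (hT y).symm)

theorem RestrictsTo.congr_section (h : RestrictsTo φ S.1 s.1) (h' : RestrictsTo φ S.1 s'.1) :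
    s = s' := by
  ext1
  funext x
  obtain ⟨h1, h2⟩ := toProdGTan_injective ((h x).symm.trans (h' x))
  exact Prod.ext h1 h2

/-- The restricted bracket lies in `Γ^φ` by involutivity and in `L × K` by integrability, hence in
`R`. Its smoothness follows from that of the bracket on `M × N`, composed with the graph embedding.
-/
theorem exists_restriction (hS : RestrictsTo φ S.1 s.1) (hT : RestrictsTo φ T.1 t.1) :
    ∃ r : smoothSections I (GModel E × GModel E') (diracR L K φ),
      RestrictsTo φ ((L.prod K).algebroid.bracket S T).1 r.1 := by
  choose u w huw using fun x =>
    exists_toProdGTan_eq (courantBracket (I.prod J) S.1 T.1 (x, φ x))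
  have sm : ∀ x, SmoothGenAt I u x ∧ SmoothGenAlong J I φ w x := fun x => by
    refine smoothGenAlong_of_toProdGTan (f := fun x : M => x) (g := φ) ?_
    simp only [huw]
    exact SmoothGenAlong.comp (f := graphMap φ)
      (((L.prod K).algebroid.bracket S T).2.1 (x, φ x)) (contMDiff_graphMap φ x)
  refine ⟨⟨fun x => (u x, w x), fun x => contMDiffAt_graphSection_iff.2 (sm x), fun x => ⟨?_, ?_⟩⟩,
    fun x => (huw x).symm⟩
  · refine (graphTangent_iff (s := (u x, w x))).1 ?_
    change GraphTangent φ x (toProdGTan (u x) (w x))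
    rw [huw]
    exact GraphTangent.courantBracket (S.2.1 _) (T.2.1 _) (Eventually.of_forall hS.tangent)
      (Eventually.of_forall hT.tangent)
  · refine toProdGTan_mem_prodFiber (L := L) (K := K) (p := (x, φ x)).1 ?_
    rw [huw]
    exact ((L.prod K).algebroid.bracket S T).2.2 (x, φ x)

end

/-- An extension of a section of `R` to a section of the product. -/
def extension (s : smoothSections I (GModel E × GModel E') (diracR L K φ)) :
    smoothSections (I.prod J) (GModel (E × E')) (L.prod K).fiber := (exists_extension s).choose

theorem extension_spec (s : smoothSections I (GModel E × GModel E') (diracR L K φ)) :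
    RestrictsTo φ (extension s).1 s.1 := (exists_extension s).choose_spec

variable (L K φ) in
/-- The Lie algebroid structure on `R` induced by the Courant bracket. -/
def graphAlgebroid : AlgebroidData I (GModel E × GModel E') (diracR L K φ) where
  anchor := fun x => (LinearMap.fst ℝ (TangentSpace I x) (Cotan I x)).comp
    ((LinearMap.fst ℝ (GTan I x) (GTanPull φ x)).comp (diracR L K φ x).subtype)
  bracket := fun s t => (exists_restriction (extension_spec s) (extension_spec t)).choose

section

variable {S T : smoothSections (I.prod J) (GModel (E × E')) (L.prod K).fiber}
  {s t : smoothSections I (GModel E × GModel E') (diracR L K φ)}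

/-- The bracket on `R` is defined by chosen extensions; independence of the choice lets any
convenient extension be used in computations. -/
theorem RestrictsTo.bracket (hS : RestrictsTo φ S.1 s.1) (hT : RestrictsTo φ T.1 t.1) :
    RestrictsTo φ ((L.prod K).algebroid.bracket S T).1 ((graphAlgebroid L K φ).bracket s t).1 :=
  fun x => (RestrictsTo.bracket_eq (extension_spec s) hS (extension_spec t) hT x).trans
    ((exists_restriction (extension_spec s) (extension_spec t)).choose_spec x)

theorem RestrictsTo.add (hS : RestrictsTo φ S.1 s.1) (hT : RestrictsTo φ T.1 t.1) :
    RestrictsTo φ (S + T).1 (s + t).1 := fun x => by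
  change S.1 (x, φ x) + T.1 (x, φ x) = _
  rw [hS x, hT x]
  exact (toProdGTan_add _ _ _ _).symm

theorem RestrictsTo.smul (c : ℝ) (hS : RestrictsTo φ S.1 s.1) :
    RestrictsTo φ (c • S).1 (c • s).1 := fun x => by
  change c • S.1 (x, φ x) = _
  rw [hS x]
  exact (toProdGTan_smul _ _ _).symm

end

/-- The vector part of an extension is related, by the graph embedding, to the anchor field of the
section on `M`. Brackets of related fields are related, and the first component of the graph
embedding is injective on tangent vectors. -/
theorem graphAlgebroid_anchor_bracket (s t : smoothSections I (GModel E × GModel E') (diracR L K φ))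
    (x : M) : (((graphAlgebroid L K φ).bracket s t).1 x).1.1
      = mlieBracket I (fun y => (s.1 y).1.1) (fun y => (t.1 y).1.1) x := by
  have hS := extension_spec s
  have hT := extension_spec t
  have h := (hS.bracket hT).fst_eq x
  have h2 := mlieBracket_related (ψ := graphMap φ) (x := x)
    (X := fun p => ((extension s).1 p).1) (Y := fun p => ((extension t).1 p).1)
    (Eventually.of_forall (contMDiff_graphMap φ)) (L.smoothGenAt (sectionFst s) x).fst
    (L.smoothGenAt (sectionFst t) x).fst ((L.prod K).smoothGenAt (extension s) (x, φ x)).fst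
    ((L.prod K).smoothGenAt (extension t) (x, φ x)).fst
    (Eventually.of_forall fun y => (hS.fst_eq y).symm)
    (Eventually.of_forall fun y => (hT.fst_eq y).symm)
  have h3 := h.symm.trans h2.symm
  rw [mfderiv_graphMap, mfderiv_graphMap] at h3
  exact congrArg (fun z : E × E' => z.1) h3

/-- Each algebraic axiom holds for `L.prod K` on extensions, and a section of `R` is determined by
any section of the product that restricts to it (`RestrictsTo.congr_section`). -/
theorem isLieAlgebroid_graphAlgebroid
    (hR : IsSubbundle I (GModel E × GModel E') (diracR L K φ)) :
    IsLieAlgebroid (graphAlgebroid L K φ) where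
  subbundle := hR
  anchor_smooth s x := (L.smoothGenAt (sectionFst s) x).fst
  add_bracket s s' t := by
    have hS := extension_spec s
    have hS' := extension_spec s'
    have hT := extension_spec t
    have h := (hS.add hS').bracket hT
    rw [(L.prod K).isLieAlgebroid.add_bracket] at h
    exact h.congr_section ((hS.bracket hT).add (hS'.bracket hT))
  smul_bracket c s t := by
    have hS := extension_spec s
    have hT := extension_spec t
    have h := (hS.smul c).bracket hT
    rw [(L.prod K).isLieAlgebroid.smul_bracket] at h
    exact h.congr_section ((hS.bracket hT).smul c)
  skew s t := by
    have hS := extension_spec s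
    have hT := extension_spec t
    have h := hS.bracket hT
    -- Signs, and below the zero section, are written as scalar multiples so that `RestrictsTo.smul`
    -- covers them.
    rw [(L.prod K).isLieAlgebroid.skew, ← neg_one_smul ℝ] at h
    rw [← neg_one_smul ℝ]
    exact h.congr_section ((hT.bracket hS).smul (-1))
  jacobi s t u := by
    have hS := extension_spec s
    have hT := extension_spec t
    have hU := extension_spec u
    have h := ((hS.bracket (hT.bracket hU)).add (hT.bracket (hU.bracket hS))).add
      (hU.bracket (hS.bracket hT))
    rw [(L.prod K).isLieAlgebroid.jacobi, ← zero_smul ℝ (extension s)] at h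
    rw [← zero_smul ℝ s]
    exact h.congr_section (hS.smul 0)
  leibniz s t ft f hf hft x := by
    have hS := extension_spec s
    have hT := extension_spec t
    have hf' : ContMDiff (I.prod J) 𝓘(ℝ, ℝ) ∞ fun p : M × N => f p.1 := hf.comp contMDiff_fst
    -- The function `f` is extended to `M × N` as a function of the first factor, which makes this
    -- an extension of `ft`.
    let F : smoothSections (I.prod J) (GModel (E × E')) (L.prod K).fiber :=
      ⟨fun p => f p.1 • (extension t).1 p, fun p => SmoothGenAt.smul (hf' p) ((extension t).2.1 p),
        fun p => Submodule.smul_mem _ _ ((extension t).2.2 p)⟩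
    have hF : RestrictsTo φ F.1 ft.1 := fun y => by
      change f y • (extension t).1 (y, φ y) = _
      rw [hT y, hft y]
      exact (toProdGTan_smul _ _ _).symm
    have h := (L.prod K).isLieAlgebroid.leibniz (extension s) (extension t) F _ hf' (fun _ => rfl)
      (x, φ x)
    rw [(hS.bracket hF) x, (hS.bracket hT) x, hT x] at h
    have ha : (L.prod K).algebroid.act (extension s) (fun p => f p.1) (x, φ x)
        = (graphAlgebroid L K φ).act s f x := by
      have e := congrArg (fun T => T (s.1 x).1.1) (mvfderiv_comp_smooth (ψ := graphMap φ)
        (hf' (x, φ x)) (contMDiff_graphMap φ x))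
      refine Eq.trans ?_ e.symm
      exact congrArg (mvfderiv (I.prod J) (fun p : M × N => f p.1) (x, φ x)) (hS.fst_eq x)
    rw [ha] at h
    have h' := h.trans ((congrArg₂ (· + ·) (toProdGTan_smul (f x) _ _).symm
      (toProdGTan_smul ((graphAlgebroid L K φ).act s f x) _ _).symm).trans
      (toProdGTan_add _ _ _ _).symm)
    obtain ⟨h1, h2⟩ := toProdGTan_injective h'
    exact Prod.ext h1 h2
  anchor_bracket := graphAlgebroid_anchor_bracket

theorem isInducedOnR_graphAlgebroid : IsInducedOnR L K φ (graphAlgebroid L K φ) where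
  anchor _ _ := rfl
  bracket _ _ S T hS hT dS dT rS rT :=
    RestrictsTo.bracket (S := ⟨S, hS, inProdDirac_iff.1 dS⟩) (T := ⟨T, hT, inProdDirac_iff.1 dT⟩)
      rS rT

/-- Uniqueness comes from the existence of extensions: every pair of sections of `R` has them, so
the restriction property determines the bracket. -/
theorem eq_graphAlgebroid {P : AlgebroidData I (GModel E × GModel E') (diracR L K φ)}
    (hP : IsInducedOnR L K φ P) : P = graphAlgebroid L K φ := by
  refine AlgebroidData.ext ?_ ?_
  · funext x
    exact LinearMap.ext fun a => hP.anchor x a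
  · funext s t
    have h := hP.bracket s t _ _ (extension s).2.1 (extension t).2.1
      (inProdDirac_iff.2 (extension s).2.2) (inProdDirac_iff.2 (extension t).2.2)
      (extension_spec s) (extension_spec t)
    exact RestrictsTo.congr_section (S := (L.prod K).algebroid.bracket (extension s) (extension t)) h
      ((extension_spec s).bracket (extension_spec t))

end GraphAlgebroid

section GraphMorphisms

variable {E : Type*} [NormedAddCommGroup E] [NormedSpace ℝ E] [FiniteDimensional ℝ E]
  {H : Type*} [TopologicalSpace H] {I : ModelWithCorners ℝ E H} [I.Boundaryless]
  {M : Type*} [TopologicalSpace M] [ChartedSpace H M] [IsManifold I ∞ M] [T2Space M]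
  [SigmaCompactSpace M]
  {E' : Type*} [NormedAddCommGroup E'] [NormedSpace ℝ E'] [FiniteDimensional ℝ E']
  {H' : Type*} [TopologicalSpace H'] {J : ModelWithCorners ℝ E' H'} [J.Boundaryless]
  {N : Type*} [TopologicalSpace N] [ChartedSpace H' N] [IsManifold J ∞ N] [T2Space N]
  [SigmaCompactSpace N]
  {L : DiracStructure I M} {K : DiracStructure J N} {φ : C^∞⟮I, M; J, N⟯}

/-! ### The projections of `R` are Lie algebroid morphisms -/

theorem toProdGTan_sum {ι : Type*} [Fintype ι] {x : M} {y : N} (c : ι → ℝ) (u : ι → GTan I x)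
    (w : ι → GTan J y) : toProdGTan (∑ i, c i • u i) (∑ i, c i • w i)
      = ∑ i, c i • toProdGTan (u i) (w i) := by
  have := map_sum (toProdEquiv I J x y) (fun i => c i • (u i, w i)) Finset.univ
  simp only [map_smul] at this
  refine Eq.trans ?_ this
  change _ = toProdGTan _ _
  congr 1
  · simp [Prod.fst_sum]
  · simp [Prod.snd_sum]

/-- Allows the bracket on `R` to be computed at a point from representatives that are smooth only at
that point of the graph and restrict correctly only near it. The global extensions serve for
comparison. -/
theorem RestrictsTo.bracket_eq_local {S T : smoothSections (I.prod J) (GModel (E × E'))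
      (L.prod K).fiber} {s t : smoothSections I (GModel E × GModel E') (diracR L K φ)}
    (hS : RestrictsTo φ S.1 s.1) (hT : RestrictsTo φ T.1 t.1) {S' T' : ∀ p : M × N,
      GTan (I.prod J) p} {x : M} (sS : SmoothGenAt (I.prod J) S' (x, φ x))
    (sT : SmoothGenAt (I.prod J) T' (x, φ x)) (mS : ∀ p, S' p ∈ prodFiber L K p)
    (mT : ∀ p, T' p ∈ prodFiber L K p)
    (eS : ∀ᶠ y in 𝓝 x, S' (y, φ y) = toProdGTan (s.1 y).1 (s.1 y).2)
    (eT : ∀ᶠ y in 𝓝 x, T' (y, φ y) = toProdGTan (t.1 y).1 (t.1 y).2) :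
    courantBracket (I.prod J) S' T' (x, φ x)
      = toProdGTan (((graphAlgebroid L K φ).bracket s t).1 x).1
        (((graphAlgebroid L K φ).bracket s t).1 x).2 :=
  (courantBracket_eq_of_graph (L := L) (K := K) (S.2.1 _) sS (T.2.1 _) sT S.2.2 mS T.2.2 mT
    (hS.tangent x).1 (hT.tangent x).1 (eS.mono fun y hy => hy.trans (hS y).symm)
    (eT.mono fun y hy => hy.trans (hT y).symm)).trans (hS.bracket hT x)

/-- The bracket on `R` of sections given locally by sections of the factors. -/
theorem graphAlgebroid_bracket_expand {ι κ : Type} [Fintype ι] [Fintype κ]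
    {s t : smoothSections I (GModel E × GModel E') (diracR L K φ)} {x : M}
    {c : ι → M → ℝ} {d : κ → M → ℝ} {u : ι → smoothSections I (GModel E) L.fiber}
    {w : ι → smoothSections J (GModel E') K.fiber} {u' : κ → smoothSections I (GModel E) L.fiber}
    {w' : κ → smoothSections J (GModel E') K.fiber}
    (hc : ∀ i, ContMDiffAt I 𝓘(ℝ, ℝ) ∞ (c i) x) (hd : ∀ i, ContMDiffAt I 𝓘(ℝ, ℝ) ∞ (d i) x)
    (h1 : ∀ᶠ y in 𝓝 x, (s.1 y).1 = ∑ i, c i y • (u i).1 y)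
    (h2 : ∀ᶠ y in 𝓝 x, (s.1 y).2 = ∑ i, c i y • ((w i).1 (φ y) : GTan J (φ y)))
    (h3 : ∀ᶠ y in 𝓝 x, (t.1 y).1 = ∑ i, d i y • (u' i).1 y)
    (h4 : ∀ᶠ y in 𝓝 x, (t.1 y).2 = ∑ i, d i y • ((w' i).1 (φ y) : GTan J (φ y))) :
    (((graphAlgebroid L K φ).bracket s t).1 x).1
        = ∑ i, ∑ j, (c i x * d j x) • (L.algebroid.bracket (u i) (u' j)).1 x
          + ∑ j, (graphAlgebroid L K φ).act s (d j) x • (u' j).1 x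
          - ∑ i, (graphAlgebroid L K φ).act t (c i) x • (u i).1 x ∧
      (((graphAlgebroid L K φ).bracket s t).1 x).2
        = ∑ i, ∑ j, (c i x * d j x) • ((K.algebroid.bracket (w i) (w' j)).1 (φ x) : GTan J (φ x))
          + ∑ j, (graphAlgebroid L K φ).act s (d j) x • ((w' j).1 (φ x) : GTan J (φ x))
          - ∑ i, (graphAlgebroid L K φ).act t (c i) x • ((w i).1 (φ x) : GTan J (φ x)) := by
  have key : ∀ {μ : Type} [Fintype μ] {a : μ → M → ℝ}
      (v : μ → smoothSections (I.prod J) (GModel (E × E')) (L.prod K).fiber),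
      (∀ i, ContMDiffAt I 𝓘(ℝ, ℝ) ∞ (a i) x) →
      SmoothGenAt (I.prod J) (fun p => ∑ i, a i p.1 • (v i).1 p) (x, φ x) ∧
      ∀ p, ∑ i, a i p.1 • (v i).1 p ∈ prodFiber L K p := by
    intro μ _ a v ha
    exact ⟨SmoothGenAt.sum fun i _ => SmoothGenAt.smul ((ha i).comp_smooth contMDiffAt_fst)
      ((v i).2.1 _), fun p => sum_mem fun i _ => Submodule.smul_mem _ _ ((v i).2.2 p)⟩
  have restr : ∀ {μ : Type} [Fintype μ] {a : μ → M → ℝ}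
      {u : μ → smoothSections I (GModel E) L.fiber} {w : μ → smoothSections J (GModel E') K.fiber}
      {s : smoothSections I (GModel E × GModel E') (diracR L K φ)},
      (∀ᶠ y in 𝓝 x, (s.1 y).1 = ∑ i, a i y • (u i).1 y) →
      (∀ᶠ y in 𝓝 x, (s.1 y).2 = ∑ i, a i y • ((w i).1 (φ y) : GTan J (φ y))) →
      ∀ᶠ y in 𝓝 x, ∑ i, a i y • (prodSection (u i) (w i)).1 (y, φ y)
        = toProdGTan (s.1 y).1 (s.1 y).2 := by
    intro μ _ a u w s h1 h2
    filter_upwards [h1, h2] with y e1 e2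
    rw [e1, e2]
    exact (toProdGTan_sum (fun i => a i y) _ _).symm
  obtain ⟨sS, mS⟩ := key (fun i => prodSection (u i) (w i)) hc
  obtain ⟨sT, mT⟩ := key (fun i => prodSection (u' i) (w' i)) hd
  have e := RestrictsTo.bracket_eq_local (extension_spec s) (extension_spec t) sS sT mS mT
    (restr h1 h2) (restr h3 h4)
  rw [courantBracket_expand (x := (x, φ x)) (c := fun i p => c i p.1) (d := fun i p => d i p.1)
    (s := fun i => (prodSection (u i) (w i)).1) (t := fun i => (prodSection (u' i) (w' i)).1)
    (fun i => (hc i).comp_smooth contMDiffAt_fst) (fun i => (hd i).comp_smooth contMDiffAt_fst)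
    (fun i => (prodSection (u i) (w i)).2.1 _) (fun i => (prodSection (u' i) (w' i)).2.1 _)
    (fun i j => (prodFiber_isotropic _).1 ((prodSection (u i) (w i)).2.2 _) _
      ((prodSection (u' j) (w' j)).2.2 _)) (Eventually.of_forall fun _ => rfl)
    (Eventually.of_forall fun _ => rfl)] at e
  -- The coefficients depend on the point of `M` only, so just the `M` component of the vector part
  -- acts on them, and that is the anchor of the section of `R`.
  have act_eq : ∀ {a : M → ℝ} {s : smoothSections I (GModel E × GModel E') (diracR L K φ)}
      {Z : GTan (I.prod J) ((x, φ x) : M × N)}, ContMDiffAt I 𝓘(ℝ, ℝ) ∞ a x →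
      Z = toProdGTan (s.1 x).1 (s.1 x).2 →
      mvfderiv (I.prod J) (fun p : M × N => a p.1) (x, φ x) Z.1
        = (graphAlgebroid L K φ).act s a x := by
    intro a s Z ha hZ
    rw [mvfderiv_comp_smooth (ψ := (Prod.fst : M × N → M)) (x := (x, φ x)) ha contMDiffAt_fst,
      mfderiv_fst, hZ]
    rfl
  have e1 := fun j => act_eq (hd j) (restr h1 h2).self_of_nhds
  have e2 := fun i => act_eq (hc i) (restr h3 h4).self_of_nhds
  simp only [e1, e2, courantBracket_prodSection] at e
  -- The identity is moved back through the linear equivalence, so that its two components can be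
  -- read separately.
  have e' : toProdEquiv I J x (φ x)
      (∑ i, ∑ j, (c i x * d j x) • ((L.algebroid.bracket (u i) (u' j)).1 x,
          (K.algebroid.bracket (w i) (w' j)).1 (φ x))
        + ∑ j, (graphAlgebroid L K φ).act s (d j) x • ((u' j).1 x, (w' j).1 (φ x))
        - ∑ i, (graphAlgebroid L K φ).act t (c i) x • ((u i).1 x, (w i).1 (φ x)))
      = toProdEquiv I J x (φ x) ((((graphAlgebroid L K φ).bracket s t).1 x).1,
        (((graphAlgebroid L K φ).bracket s t).1 x).2) := by
    simp only [map_sub, map_add, map_sum, map_smul]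
    exact e
  have e'' := ((toProdEquiv I J x (φ x)).injective e').symm
  refine ⟨(congrArg Prod.fst e'').trans ?_, (congrArg Prod.snd e'').trans ?_⟩
  · simp only [Prod.fst_sub, Prod.fst_add, Prod.fst_sum, Prod.smul_fst]
  · simp only [Prod.snd_sub, Prod.snd_add, Prod.snd_sum, Prod.smul_snd]

theorem DiracStructure.zero_bracket (L : DiracStructure I M)
    (s : smoothSections I (GModel E) L.fiber) : L.algebroid.bracket 0 s = 0 := by
  have := L.isLieAlgebroid.smul_bracket 0 s s
  simpa using this

theorem DiracStructure.bracket_zero (L : DiracStructure I M)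
    (s : smoothSections I (GModel E) L.fiber) : L.algebroid.bracket s 0 = 0 := by
  rw [L.isLieAlgebroid.skew, L.zero_bracket, neg_zero]

/-- The given expansions describe the components in `L` alone. Locally they are completed to `s = ∑
f (σ, 0) + ∑ f' (0, σ')`, and likewise for `t`; the added terms have zero first component, so the
first component of the bracket is the required formula. -/
theorem isLieAlgebroidMorphism_projL (hR : IsSubbundle I (GModel E × GModel E') (diracR L K φ)) :
    IsLieAlgebroidMorphism (graphAlgebroid L K φ) L.algebroid id (projL L K φ) where
  source := isLieAlgebroid_graphAlgebroid hR
  target := L.isLieAlgebroid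
  base_smooth := contMDiff_id
  smooth s := (sectionFst s).2.1
  anchor x a := by
    rw [mfderiv_id]
    rfl
  bracket s t U k l f σ g τ hU hf hg hs ht x hx := by
    have hsU := hU.eventually_mem hx
    obtain ⟨k', f', σ', U₁, hU₁, hx₁, hf', h'⟩ := exists_local_coeff (B := K) φ.contMDiff
      (sectionSnd_smooth s) (fun x => (s.2.2 x).2.2) x
    obtain ⟨l', g', τ', U₂, hU₂, hx₂, hg', h''⟩ := exists_local_coeff (B := K) φ.contMDiff
      (sectionSnd_smooth t) (fun x => (t.2.2 x).2.2) x
    have := (graphAlgebroid_bracket_expand (s := s) (t := t) (x := x)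
      (c := Sum.elim f f') (d := Sum.elim g g') (u := Sum.elim σ fun _ => 0)
      (w := Sum.elim (fun _ => 0) σ') (u' := Sum.elim τ fun _ => 0)
      (w' := Sum.elim (fun _ => 0) τ')
      (Sum.rec (fun i => (hf i).contMDiffAt hsU) fun i => hf' i x hx₁)
      (Sum.rec (fun i => (hg i).contMDiffAt hsU) fun i => hg' i x hx₂)
      (hsU.mono fun y hy => ?_) ((hU₁.eventually_mem hx₁).mono fun y hy => ?_)
      (hsU.mono fun y hy => ?_) ((hU₂.eventually_mem hx₂).mono fun y hy => ?_)).1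
    · ext1
      refine this.trans ?_
      simp [Fintype.sum_sum_type, L.zero_bracket, L.bracket_zero]
      rfl
    · simp only [Fintype.sum_sum_type, Sum.elim_inl, Sum.elim_inr, ZeroMemClass.coe_zero,
        Pi.zero_apply, smul_zero, Finset.sum_const_zero, add_zero]
      refine (congrArg Subtype.val (hs y hy)).trans ?_
      simp only [AddSubmonoidClass.coe_finsetSum, SetLike.val_smul]
      rfl
    · simp only [Fintype.sum_sum_type, Sum.elim_inl, Sum.elim_inr, ZeroMemClass.coe_zero,
        Pi.zero_apply, smul_zero, Finset.sum_const_zero, zero_add]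
      exact h' y hy
    · simp only [Fintype.sum_sum_type, Sum.elim_inl, Sum.elim_inr, ZeroMemClass.coe_zero,
        Pi.zero_apply, smul_zero, Finset.sum_const_zero, add_zero]
      refine (congrArg Subtype.val (ht y hy)).trans ?_
      simp only [AddSubmonoidClass.coe_finsetSum, SetLike.val_smul]
      rfl
    · simp only [Fintype.sum_sum_type, Sum.elim_inl, Sum.elim_inr, ZeroMemClass.coe_zero,
        Pi.zero_apply, smul_zero, Finset.sum_const_zero, zero_add]
      exact h'' y hy

/-- The component in `L` is itself a global section over `M` and enters as one extra term
`(sectionFst s, 0)` with coefficient one, which does not contribute to the second component.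
Compatibility with the anchors is membership in `Γ^φ`. -/
theorem isLieAlgebroidMorphism_projK (hR : IsSubbundle I (GModel E × GModel E') (diracR L K φ)) :
    IsLieAlgebroidMorphism (graphAlgebroid L K φ) K.algebroid φ (projK L K φ) where
  source := isLieAlgebroid_graphAlgebroid hR
  target := K.isLieAlgebroid
  base_smooth := φ.contMDiff
  smooth s := sectionSnd_smooth s
  anchor x a := by
    obtain ⟨v, α, h⟩ := a.2.1
    have h1 : a.1.2.1 = mfderiv I J φ x v := congrArg (fun z => z.2.1) h
    have h2 : a.1.1.1 = v := congrArg (fun z => z.1.1) h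
    refine h1.trans ?_
    rw [← h2]
    rfl
  bracket s t U k l f σ g τ hU hf hg hs ht x hx := by
    have hsU := hU.eventually_mem hx
    have hc : ContMDiffAt I 𝓘(ℝ, ℝ) ∞ (fun _ : M => (1 : ℝ)) x := contMDiffAt_const
    have := (graphAlgebroid_bracket_expand (s := s) (t := t) (x := x)
      (c := Sum.elim (fun (_ : Unit) _ => 1) f) (d := Sum.elim (fun (_ : Unit) _ => 1) g)
      (u := Sum.elim (fun _ => sectionFst s) fun _ => 0)
      (w := Sum.elim (fun _ => 0) σ) (u' := Sum.elim (fun _ => sectionFst t) fun _ => 0)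
      (w' := Sum.elim (fun _ => 0) τ)
      (Sum.rec (fun _ => hc) fun i => (hf i).contMDiffAt hsU)
      (Sum.rec (fun _ => hc) fun i => (hg i).contMDiffAt hsU)
      (Eventually.of_forall fun y => ?_) (hsU.mono fun y hy => ?_)
      (Eventually.of_forall fun y => ?_) (hsU.mono fun y hy => ?_)).2
    · ext1
      refine this.trans ?_
      simp [Fintype.sum_sum_type, K.zero_bracket, K.bracket_zero]
      rfl
    · simp [Fintype.sum_sum_type]
      rfl
    · simp only [Fintype.sum_sum_type, Sum.elim_inl, Sum.elim_inr, ZeroMemClass.coe_zero,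
        Pi.zero_apply, smul_zero, Finset.sum_const_zero, zero_add]
      refine (congrArg Subtype.val (hs y hy)).trans ?_
      simp only [AddSubmonoidClass.coe_finsetSum, SetLike.val_smul]
      rfl
    · simp [Fintype.sum_sum_type]
      rfl
    · simp only [Fintype.sum_sum_type, Sum.elim_inl, Sum.elim_inr, ZeroMemClass.coe_zero,
        Pi.zero_apply, smul_zero, Finset.sum_const_zero, zero_add]
      refine (congrArg Subtype.val (ht y hy)).trans ?_
      simp only [AddSubmonoidClass.coe_finsetSum, SetLike.val_smul]
      rfl

end GraphMorphisms

section CohomologyPullback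

variable {E : Type*} [NormedAddCommGroup E] [NormedSpace ℝ E] [FiniteDimensional ℝ E]
  {H : Type*} [TopologicalSpace H] {I : ModelWithCorners ℝ E H} [I.Boundaryless]
  {M : Type*} [TopologicalSpace M] [ChartedSpace H M] [IsManifold I ∞ M]
  {E' : Type*} [NormedAddCommGroup E'] [NormedSpace ℝ E'] [FiniteDimensional ℝ E']
  {H' : Type*} [TopologicalSpace H'] {J : ModelWithCorners ℝ E' H'} [J.Boundaryless]
  {N : Type*} [TopologicalSpace N] [ChartedSpace H' N] [IsManifold J ∞ N] [T2Space N]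
  {F : Type*} [NormedAddCommGroup F] [NormedSpace ℝ F] {V : M → Type*}
  [∀ x, AddCommGroup (V x)] [∀ x, Module ℝ (V x)] [∀ x, TopologicalSpace (V x)]
  [TopologicalSpace (TotalSpace F V)] [FiberBundle F V] [VectorBundle ℝ F V]
  {A : ∀ x : M, Submodule ℝ (V x)}
  {F' : Type*} [NormedAddCommGroup F'] [NormedSpace ℝ F'] [FiniteDimensional ℝ F'] {V' : N → Type*}
  [∀ y, AddCommGroup (V' y)] [∀ y, Module ℝ (V' y)] [∀ y, TopologicalSpace (V' y)]
  [TopologicalSpace (TotalSpace F' V')] [FiberBundle F' V'] [VectorBundle ℝ F' V']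
  {B : ∀ y : N, Submodule ℝ (V' y)}
  {P : AlgebroidData I F A} {Q : AlgebroidData J F' B} {φ : M → N}
  {Φ : ∀ x : M, A x →ₗ[ℝ] B (φ x)}

/-! ### Pullback in the first Lie algebroid cohomology -/

theorem IsLieAlgebroidMorphism.exists_local_coeff (h : IsLieAlgebroidMorphism P Q φ Φ)
    (s : smoothSections I F A) (x₀ : M) :
    ∃ (l : ℕ) (f : Fin l → M → ℝ) (σ : Fin l → smoothSections J F' B) (U : Set M),
      IsOpen U ∧ x₀ ∈ U ∧ (∀ i, ContMDiffOn I 𝓘(ℝ, ℝ) ∞ (f i) U) ∧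
      ∀ x ∈ U, Φ x (secVal s x) = ∑ i, f i x • secVal (σ i) (φ x) := by
  obtain ⟨l, σ, W, hW, hx, hσ⟩ := h.target.subbundle.exists_sectionFrame (φ x₀)
  obtain ⟨f, hf, hf'⟩ := hσ.exists_smooth_coeff (J := I) hW φ
    (fun x => (Φ x (secVal s x) : V' (φ x))) fun x => (Φ x (secVal s x)).2
  refine ⟨l, f, σ, φ ⁻¹' W, hW.preimage h.base_smooth.continuous, hx, fun i x hx =>
    (hf' x hx (h.base_smooth x) (h.smooth s x) i).contMDiffWithinAt, fun x hx => ?_⟩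
  ext1
  refine (hf x hx).trans ?_
  simp only [AddSubmonoidClass.coe_finsetSum, SetLike.val_smul]
  rfl

theorem pullbackForm_apply_eq {α : ∀ y : N, B y →ₗ[ℝ] ℝ} {s : smoothSections I F A} {l : ℕ}
    {f : Fin l → M → ℝ} {σ : Fin l → smoothSections J F' B} {x : M}
    (h : Φ x (secVal s x) = ∑ i, f i x • secVal (σ i) (φ x)) :
    pullbackForm φ Φ α x (secVal s x) = ∑ i, f i x * α (φ x) (secVal (σ i) (φ x)) := by
  change α (φ x) (Φ x (secVal s x)) = _
  rw [h]
  simp only [map_sum, map_smul, smul_eq_mul]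

theorem IsLieAlgebroidMorphism.pullback_mem_aForms (h : IsLieAlgebroidMorphism P Q φ Φ)
    {α : ∀ y : N, B y →ₗ[ℝ] ℝ} (hα : α ∈ aForms J F' B) : pullbackForm φ Φ α ∈ aForms I F A := by
  intro s x₀
  obtain ⟨l, f, σ, U, hU, hx, hf, e⟩ := h.exists_local_coeff s x₀
  have : ContMDiffAt I 𝓘(ℝ, ℝ) ∞
      (fun x => ∑ i, f i x * α (φ x) (secVal (σ i) (φ x))) x₀ :=
    ContMDiffAt.sum fun i _ => ((hf i).contMDiffAt (hU.mem_nhds hx)).mul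
      ((hα (σ i) (φ x₀)).comp_smooth (h.base_smooth x₀))
  exact this.congr_of_eventuallyEq
    ((hU.eventually_mem hx).mono fun x hx => pullbackForm_apply_eq (e x hx))

/-- The product rule separates the derivatives of the coefficients `g j` from those of the functions
`α(τ j) ∘ φ`; compatibility with the anchors turns the latter into derivatives along the `σ i`. -/
theorem IsLieAlgebroidMorphism.act_pullback (h : IsLieAlgebroidMorphism P Q φ Φ)
    {α : ∀ y : N, B y →ₗ[ℝ] ℝ} (hα : α ∈ aForms J F' B) {s t : smoothSections I F A} {k l : ℕ}
    {f : Fin k → M → ℝ} {σ : Fin k → smoothSections J F' B}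
    {g : Fin l → M → ℝ} {τ : Fin l → smoothSections J F' B} {U : Set M} (hU : IsOpen U)
    (hg : ∀ i, ContMDiffOn I 𝓘(ℝ, ℝ) ∞ (g i) U)
    (es : ∀ x ∈ U, Φ x (secVal s x) = ∑ i, f i x • secVal (σ i) (φ x))
    (et : ∀ x ∈ U, Φ x (secVal t x) = ∑ i, g i x • secVal (τ i) (φ x)) {x : M} (hx : x ∈ U) :
    P.act s (fun y => pullbackForm φ Φ α y (secVal t y)) x
      = ∑ j, P.act s (g j) x * α (φ x) (secVal (τ j) (φ x))
        + ∑ j, ∑ i, g j x * (f i x * Q.act (σ i) (fun y => α y (secVal (τ j) y)) (φ x)) := by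
  have hφ := h.base_smooth x
  have sg := fun j => (hg j).contMDiffAt (hU.mem_nhds hx)
  have sa := fun j => hα (τ j) (φ x)
  have e1 : mfderiv I J φ x (P.anchorField s x) = ∑ i, f i x • Q.anchorField (σ i) (φ x) := by
    refine (h.anchor x (secVal s x)).symm.trans ?_
    rw [es x hx, map_sum]
    simp only [map_smul]
    rfl
  have e2 : ∀ j, mvfderiv I (fun y => α (φ y) (secVal (τ j) (φ y))) x (P.anchorField s x)
      = ∑ i, f i x * Q.act (σ i) (fun y => α y (secVal (τ j) y)) (φ x) := fun j => by
    rw [mvfderiv_comp_smooth (f := fun y => α y (secVal (τ j) y)) (sa j) hφ,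
      ContinuousLinearMap.comp_apply, e1, map_sum]
    simp only [map_smul, smul_eq_mul]
    rfl
  have e0 : mvfderiv I (fun y => pullbackForm φ Φ α y (secVal t y)) x
      = ∑ j, mvfderiv I (fun y => g j y * α (φ y) (secVal (τ j) (φ y))) x := by
    rw [← mvfderiv_sum_of_smooth (f := fun j y => g j y * α (φ y) (secVal (τ j) (φ y)))
      fun j _ => (sg j).mul ((sa j).comp_smooth hφ)]
    exact mvfderiv_congr
      ((hU.eventually_mem hx).mono fun x hx => pullbackForm_apply_eq (et x hx))
  simp only [AlgebroidData.act] at e2 ⊢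
  rw [e0, sum_apply, ← Finset.sum_add_distrib]
  refine Finset.sum_congr rfl fun j _ => ?_
  rw [mvfderiv_mul_of_smooth (sg j) ((sa j).comp_smooth hφ), e2, Finset.mul_sum]

/-- The derivatives of the coefficients produced by `act_pullback` cancel those in the bracket
formula of a morphism. What is left is `∑ f_i g_j (dα)(σ_i, τ_j)`, which vanishes. -/
theorem IsLieAlgebroidMorphism.pullback_mem_closedForms (h : IsLieAlgebroidMorphism P Q φ Φ)
    {α : ∀ y : N, B y →ₗ[ℝ] ℝ} (hα : α ∈ Q.closedForms) :
    pullbackForm φ Φ α ∈ P.closedForms := by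
  refine ⟨h.pullback_mem_aForms hα.1, fun s t x => ?_⟩
  obtain ⟨k, f, σ, U, hU, hx, hf, es⟩ := h.exists_local_coeff s x
  obtain ⟨l, g, τ, W, hW, hxW, hg, et⟩ := h.exists_local_coeff t x
  have hUW := hU.inter hW
  have hxUW : x ∈ U ∩ W := ⟨hx, hxW⟩
  have hf' := fun i => (hf i).mono (Set.inter_subset_left (t := W))
  have hg' := fun i => (hg i).mono (Set.inter_subset_right (s := U))
  have es' : ∀ x ∈ U ∩ W, Φ x (secVal s x) = ∑ i, f i x • secVal (σ i) (φ x) :=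
    fun x hx => es x hx.1
  have et' : ∀ x ∈ U ∩ W, Φ x (secVal t x) = ∑ i, g i x • secVal (τ i) (φ x) :=
    fun x hx => et x hx.2
  have hb := h.bracket s t _ _ _ f σ g τ hUW hf' hg' es' et' x hxUW
  have e3 : pullbackForm φ Φ α x (secVal (P.bracket s t) x)
      = ∑ i, ∑ j, (f i x * g j x) * α (φ x) (secVal (Q.bracket (σ i) (τ j)) (φ x))
        + ∑ j, P.act s (g j) x * α (φ x) (secVal (τ j) (φ x))
        - ∑ i, P.act t (f i) x * α (φ x) (secVal (σ i) (φ x)) := by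
    change α (φ x) (Φ x _) = _
    rw [hb]
    simp only [map_sub, map_add, map_sum, map_smul, smul_eq_mul]
  have hd : ∀ i j, α (φ x) (secVal (Q.bracket (σ i) (τ j)) (φ x))
      = Q.act (σ i) (fun y => α y (secVal (τ j) y)) (φ x)
        - Q.act (τ j) (fun y => α y (secVal (σ i) y)) (φ x) := fun i j => by
    have := hα.2 (σ i) (τ j) (φ x)
    rw [AlgebroidData.dOne] at this
    linarith
  rw [AlgebroidData.dOne, h.act_pullback hα.1 hUW hg' es' et' hxUW,
    h.act_pullback hα.1 hUW hf' et' es' hxUW, e3]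
  simp only [hd, mul_sub, Finset.sum_sub_distrib]
  rw [Finset.sum_comm (s := (Finset.univ : Finset (Fin l)))]
  have r1 : ∀ i j, g j x * (f i x * Q.act (σ i) (fun y => α y (secVal (τ j) y)) (φ x))
      = f i x * g j x * Q.act (σ i) (fun y => α y (secVal (τ j) y)) (φ x) := fun i j => by ring
  have r2 : ∀ i j, f i x * (g j x * Q.act (τ j) (fun y => α y (secVal (σ i) y)) (φ x))
      = f i x * g j x * Q.act (τ j) (fun y => α y (secVal (σ i) y)) (φ x) := fun i j => by ring
  simp only [r1, r2]
  ring

/-- By compatibility with the anchors, a primitive `f` of `α` gives the primitive `f ∘ φ` of the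
pullback. -/
theorem IsLieAlgebroidMorphism.pullback_mem_exactForms (h : IsLieAlgebroidMorphism P Q φ Φ)
    {α : ∀ y : N, B y →ₗ[ℝ] ℝ} (hα : α ∈ Q.exactForms) :
    pullbackForm φ Φ α ∈ P.exactForms := by
  obtain ⟨f, hf, e⟩ := hα
  refine ⟨fun x => f (φ x), hf.comp h.base_smooth, fun x a => ?_⟩
  change α (φ x) (Φ x a) = _
  rw [e, h.anchor, mvfderiv_comp_smooth (hf (φ x)) (h.base_smooth x)]
  rfl

/-- Pullback of closed one-forms along a Lie algebroid morphism. -/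
def IsLieAlgebroidMorphism.pullbackClosed (h : IsLieAlgebroidMorphism P Q φ Φ) :
    Q.closedForms →ₗ[ℝ] P.closedForms where
  toFun α := ⟨pullbackForm φ Φ α.1, h.pullback_mem_closedForms α.2⟩
  map_add' _ _ := rfl
  map_smul' _ _ := rfl

/-- A Lie algebroid morphism induces a unique pullback map in cohomology. -/
theorem IsLieAlgebroidMorphism.existsUnique_cohomologyPullback
    (h : IsLieAlgebroidMorphism P Q φ Φ) :
    ∃! T : Q.H1 →ₗ[ℝ] P.H1, IsCohomologyPullback P Q φ Φ T := by
  refine ⟨Submodule.mapQ _ _ h.pullbackClosed fun α hα => ?_, fun α => ?_, fun T hT => ?_⟩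
  · exact h.pullback_mem_exactForms hα
  · exact ⟨h.pullback_mem_closedForms α.2, rfl⟩
  · refine Submodule.linearMap_qext _ (LinearMap.ext fun α => ?_)
    obtain ⟨h', e⟩ := hT α
    exact e

end CohomologyPullback

section BasisFamilies

variable {W : Type*} [AddCommGroup W] [Module ℝ W] {X : Type*} [AddCommGroup X] [Module ℝ X] {r : ℕ}

/-! ### Coordinates with respect to a family that is a basis -/

/-- The family `v` is a basis of `W`. -/
def IsBasisFamily (v : Fin r → W) : Prop :=
  LinearIndependent ℝ v ∧ Submodule.span ℝ (Set.range v) = ⊤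

/-- The basis given by a family. -/
def IsBasisFamily.basis {v : Fin r → W} (h : IsBasisFamily v) : Module.Basis (Fin r) ℝ W :=
  Module.Basis.mk h.1 h.2.ge

theorem IsBasisFamily.basis_apply {v : Fin r → W} (h : IsBasisFamily v) (i : Fin r) :
    h.basis i = v i := Module.Basis.mk_apply _ _ i

theorem IsBasisFamily.coe_basis {v : Fin r → W} (h : IsBasisFamily v) : ⇑h.basis = v :=
  funext h.basis_apply

open Classical in
/-- The coordinates of a vector in the basis `v` (zero if `v` is not a basis). -/
def familyCoord (v : Fin r → W) : W →ₗ[ℝ] (Fin r → ℝ) :=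
  if h : IsBasisFamily v then h.basis.equivFun.toLinearMap else 0

/-- The sum of the diagonal coordinates of the family `B` in the basis `v`. -/
def familyTrace (v B : Fin r → W) : ℝ := ∑ i, familyCoord v (B i) i

/-- The determinant of the family `w` in the basis `v`. -/
def familyDet (v w : Fin r → W) : ℝ := (Matrix.of fun j i => familyCoord v (w i) j).det

variable {v v' : Fin r → W}

theorem IsBasisFamily.familyCoord_apply (h : IsBasisFamily v) (w : W) (i : Fin r) :
    familyCoord v w i = h.basis.repr w i := by
  rw [familyCoord, dif_pos h]
  rfl

theorem IsBasisFamily.sum_familyCoord (h : IsBasisFamily v) (w : W) :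
    ∑ i, familyCoord v w i • v i = w := by
  simp only [h.familyCoord_apply, ← h.basis_apply]
  exact h.basis.sum_repr w

theorem IsBasisFamily.familyCoord_sum (h : IsBasisFamily v) (c : Fin r → ℝ) :
    familyCoord v (∑ i, c i • v i) = c := by
  rw [familyCoord, dif_pos h]
  simp only [← h.basis_apply]
  exact h.basis.equivFun_symm_apply c ▸ h.basis.equivFun.apply_symm_apply c

/-- The components of `w` along the other basis vectors repeat an argument and are killed by the
alternating map. -/
theorem IsBasisFamily.map_update (h : IsBasisFamily v) (f : W [⋀^Fin r]→ₗ[ℝ] X) (i : Fin r) (w : W) :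
    f (Function.update v i w) = familyCoord v w i • f v := by
  conv_lhs => rw [← h.sum_familyCoord w]
  rw [← AlternatingMap.coe_multilinearMap, MultilinearMap.map_update_sum,
    Finset.sum_eq_single i]
  · rw [MultilinearMap.map_update_smul, Function.update_eq_self]
  · intro j _ hj
    rw [MultilinearMap.map_update_smul]
    have := f.map_update_self v hj.symm
    rw [← AlternatingMap.coe_multilinearMap] at this
    rw [this, smul_zero]
  · simp

theorem IsBasisFamily.familyDet_eq (h : IsBasisFamily v) (w : Fin r → W) :
    familyDet v w = h.basis.det w := by
  rw [familyDet, Module.Basis.det_apply]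
  congr 1
  ext j i
  simp [Module.Basis.toMatrix_apply, h.familyCoord_apply]

theorem IsBasisFamily.map_eq_familyDet (h : IsBasisFamily v) (f : W [⋀^Fin r]→ₗ[ℝ] X) (w : Fin r → W) :
    f w = familyDet v w • f v := by
  -- Testing with linear functionals reduces the claim to scalar forms, each of which is a multiple
  -- of the determinant of the basis.
  rw [← sub_eq_zero, ← Module.forall_dual_apply_eq_zero_iff ℝ]
  intro g
  have := congrArg (fun F => F w) (AlternatingMap.eq_smul_basis_det h.basis (g.compAlternatingMap f))
  simp only [LinearMap.compAlternatingMap_apply, AlternatingMap.smul_apply, smul_eq_mul,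
    h.coe_basis, ← h.familyDet_eq] at this
  rw [map_sub, map_smul, this, smul_eq_mul]
  ring

theorem IsBasisFamily.familyDet_ne_zero (h : IsBasisFamily v) (h' : IsBasisFamily v') :
    familyDet v v' ≠ 0 := by
  rw [h.familyDet_eq]
  exact (h.basis.is_basis_iff_det.1 h').ne_zero

theorem IsBasisFamily.familyDet_mul (h : IsBasisFamily v) (h' : IsBasisFamily v') (w : Fin r → W) :
    familyDet v w = familyDet v' w * familyDet v v' := by
  have := h'.map_eq_familyDet h.basis.det w
  rw [← h.familyDet_eq, ← h.familyDet_eq] at this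
  exact this

theorem IsBasisFamily.ιMulti_ne_zero (h : IsBasisFamily v) : exteriorPower.ιMulti ℝ r v ≠ 0 := by
  intro h0
  have := congrArg (exteriorPower.alternatingMapLinearEquiv h.basis.det) h0
  rw [exteriorPower.alternatingMapLinearEquiv_apply_ιMulti, map_zero] at this
  have h1 := h.basis.det_self
  rw [h.coe_basis] at h1
  rw [h1] at this
  exact one_ne_zero this

/-- Functionals that do not vanish on the two factors give a functional on the tensor product that
does not vanish on the pure tensor. -/
theorem tmul_ne_zero_of_ne_zero {u : W} {w : X} (hu : u ≠ 0) (hw : w ≠ 0) : u ⊗ₜ[ℝ] w ≠ 0 := by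
  intro h0
  obtain ⟨f, hf⟩ := not_forall.1 (mt (Module.forall_dual_apply_eq_zero_iff ℝ u).1 hu)
  obtain ⟨g, hg⟩ := not_forall.1 (mt (Module.forall_dual_apply_eq_zero_iff ℝ w).1 hw)
  have := congrArg (TensorProduct.dualDistrib ℝ W X (f ⊗ₜ[ℝ] g)) h0
  rw [TensorProduct.dualDistrib_apply, map_zero] at this
  exact mul_ne_zero hf hg this

theorem IsBasisFamily.familyTrace_eq_trace (h : IsBasisFamily v) (T : W →ₗ[ℝ] W) :
    familyTrace v (fun i => T (v i)) = LinearMap.trace ℝ W T := by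
  rw [LinearMap.trace_eq_matrix_trace ℝ h.basis, Matrix.trace, familyTrace]
  refine Finset.sum_congr rfl fun i _ => ?_
  rw [Matrix.diag_apply, LinearMap.toMatrix_apply, h.familyCoord_apply, h.basis_apply]

theorem familyTrace_add (v B B' : Fin r → W) :
    familyTrace v (fun i => B i + B' i) = familyTrace v B + familyTrace v B' := by
  simp [familyTrace, Finset.sum_add_distrib]

theorem familyTrace_sub (v B B' : Fin r → W) :
    familyTrace v (fun i => B i - B' i) = familyTrace v B - familyTrace v B' := by
  simp [familyTrace, Finset.sum_sub_distrib]

theorem familyTrace_smul (v B : Fin r → W) (c : ℝ) :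
    familyTrace v (fun i => c • B i) = c * familyTrace v B := by
  simp [familyTrace, Finset.mul_sum]

theorem IsBasisFamily.familyTrace_sum (h : IsBasisFamily v) (S : Fin r → Fin r → ℝ) :
    familyTrace v (fun j => ∑ i, S i j • v i) = ∑ i, S i i :=
  Finset.sum_congr rfl fun j _ => congrArg (fun f => f j) (h.familyCoord_sum fun i => S i j)

/-- The change of the trace of a derivation under a change of the basis. -/
theorem IsBasisFamily.familyTrace_change (h : IsBasisFamily v) (h' : IsBasisFamily v')
    {A dA : Matrix (Fin r) (Fin r) ℝ} {B B' : Fin r → W} (hv : ∀ i, v' i = ∑ j, A j i • v j)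
    (hB : ∀ i, B' i = ∑ j, A j i • B j + ∑ j, dA j i • v j) :
    A.det * familyTrace v' B'
      = A.det * familyTrace v B + ∑ i, (A.updateCol i fun j => dA j i).det := by
  -- A derivation is not linear over functions, but at one point its values on the new basis are
  -- those of this linear map plus a term in the derivatives of the transition matrix. The trace of
  -- the linear map is the same in both bases.
  let T : W →ₗ[ℝ] W := h.basis.constr ℝ B
  have hT : ∀ i, T (v i) = B i := fun i => by
    rw [← h.basis_apply]
    exact h.basis.constr_basis ℝ B i
  have e1 : ∀ i, B' i = T (v' i) + ∑ j, dA j i • v j := fun i => by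
    rw [hB, hv, map_sum]
    simp only [map_smul, hT]
  have e2 : familyTrace v B = LinearMap.trace ℝ W T := by
    rw [← h.familyTrace_eq_trace]
    simp only [hT]
  have e3 : familyTrace v' (fun i => T (v' i)) = LinearMap.trace ℝ W T := h'.familyTrace_eq_trace T
  have hA : ∀ i, h.basis.repr (v' i) = Finsupp.equivFunOnFinite.symm fun j => A j i := fun i => by
    ext j
    rw [← h.familyCoord_apply, hv, h.familyCoord_sum fun j => A j i]
    rfl
  have hM : h.basis.toMatrix v' = A := by
    ext j i
    rw [Module.Basis.toMatrix_apply, hA]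
    rfl
  -- Cramer's rule in the basis `v'`: replacing a column of `A` multiplies the determinant by the
  -- matching coordinate of the new column.
  have e4 : ∀ i, (A.updateCol i fun j => dA j i).det
      = familyCoord v' (∑ j, dA j i • v j) i * A.det := fun i => by
    have := h'.map_update h.basis.det i (∑ j, dA j i • v j)
    rw [Module.Basis.det_apply, Module.Basis.det_apply, Module.Basis.toMatrix_update, hM] at this
    have e : (h.basis.repr (∑ j, dA j i • v j) : Fin r → ℝ) = fun j => dA j i := by
      funext j
      rw [← h.familyCoord_apply, h.familyCoord_sum fun j => dA j i]
    rw [e] at this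
    exact this
  have e5 : familyTrace v' B' = familyTrace v' (fun i => T (v' i))
      + familyTrace v' (fun i => ∑ j, dA j i • v j) := by
    rw [← familyTrace_add]
    simp only [← e1]
  rw [e5, e3, e2]
  simp only [e4]
  rw [← Finset.sum_mul, familyTrace]
  ring

/-- The trace of the curvature of a commutator of derivations. -/
theorem IsBasisFamily.familyTrace_commutator (h : IsBasisFamily v) {S T dS dT : Fin r → Fin r → ℝ}
    {B C D : Fin r → W} (hB : ∀ j, B j = ∑ i, S i j • v i) (hC : ∀ j, C j = ∑ i, T i j • v i)
    (hD : ∀ j, D j = (∑ i, T i j • B i + ∑ i, dT i j • v i)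
      - (∑ i, S i j • C i + ∑ i, dS i j • v i)) :
    familyTrace v D = ∑ i, dT i i - ∑ i, dS i i := by
  have e : D = fun j => (∑ i, (∑ k, T k j * S i k) • v i + ∑ i, dT i j • v i)
      - (∑ i, (∑ k, S k j * T i k) • v i + ∑ i, dS i j • v i) := by
    funext j
    rw [hD]
    simp only [hB, hC, Finset.smul_sum, smul_smul, Finset.sum_smul]
    congr 2 <;> exact Finset.sum_comm
  rw [e, familyTrace_sub, familyTrace_add, familyTrace_add, h.familyTrace_sum, h.familyTrace_sum,
    h.familyTrace_sum, h.familyTrace_sum]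
  -- The products of the two connection matrices have equal traces, so only the derivatives of their
  -- entries survive.
  have : ∑ i, ∑ k, T k i * S i k = ∑ i, ∑ k, S k i * T i k := by
    rw [Finset.sum_comm]
    exact Finset.sum_congr rfl fun i _ => Finset.sum_congr rfl fun k _ => mul_comm _ _
  rw [this]
  ring

end BasisFamilies

section Derivations

variable {E : Type*} [NormedAddCommGroup E] [NormedSpace ℝ E] [FiniteDimensional ℝ E]
  {H : Type*} [TopologicalSpace H] {I : ModelWithCorners ℝ E H} [I.Boundaryless]
  {M : Type*} [TopologicalSpace M] [ChartedSpace H M] [IsManifold I ∞ M]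

/-! ### Derivations of the sections of a vector bundle -/

/-- The derivative of a determinant. -/
theorem mvfderiv_det {k : ℕ} {G : M → Matrix (Fin k) (Fin k) ℝ} {x : M}
    (hG : ∀ i j, ContMDiffAt I 𝓘(ℝ, ℝ) ∞ (fun x => G x i j) x) (v : TangentSpace I x) :
    mvfderiv I (fun y => (G y).det) x v
      = ∑ i, ((G x).updateCol i fun j => mvfderiv I (fun y => G y j i) x v).det := by
  have hp : ∀ (σ : Equiv.Perm (Fin k)) (s : Finset (Fin k)),
      mvfderiv I (fun y => ∏ i ∈ s, G y (σ i) i) x v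
        = ∑ i ∈ s, mvfderiv I (fun y => G y (σ i) i) x v * ∏ j ∈ s.erase i, G x (σ j) j := by
    intro σ s
    induction s using Finset.induction_on with
    | empty =>
      simp only [Finset.prod_empty, Finset.sum_empty]
      exact congrArg (fun T => T v) (mvfderiv_const (I := I) (1 : ℝ) (x := x))
    | insert a s ha ih =>
      simp only [Finset.prod_insert ha, Finset.sum_insert ha, Finset.erase_insert ha]
      rw [mvfderiv_mul_of_smooth (f := fun y => G y (σ a) a)
        (g := fun y => ∏ i ∈ s, G y (σ i) i) (hG _ _) (contMDiffAt_finsetProd fun i _ => hG _ _),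
        ih, Finset.mul_sum]
      congr 1
      refine Finset.sum_congr rfl fun i hi => ?_
      have hia : a ≠ i := fun h => ha (h ▸ hi)
      rw [Finset.erase_insert_of_ne hia, Finset.prod_insert fun h => ha (Finset.mem_of_mem_erase h)]
      ring
  have hs : ∀ σ : Equiv.Perm (Fin k), ContMDiffAt I 𝓘(ℝ, ℝ) ∞
      (fun y => ∏ i, G y (σ i) i) x := fun σ => contMDiffAt_finsetProd fun i _ => hG _ _
  simp only [Matrix.det_apply']
  rw [mvfderiv_sum_of_smooth (f := fun (σ : Equiv.Perm (Fin k)) y =>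
    ((Equiv.Perm.sign σ : ℤ) : ℝ) * ∏ i, G y (σ i) i) fun σ _ => contMDiffAt_const.mul (hs σ),
    Finset.sum_comm, sum_apply]
  refine Finset.sum_congr rfl fun σ _ => ?_
  rw [mvfderiv_mul_of_smooth (f := fun _ => ((Equiv.Perm.sign σ : ℤ) : ℝ))
    (g := fun y => ∏ i, G y (σ i) i) contMDiffAt_const (hs σ), hp, Finset.mul_sum]
  have h0 : mvfderiv I (fun _ : M => ((Equiv.Perm.sign σ : ℤ) : ℝ)) x v = 0 :=
    congrArg (fun T => T v) (mvfderiv_const (I := I) (((Equiv.Perm.sign σ : ℤ) : ℝ)) (x := x))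
  rw [h0, zero_mul, zero_add]
  refine Finset.sum_congr rfl fun i _ => ?_
  rw [← Finset.mul_prod_erase _ _ (Finset.mem_univ i)]
  congr 2
  · simp
  · refine Finset.prod_congr rfl fun j hj => ?_
    rw [Matrix.updateCol_ne (Finset.ne_of_mem_erase hj)]

variable {F : Type*} [NormedAddCommGroup F] [NormedSpace ℝ F] {V : M → Type*}
  [∀ x, AddCommGroup (V x)] [∀ x, Module ℝ (V x)] [∀ x, TopologicalSpace (V x)]
  [TopologicalSpace (TotalSpace F V)] [FiberBundle F V] [VectorBundle ℝ F V]
  {A : ∀ x : M, Submodule ℝ (V x)}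

/-- `D` is a derivation of `Γ(A)` over the vector field `X`. -/
structure IsSectionDerivation (X : ∀ x : M, TangentSpace I x)
    (D : smoothSections I F A → smoothSections I F A) : Prop where
  add : ∀ s t, D (s + t) = D s + D t
  leibniz : ∀ (t ft : smoothSections I F A) (f : M → ℝ), ContMDiff I 𝓘(ℝ, ℝ) ∞ f →
    (∀ x, ft.1 x = f x • t.1 x) →
    ∀ x, (D ft).1 x = f x • (D t).1 x + mvfderiv I f x (X x) • t.1 x

theorem secVal_add (s t : smoothSections I F A) (x : M) :
    secVal (s + t) x = secVal s x + secVal t x := rfl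

theorem secVal_sub (s t : smoothSections I F A) (x : M) :
    secVal (s - t) x = secVal s x - secVal t x := rfl

theorem secVal_smul (c : ℝ) (s : smoothSections I F A) (x : M) :
    secVal (c • s) x = c • secVal s x := rfl

theorem secVal_zero (x : M) : secVal (0 : smoothSections I F A) x = 0 := rfl

theorem secVal_sum {ι : Type*} (S : Finset ι) (s : ι → smoothSections I F A) (x : M) :
    secVal (∑ i ∈ S, s i) x = ∑ i ∈ S, secVal (s i) x := by
  classical
  induction S using Finset.induction_on with
  | empty => rfl
  | insert a S ha ih => rw [Finset.sum_insert ha, Finset.sum_insert ha, secVal_add, ih]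

/-- The product of a section with a smooth function. -/
def smulSection (f : M → ℝ) (hf : ContMDiff I 𝓘(ℝ, ℝ) ∞ f) (s : smoothSections I F A) :
    smoothSections I F A :=
  ⟨fun x => f x • s.1 x, hf.smul_section s.2.1, fun x => (A x).smul_mem _ (s.2.2 x)⟩

namespace IsSectionDerivation

variable {X : ∀ x : M, TangentSpace I x} {D : smoothSections I F A → smoothSections I F A}

theorem map_zero (h : IsSectionDerivation X D) : D 0 = 0 := by
  simpa using h.add 0 0

theorem map_sub (h : IsSectionDerivation X D) (s t : smoothSections I F A) :
    D (s - t) = D s - D t := by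
  rw [eq_sub_iff_add_eq, ← h.add, sub_add_cancel]

theorem map_neg (h : IsSectionDerivation X D) (s : smoothSections I F A) : D (-s) = -D s := by
  rw [← zero_sub, h.map_sub, h.map_zero, zero_sub]

theorem map_sum (h : IsSectionDerivation X D) {ι : Type*} (S : Finset ι)
    (s : ι → smoothSections I F A) : D (∑ i ∈ S, s i) = ∑ i ∈ S, D (s i) := by
  classical
  induction S using Finset.induction_on with
  | empty => exact h.map_zero
  | insert a S ha ih => rw [Finset.sum_insert ha, Finset.sum_insert ha, h.add, ih]

theorem smul_apply (h : IsSectionDerivation X D) {f : M → ℝ} (hf : ContMDiff I 𝓘(ℝ, ℝ) ∞ f)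
    (s : smoothSections I F A) (x : M) : secVal (D (smulSection f hf s)) x
      = f x • secVal (D s) x + mvfderiv I f x (X x) • secVal s x :=
  Subtype.ext (h.leibniz s (smulSection f hf s) f hf (fun _ => rfl) x)

variable [T2Space M]

/-- Locality of a derivation: a bump function times `s - t` is the zero section, and the derivative
of the bump function is multiplied by a value that vanishes at `x`. -/
theorem congr_of_eventuallyEq (h : IsSectionDerivation X D) {s t : smoothSections I F A} {x : M}
    (hst : ∀ᶠ y in 𝓝 x, secVal s y = secVal t y) : secVal (D s) x = secVal (D t) x := by
  obtain ⟨U, hU, hUo, hx⟩ := eventually_nhds_iff.1 hst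
  obtain ⟨b, hb, hb1, hbU⟩ := exists_bump (I := I) hUo hx
  have e : smulSection b hb (s - t) = 0 := by
    ext y
    by_cases hy : y ∈ U
    · have h1 : (s - t).1 y = 0 := sub_eq_zero.2 (congrArg Subtype.val (hU y hy))
      exact (congrArg (b y • ·) h1).trans (smul_zero _)
    · have : b y = 0 := image_eq_zero_of_notMem_tsupport fun h => hy (hbU h)
      exact (congrArg (· • (s - t).1 y) this).trans (zero_smul _ _)
  have h1 := h.smul_apply hb (s - t) x
  rw [e, h.map_zero, h.map_sub, secVal_sub, secVal_sub, hst.self_of_nhds, sub_self, smul_zero,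
    add_zero, hb1.self_of_nhds, one_smul, secVal_zero] at h1
  exact (sub_eq_zero.1 h1.symm)

/-- The coefficients are smooth only near `x`. Multiplied by a bump function they become global, and
the Leibniz rule then applies without changing anything near `x`. -/
theorem expand (h : IsSectionDerivation X D) {k : ℕ} {t : smoothSections I F A}
    {e : Fin k → smoothSections I F A} {f : Fin k → M → ℝ} {x : M}
    (hf : ∀ i, ∀ᶠ y in 𝓝 x, ContMDiffAt I 𝓘(ℝ, ℝ) ∞ (f i) y)
    (ht : ∀ᶠ y in 𝓝 x, secVal t y = ∑ i, f i y • secVal (e i) y) :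
    secVal (D t) x = ∑ i, f i x • secVal (D (e i)) x
      + ∑ i, mvfderiv I (f i) x (X x) • secVal (e i) x := by
  obtain ⟨U, hU, hUo, hx⟩ := eventually_nhds_iff.1 (eventually_all.2 hf)
  obtain ⟨b, hb, hb1, hbU⟩ := exists_bump (I := I) hUo hx
  have hbf : ∀ i, ContMDiff I 𝓘(ℝ, ℝ) ∞ fun y => b y * f i y := by
    intro i y
    by_cases hy : y ∈ tsupport b
    · exact hb.contMDiffAt.mul (hU y (hbU hy) i)
    · refine (contMDiffAt_const (c := (0 : ℝ))).congr_of_eventuallyEq ?_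
      filter_upwards [(isClosed_tsupport b).isOpen_compl.mem_nhds hy] with z hz
      rw [image_eq_zero_of_notMem_tsupport hz, zero_mul]
  have h1 : secVal (D t) x = secVal (D (∑ i, smulSection _ (hbf i) (e i))) x := by
    refine h.congr_of_eventuallyEq ?_
    filter_upwards [ht, hb1] with y hy hby
    rw [hy, secVal_sum]
    refine Finset.sum_congr rfl fun i _ => Subtype.ext ?_
    show f i y • (e i).1 y = (b y * f i y) • (e i).1 y
    rw [hby, one_mul]
  rw [h1, h.map_sum, secVal_sum, ← Finset.sum_add_distrib]
  refine Finset.sum_congr rfl fun i _ => ?_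
  have h2 : mvfderiv I (fun y => b y * f i y) x = mvfderiv I (f i) x :=
    mvfderiv_congr (hb1.mono fun y hy => by rw [hy, one_mul])
  rw [h.smul_apply, h2, hb1.self_of_nhds, one_mul]

end IsSectionDerivation

/-! ### Traces of derivations -/

/-- The trace of a derivation in a frame: the connection form of the top exterior power. -/
def derivationTrace {k : ℕ} (e : Fin k → smoothSections I F A)
    (D : smoothSections I F A → smoothSections I F A) (x : M) : ℝ :=
  familyTrace (fun i => secVal (e i) x) fun i => secVal (D (e i)) x

/-- The determinant of a frame in terms of another one. -/
def frameDet {k : ℕ} (e e' : Fin k → smoothSections I F A) (x : M) : ℝ :=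
  familyDet (fun i => secVal (e i) x) fun i => secVal (e' i) x

variable {k : ℕ} {e e' : Fin k → smoothSections I F A} {U : Set M}

theorem IsSectionFrame.isBasisFamily (he : IsSectionFrame e U) {x : M} (hx : x ∈ U) :
    IsBasisFamily fun i => secVal (e i) x := ⟨he.basis_indep hx, he.basis_span hx⟩

theorem IsSectionFrame.contMDiffAt_coord [FiniteDimensional ℝ F] (he : IsSectionFrame e U)
    (hU : IsOpen U) (s : smoothSections I F A) {x : M} (hx : x ∈ U) (i : Fin k) :
    ContMDiffAt I 𝓘(ℝ, ℝ) ∞ (fun x => familyCoord (fun i => secVal (e i) x) (secVal s x) i) x := by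
  refine contMDiffAt_frame_coeff (J := I) (φ := id) (e := fun i y => (e i).1 y) (s := s.1)
    (c := fun i x => familyCoord (fun i => secVal (e i) x) (secVal s x) i)
    (fun i => smoothSections_contMDiffAt (e i) x) (smoothSections_contMDiffAt s x)
    (he.indep x hx) ?_ i
  filter_upwards [hU.mem_nhds hx] with y hy
  have := congrArg Subtype.val ((he.isBasisFamily hy).sum_familyCoord (secVal s y))
  rw [AddSubmonoidClass.coe_finsetSum] at this
  exact this.symm

theorem IsSectionFrame.contMDiffAt_derivationTrace [FiniteDimensional ℝ F]
    (he : IsSectionFrame e U) (hU : IsOpen U) (D : smoothSections I F A → smoothSections I F A)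
    {x : M} (hx : x ∈ U) : ContMDiffAt I 𝓘(ℝ, ℝ) ∞ (derivationTrace e D) x :=
  ContMDiffAt.sum (t := Finset.univ) fun i _ => he.contMDiffAt_coord hU (D (e i)) hx i

theorem IsSectionFrame.contMDiffAt_frameDet [FiniteDimensional ℝ F]
    (he : IsSectionFrame e U) (hU : IsOpen U) (e' : Fin k → smoothSections I F A)
    {x : M} (hx : x ∈ U) : ContMDiffAt I 𝓘(ℝ, ℝ) ∞ (frameDet e e') x :=
  contMDiffAt_det fun j i => he.contMDiffAt_coord hU (e' i) hx j

variable [T2Space M] [FiniteDimensional ℝ F]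

/-- Divided by the determinant, this says that the traces in two frames differ by the derivative of
the logarithm of the determinant. The sum of determinants with one differentiated column is the
derivative of the determinant by `mvfderiv_det`. -/
theorem IsSectionDerivation.trace_change {X : ∀ x : M, TangentSpace I x}
    {D : smoothSections I F A → smoothSections I F A} (hD : IsSectionDerivation X D)
    (hU : IsOpen U) (he : IsSectionFrame e U) {x : M} (hx : x ∈ U)
    (he' : IsBasisFamily fun i => secVal (e' i) x) :
    frameDet e e' x * derivationTrace e' D x
      = frameDet e e' x * derivationTrace e D x + mvfderiv I (frameDet e e') x (X x) := by
  let c : Fin k → Fin k → M → ℝ := fun j i x =>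
    familyCoord (fun i => secVal (e i) x) (secVal (e' i) x) j
  have hc : ∀ j i y, y ∈ U → ContMDiffAt I 𝓘(ℝ, ℝ) ∞ (c j i) y := fun j i y hy =>
    he.contMDiffAt_coord hU (e' i) hy j
  have h1 : mvfderiv I (frameDet e e') x (X x) = _ :=
    mvfderiv_det (G := fun x => Matrix.of fun j i => c j i x) (fun j i => hc j i x hx) (X x)
  rw [h1]
  have hv : ∀ y ∈ U, ∀ i, secVal (e' i) y = ∑ j, c j i y • secVal (e j) y := fun y hy i =>
    ((he.isBasisFamily hy).sum_familyCoord _).symm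
  exact (he.isBasisFamily hx).familyTrace_change he' (hv x hx) fun i =>
    hD.expand (f := fun j => c j i)
      (fun j => (hU.eventually_mem hx).mono fun y hy => hc j i y hy)
      ((hU.eventually_mem hx).mono fun y hy => hv y hy i)

/-- The commutator of the two connection matrices has trace zero. This is the source of the
closedness of the connection form on the top exterior power. -/
theorem IsSectionDerivation.trace_commutator {X Y : ∀ x : M, TangentSpace I x}
    {D D' D'' : smoothSections I F A → smoothSections I F A} (hD : IsSectionDerivation X D)
    (hD' : IsSectionDerivation Y D') (hD'' : ∀ t, D'' t = D (D' t) - D' (D t))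
    (hU : IsOpen U) (he : IsSectionFrame e U) {x : M} (hx : x ∈ U) :
    derivationTrace e D'' x = mvfderiv I (derivationTrace e D') x (X x)
      - mvfderiv I (derivationTrace e D) x (Y x) := by
  let S : Fin k → Fin k → M → ℝ := fun i j x =>
    familyCoord (fun i => secVal (e i) x) (secVal (D (e j)) x) i
  let T : Fin k → Fin k → M → ℝ := fun i j x =>
    familyCoord (fun i => secVal (e i) x) (secVal (D' (e j)) x) i
  have hS : ∀ i j y, y ∈ U → ContMDiffAt I 𝓘(ℝ, ℝ) ∞ (S i j) y := fun i j y hy =>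
    he.contMDiffAt_coord hU (D (e j)) hy i
  have hT : ∀ i j y, y ∈ U → ContMDiffAt I 𝓘(ℝ, ℝ) ∞ (T i j) y := fun i j y hy =>
    he.contMDiffAt_coord hU (D' (e j)) hy i
  have eS : ∀ y ∈ U, ∀ j, secVal (D (e j)) y = ∑ i, S i j y • secVal (e i) y := fun y hy i =>
    ((he.isBasisFamily hy).sum_familyCoord _).symm
  have eT : ∀ y ∈ U, ∀ j, secVal (D' (e j)) y = ∑ i, T i j y • secVal (e i) y := fun y hy i =>
    ((he.isBasisFamily hy).sum_familyCoord _).symm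
  have h1 : derivationTrace e D'' x = ∑ i, mvfderiv I (T i i) x (X x)
      - ∑ i, mvfderiv I (S i i) x (Y x) := by
    refine (he.isBasisFamily hx).familyTrace_commutator (S := fun i j => S i j x)
      (T := fun i j => T i j x) (dS := fun i j => mvfderiv I (S i j) x (Y x))
      (dT := fun i j => mvfderiv I (T i j) x (X x)) (eS x hx) (eT x hx) fun j => ?_
    rw [hD'', secVal_sub]
    rw [hD.expand (f := fun i => T i j)
        (fun i => (hU.eventually_mem hx).mono fun y hy => hT i j y hy)
        ((hU.eventually_mem hx).mono fun y hy => eT y hy j),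
      hD'.expand (f := fun i => S i j)
        (fun i => (hU.eventually_mem hx).mono fun y hy => hS i j y hy)
        ((hU.eventually_mem hx).mono fun y hy => eS y hy j)]
  have h2 : mvfderiv I (derivationTrace e D') x = ∑ i, mvfderiv I (T i i) x :=
    mvfderiv_sum_of_smooth (s := Finset.univ) (f := fun i => T i i) fun i _ => hT i i x hx
  have h3 : mvfderiv I (derivationTrace e D) x = ∑ i, mvfderiv I (S i i) x :=
    mvfderiv_sum_of_smooth (s := Finset.univ) (f := fun i => S i i) fun i _ => hS i i x hx
  rw [h1, h2, h3, sum_apply, sum_apply]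

end Derivations

/-! ### Transport of coordinates along a linear equivalence. -/

section BasisFamilyMap

variable {W X : Type*} [AddCommGroup W] [Module ℝ W] [AddCommGroup X] [Module ℝ X] {r : ℕ}

theorem IsBasisFamily.map {v : Fin r → W} (h : IsBasisFamily v) (φ : W ≃ₗ[ℝ] X) :
    IsBasisFamily fun i => φ (v i) := by
  refine ⟨h.1.map' (φ : W →ₗ[ℝ] X) φ.ker, ?_⟩
  have := congrArg (Submodule.map (φ : W →ₗ[ℝ] X)) h.2
  rw [Submodule.map_span, Submodule.map_top, LinearEquiv.range, ← Set.range_comp] at this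
  exact this

theorem IsBasisFamily.familyCoord_map {v : Fin r → W} (h : IsBasisFamily v) (φ : W ≃ₗ[ℝ] X)
    (w : W) : familyCoord (fun i => φ (v i)) (φ w) = familyCoord v w := by
  conv_lhs => rw [← h.sum_familyCoord w, map_sum]
  simp only [map_smul]
  exact (h.map φ).familyCoord_sum _

end BasisFamilyMap

/-! ### The canonical line bundle and its flat connection in local frames. -/

section CanonicalFrames

variable {E : Type*} [NormedAddCommGroup E] [NormedSpace ℝ E] [FiniteDimensional ℝ E]
  {H : Type*} [TopologicalSpace H] {I : ModelWithCorners ℝ E H} [I.Boundaryless]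
  {M : Type*} [TopologicalSpace M] [ChartedSpace H M] [IsManifold I ∞ M]

/-! ### The Lie derivative on the cotangent bundle -/

variable (I) in
/-- The cotangent bundle as a subbundle of itself. -/
abbrev cotanTop (x : M) : Submodule ℝ (Cotan I x) := ⊤

/-- Viewing `T*M` as a subbundle of itself lets the results on section frames and derivations serve
for both factors of the canonical line bundle. -/
theorem isSubbundle_cotanTop : IsSubbundle I (E →L[ℝ] ℝ) (cotanTop I (M := M)) := by
  intro x₀
  have : IsManifold I (((⊤ : ℕ∞) : ℕ∞ω) + 1) M := ‹IsManifold I ∞ M›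
  have : ContMDiffVectorBundle ∞ (E →L[ℝ] ℝ) (fun x : M => Cotan I x) I := inferInstance
  let T := trivializationAt (E →L[ℝ] ℝ) (fun x : M => Cotan I x) x₀
  let b := Module.finBasis ℝ (E →L[ℝ] ℝ)
  have h := T.isLocalFrameOn_localFrame_baseSet I ∞ b
  exact ⟨_, T.baseSet, fun i => T.localFrame b i, T.open_baseSet,
    FiberBundle.mem_baseSet_trivializationAt' x₀, h.contMDiffOn,
    fun x hx => ⟨h.linearIndependent hx, top_le_iff.1 (h.generating hx)⟩⟩

/-- The Lie derivative along a smooth vector field, on smooth one-forms. -/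
def lieDerivSection (X : ∀ x : M, TangentSpace I x) (hX : ∀ x, SmoothVFAt I X x)
    (β : smoothSections I (E →L[ℝ] ℝ) (cotanTop I (M := M))) :
    smoothSections I (E →L[ℝ] ℝ) (cotanTop I (M := M)) :=
  ⟨lieDerivForm I X β.1, fun _ => SmoothFormAt.lieDerivForm (Eventually.of_forall hX)
    (Eventually.of_forall β.2.1), fun _ => Submodule.mem_top⟩

theorem isSectionDerivation_lieDerivSection (X : ∀ x : M, TangentSpace I x)
    (hX : ∀ x, SmoothVFAt I X x) : IsSectionDerivation X (lieDerivSection X hX) where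
  add s t := Subtype.ext <| funext fun x =>
    lieDerivForm_add_right (hX x) (s.2.1 x) (t.2.1 x)
  leibniz t ft f hf hft x := by
    have h : ft.1 = fun x => f x • t.1 x := funext hft
    show lieDerivForm I X ft.1 x = _
    rw [h, add_comm]
    exact lieDerivForm_smul_right (hX x) (hf x) (t.2.1 x)

variable {F : Type*} [NormedAddCommGroup F] [NormedSpace ℝ F] {V : M → Type*}
  [∀ x, AddCommGroup (V x)] [∀ x, Module ℝ (V x)] [∀ x, TopologicalSpace (V x)]
  [TopologicalSpace (TotalSpace F V)] [FiberBundle F V] [VectorBundle ℝ F V]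
  {A : ∀ x : M, Submodule ℝ (V x)} {P : AlgebroidData I F A}

theorem IsLieAlgebroid.isSectionDerivation_bracket (hP : IsLieAlgebroid P)
    (s : smoothSections I F A) : IsSectionDerivation (P.anchorField s) (P.bracket s) where
  add t t' := by
    rw [hP.skew s, hP.add_bracket, hP.skew s t, hP.skew s t', neg_add]
  leibniz t ft f hf hft x := hP.leibniz s t ft f hf hft x

theorem IsLieAlgebroid.smoothVFAt (hP : IsLieAlgebroid P) (s : smoothSections I F A) (x : M) :
    SmoothVFAt I (P.anchorField s) x := hP.anchor_smooth s x

/-! ### Local frames of the canonical line bundle -/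

variable (I F A) in
/-- A local frame of `A` and of `T*M`. -/
structure CanonicalFrame (r : ℕ) where
  /-- the frame of `A` -/
  e : Fin r → smoothSections I F A
  /-- the frame of `T*M` -/
  θ : Fin (Module.finrank ℝ E) → smoothSections I (E →L[ℝ] ℝ) (cotanTop I (M := M))
  /-- the domain -/
  U : Set M
  isOpen : IsOpen U
  frame_e : IsSectionFrame e U
  frame_θ : IsSectionFrame θ U

namespace CanonicalFrame

variable {r : ℕ}

/-- The section of the canonical line bundle given by a frame. -/
def elt (f : CanonicalFrame I F A r) (x : M) : CanLine I A r x :=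
  frameElt f.e (fun i => (f.θ i).1) x

/-- The factor between the sections of the canonical line bundle given by two frames. -/
def det (f g : CanonicalFrame I F A r) (x : M) : ℝ :=
  frameDet f.e g.e x * frameDet f.θ g.θ x

/-- The frame of the canonical line bundle given by a frame pair. -/
def ofFramePair {e : Fin r → smoothSections I F A}
    {θ : Fin (Module.finrank ℝ E) → ∀ x : M, Cotan I x} {U : Set M} (hU : IsOpen U)
    (h : IsFramePair e θ U) : CanonicalFrame I F A r where
  e := e
  θ i := ⟨θ i, h.smooth i, fun _ => Submodule.mem_top⟩
  U := U
  isOpen := hU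
  frame_e := isSectionFrame_of_secVal h.indep_e h.span_e
  frame_θ := ⟨h.indep_θ, h.span_θ⟩

theorem isFramePair (f : CanonicalFrame I F A r) : IsFramePair f.e (fun i => (f.θ i).1) f.U where
  smooth i := (f.θ i).2.1
  indep_e _ hx := f.frame_e.basis_indep hx
  span_e _ hx := f.frame_e.basis_span hx
  indep_θ x hx := f.frame_θ.indep x hx
  span_θ x hx := f.frame_θ.span x hx

theorem exists_mem [T2Space M] (hA : IsSubbundle I F A)
    (hr : ∀ x, Module.finrank ℝ (A x) = r) (x : M) : ∃ f : CanonicalFrame I F A r, x ∈ f.U := by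
  obtain ⟨k, e, U, hU, hx, he⟩ := hA.exists_sectionFrame x
  obtain ⟨l, θ, W, hW, hxW, hθ⟩ := (isSubbundle_cotanTop (I := I) (M := M)).exists_sectionFrame x
  have hk : k = r := (he.finrank_eq hx).symm.trans (hr x)
  have hl : l = Module.finrank ℝ E := by
    rw [← hθ.finrank_eq hxW, finrank_top]
    refine Eq.trans (b := Module.finrank ℝ (E →L[ℝ] ℝ)) rfl ?_
    rw [← (LinearMap.toContinuousLinearMap (E := E) (F' := ℝ)).finrank_eq]
    exact Subspace.dual_finrank_eq
  subst hk hl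
  exact ⟨⟨e, θ, U ∩ W, hU.inter hW, ⟨fun y hy => he.indep y hy.1, fun y hy => he.span y hy.1⟩,
    ⟨fun y hy => hθ.indep y hy.2, fun y hy => hθ.span y hy.2⟩⟩, hx, hxW⟩

variable (f g h : CanonicalFrame I F A r) {x : M}

theorem elt_ne_zero (hx : x ∈ f.U) : f.elt x ≠ 0 :=
  tmul_ne_zero_of_ne_zero (f.frame_e.isBasisFamily hx).ιMulti_ne_zero
    (IsBasisFamily.ιMulti_ne_zero ⟨f.frame_θ.indep x hx, f.frame_θ.span x hx⟩)

theorem det_ne_zero (hf : x ∈ f.U) (hg : x ∈ g.U) : f.det g x ≠ 0 :=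
  mul_ne_zero ((f.frame_e.isBasisFamily hf).familyDet_ne_zero (g.frame_e.isBasisFamily hg))
    ((f.frame_θ.isBasisFamily hf).familyDet_ne_zero (g.frame_θ.isBasisFamily hg))

theorem det_trans (hf : x ∈ f.U) (hg : x ∈ g.U) : f.det h x = g.det h x * f.det g x := by
  have h1 := (f.frame_e.isBasisFamily hf).familyDet_mul (g.frame_e.isBasisFamily hg)
    fun i => secVal (h.e i) x
  have h2 := (f.frame_θ.isBasisFamily hf).familyDet_mul (g.frame_θ.isBasisFamily hg)
    fun i => secVal (h.θ i) x
  simp only [det, frameDet]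
  rw [h1, h2]
  ring

theorem elt_eq (hf : x ∈ f.U) : g.elt x = f.det g x • f.elt x := by
  have h1 := (f.frame_e.isBasisFamily hf).map_eq_familyDet (exteriorPower.ιMulti ℝ r)
    fun i => secVal (g.e i) x
  have hθ := f.frame_θ.isBasisFamily hf
  -- The fiber of the line bundle is built from the cotangent space and not from its top submodule,
  -- so the frame is moved across `Submodule.topEquiv`; coordinates are unchanged.
  have h2 := (hθ.map Submodule.topEquiv).map_eq_familyDet
    (exteriorPower.ιMulti ℝ (Module.finrank ℝ E)) fun i => (g.θ i).1 x
  have h3 : familyDet (fun i => Submodule.topEquiv (secVal (f.θ i) x)) (fun i => (g.θ i).1 x)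
      = frameDet f.θ g.θ x := by
    refine congrArg Matrix.det ?_
    ext j i
    exact congrFun (hθ.familyCoord_map Submodule.topEquiv (secVal (g.θ i) x)) j
  rw [h3] at h2
  refine (congrArg₂ (fun a b => a ⊗ₜ[ℝ] b) h1 h2).trans ?_
  rw [TensorProduct.smul_tmul_smul]
  rfl

theorem contMDiffAt_det [FiniteDimensional ℝ F] (hf : x ∈ f.U) : ContMDiffAt I 𝓘(ℝ, ℝ) ∞ (f.det g) x :=
  (f.frame_e.contMDiffAt_frameDet f.isOpen g.e hf).mul
    (f.frame_θ.contMDiffAt_frameDet f.isOpen g.θ hf)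

end CanonicalFrame

/-! ### The connection form of the canonical line bundle -/

variable {r : ℕ} (f g : CanonicalFrame I F A r) {x : M}

/-- The connection form of the canonical line bundle in a local frame. -/
def IsLieAlgebroid.connForm (hP : IsLieAlgebroid P) (f : CanonicalFrame I F A r)
    (s : smoothSections I F A) (x : M) : ℝ :=
  derivationTrace f.e (P.bracket s) x
    + derivationTrace f.θ (lieDerivSection (P.anchorField s) (hP.smoothVFAt s)) x

/-- A derivation extended to the top exterior power multiplies the generator of a frame by its
trace; the two factors of the tensor product contribute the sum of two traces. -/
theorem IsLieAlgebroid.nablaFrame_eq (hP : IsLieAlgebroid P) (s : smoothSections I F A)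
    (hx : x ∈ f.U) :
    P.nablaFrame s f.e (fun i => (f.θ i).1) x = hP.connForm f s x • f.elt x := by
  have h1 : (∑ i, exteriorPower.ιMulti ℝ r
      (Function.update (fun k => secVal (f.e k) x) i (secVal (P.bracket s (f.e i)) x)))
      = derivationTrace f.e (P.bracket s) x
        • exteriorPower.ιMulti ℝ r (fun i => secVal (f.e i) x) := by
    rw [derivationTrace, familyTrace, Finset.sum_smul]
    exact Finset.sum_congr rfl fun i _ => (f.frame_e.isBasisFamily hx).map_update _ i _
  have hθ := f.frame_θ.isBasisFamily hx
  have h2 : (∑ i, exteriorPower.ιMulti ℝ (Module.finrank ℝ E)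
      (Function.update (fun k => (f.θ k).1 x) i
        (lieDerivForm I (P.anchorField s) (f.θ i).1 x)))
      = derivationTrace f.θ (lieDerivSection (P.anchorField s) (hP.smoothVFAt s)) x
        • exteriorPower.ιMulti ℝ (Module.finrank ℝ E) (fun i => (f.θ i).1 x) := by
    rw [derivationTrace, familyTrace, Finset.sum_smul]
    refine Finset.sum_congr rfl fun i _ => ?_
    refine ((hθ.map Submodule.topEquiv).map_update _ i _).trans ?_
    congr 1
    exact congrFun (hθ.familyCoord_map Submodule.topEquiv
      (secVal (lieDerivSection (P.anchorField s) (hP.smoothVFAt s) (f.θ i)) x)) i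
  rw [connForm, add_smul]
  refine congrArg₂ (· + ·) ((congrArg (fun u => u ⊗ₜ[ℝ] _) h1).trans ?_)
    ((congrArg (fun u => _ ⊗ₜ[ℝ] u) h2).trans ?_)
  · exact (TensorProduct.smul_tmul' _ _ _).symm
  · exact TensorProduct.tmul_smul _ _ _

theorem AlgebroidData.anchorField_add (P : AlgebroidData I F A) (s t : smoothSections I F A)
    (x : M) : P.anchorField (s + t) x = P.anchorField s x + P.anchorField t x :=
  map_add (P.anchor x) (secVal s x) (secVal t x)

theorem AlgebroidData.anchorField_smul (P : AlgebroidData I F A) (c : ℝ)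
    (s : smoothSections I F A) (x : M) : P.anchorField (c • s) x = c • P.anchorField s x :=
  map_smul (P.anchor x) c (secVal s x)

theorem IsLieAlgebroid.connForm_add (hP : IsLieAlgebroid P) (s t : smoothSections I F A) :
    hP.connForm f (s + t) x = hP.connForm f s x + hP.connForm f t x := by
  have h1 : derivationTrace f.e (P.bracket (s + t)) x
      = derivationTrace f.e (P.bracket s) x + derivationTrace f.e (P.bracket t) x := by
    simp only [derivationTrace, hP.add_bracket, secVal_add]
    exact familyTrace_add _ _ _
  have h2 : ∀ i, secVal (lieDerivSection _ (hP.smoothVFAt (s + t)) (f.θ i)) x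
      = secVal (lieDerivSection _ (hP.smoothVFAt s) (f.θ i)) x
        + secVal (lieDerivSection _ (hP.smoothVFAt t) (f.θ i)) x := fun i => by
    refine Subtype.ext (Eq.trans ?_ (lieDerivForm_add_left (hP.smoothVFAt s x)
      (hP.smoothVFAt t x) ((f.θ i).2.1 x)))
    exact congrArg (fun X => lieDerivForm I X (f.θ i).1 x) (funext (P.anchorField_add s t))
  have h3 : derivationTrace f.θ (lieDerivSection _ (hP.smoothVFAt (s + t))) x
      = derivationTrace f.θ (lieDerivSection _ (hP.smoothVFAt s)) x
        + derivationTrace f.θ (lieDerivSection _ (hP.smoothVFAt t)) x := by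
    simp only [derivationTrace, h2]
    exact familyTrace_add _ _ _
  rw [connForm, h1, h3, connForm, connForm]
  ring

theorem IsLieAlgebroid.connForm_smul (hP : IsLieAlgebroid P) (c : ℝ) (s : smoothSections I F A) :
    hP.connForm f (c • s) x = c * hP.connForm f s x := by
  have h1 : derivationTrace f.e (P.bracket (c • s)) x
      = c * derivationTrace f.e (P.bracket s) x := by
    simp only [derivationTrace, hP.smul_bracket, secVal_smul]
    exact familyTrace_smul _ _ _
  have h2 : ∀ i, secVal (lieDerivSection _ (hP.smoothVFAt (c • s)) (f.θ i)) x
      = c • secVal (lieDerivSection _ (hP.smoothVFAt s) (f.θ i)) x := fun i => by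
    refine Subtype.ext (Eq.trans ?_ ((lieDerivForm_smul_left (hP.smoothVFAt s x)
      (contMDiffAt_const (c := c)) ((f.θ i).2.1 x)).trans ?_))
    · exact congrArg (fun X => lieDerivForm I X (f.θ i).1 x) (funext (P.anchorField_smul c s))
    · rw [mvfderiv_const, smul_zero, add_zero]
      rfl
  have h3 : derivationTrace f.θ (lieDerivSection _ (hP.smoothVFAt (c • s))) x
      = c * derivationTrace f.θ (lieDerivSection _ (hP.smoothVFAt s)) x := by
    simp only [derivationTrace, h2]
    exact familyTrace_smul _ _ _
  rw [connForm, h1, h3, connForm]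
  ring

variable [T2Space M] [FiniteDimensional ℝ F]

theorem IsLieAlgebroid.contMDiffAt_connForm (hP : IsLieAlgebroid P) (s : smoothSections I F A)
    (hx : x ∈ f.U) : ContMDiffAt I 𝓘(ℝ, ℝ) ∞ (hP.connForm f s) x :=
  (f.frame_e.contMDiffAt_derivationTrace f.isOpen _ hx).add
    (f.frame_θ.contMDiffAt_derivationTrace f.isOpen _ hx)

/-- The two trace formulas, for `A` and for `T*M`, combine by the product rule into the logarithmic
derivative of the product of the two determinants. -/
theorem IsLieAlgebroid.connForm_change (hP : IsLieAlgebroid P) (s : smoothSections I F A)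
    (hf : x ∈ f.U) (hg : x ∈ g.U) :
    f.det g x * hP.connForm g s x = f.det g x * hP.connForm f s x + P.act s (f.det g) x := by
  have h1 := (hP.isSectionDerivation_bracket s).trace_change f.isOpen f.frame_e hf
    (g.frame_e.isBasisFamily hg)
  have h2 := (isSectionDerivation_lieDerivSection _ (hP.smoothVFAt s)).trace_change f.isOpen
    f.frame_θ hf (g.frame_θ.isBasisFamily hg)
  have h3 : P.act s (f.det g) x = _ :=
    mvfderiv_mul_of_smooth (f.frame_e.contMDiffAt_frameDet f.isOpen g.e hf)
      (f.frame_θ.contMDiffAt_frameDet f.isOpen g.θ hf) (P.anchorField s x)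
  rw [h3]
  simp only [CanonicalFrame.det, connForm]
  linear_combination (frameDet f.θ g.θ x) * h1 + (frameDet f.e g.e x) * h2

/-- Tensoriality in `s`. Write `s = ∑ c_j e_j` with `c_j(x) = 0`. At `x` the operator `[s, ·]` on
`A` has trace `-∑ ρ(e_j)(c_j)`, while the Lie derivative along `ρ(s)` on `T*M` has trace `+∑
ρ(e_j)(c_j)`. Neither trace is tensorial alone; the factor `⋀^top T*M` is what cancels the first. -/
theorem IsLieAlgebroid.connForm_eq_zero (hP : IsLieAlgebroid P) {s : smoothSections I F A}
    (hx : x ∈ f.U) (hs : secVal s x = 0) : hP.connForm f s x = 0 := by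
  let c : Fin r → M → ℝ := fun j y =>
    familyCoord (fun i => secVal (f.e i) y) (secVal s y) j
  have hc : ∀ j y, y ∈ f.U → ContMDiffAt I 𝓘(ℝ, ℝ) ∞ (c j) y := fun j y hy =>
    f.frame_e.contMDiffAt_coord f.isOpen s hy j
  have es : ∀ y ∈ f.U, secVal s y = ∑ j, c j y • secVal (f.e j) y := fun y hy =>
    ((f.frame_e.isBasisFamily hy).sum_familyCoord _).symm
  have hc0 : ∀ j, c j x = 0 := fun j => by
    show familyCoord _ (secVal s x) j = 0
    rw [hs, map_zero]
    rfl
  have hbr : ∀ i, secVal (P.bracket s (f.e i)) x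
      = ∑ j, -P.act (f.e i) (c j) x • secVal (f.e j) x := fun i => by
    have h1 := (hP.isSectionDerivation_bracket (f.e i)).expand (t := s)
      (fun j => (f.isOpen.eventually_mem hx).mono fun y hy => hc j y hy)
      ((f.isOpen.eventually_mem hx).mono fun y hy => es y hy)
    simp only [hc0, zero_smul, Finset.sum_const_zero, zero_add] at h1
    rw [hP.skew]
    show -secVal (P.bracket (f.e i) s) x = _
    rw [h1]
    simp only [neg_smul, Finset.sum_neg_distrib]
    rfl
  have hE : derivationTrace f.e (P.bracket s) x = ∑ i, -P.act (f.e i) (c i) x := by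
    simp only [derivationTrace, hbr]
    exact (f.frame_e.isBasisFamily hx).familyTrace_sum fun j i => -P.act (f.e i) (c j) x
  have hX : ∀ᶠ y in 𝓝 x, P.anchorField s y = ∑ j, c j y • P.anchorField (f.e j) y :=
    (f.isOpen.eventually_mem hx).mono fun y hy => by
      simp only [AlgebroidData.anchorField]
      rw [es y hy, map_sum]
      simp only [map_smul]
  have hθ := f.frame_θ.isBasisFamily hx
  have hlie : ∀ i, lieDerivForm I (P.anchorField s) (f.θ i).1 x
      = ∑ j, (f.θ i).1 x (P.anchorField (f.e j) x) • mvfderiv I (c j) x := fun i => by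
    -- The induction carries smoothness along with the formula, because additivity of the Lie
    -- derivative in the vector field needs it for the partial sum.
    have hsm : ∀ S : Finset (Fin r), SmoothVFAt I (fun y => ∑ j ∈ S, c j y • P.anchorField (f.e j) y) x
        ∧ lieDerivForm I (fun y => ∑ j ∈ S, c j y • P.anchorField (f.e j) y) (f.θ i).1 x
          = ∑ j ∈ S, (f.θ i).1 x (P.anchorField (f.e j) x) • mvfderiv I (c j) x := by
      intro S
      have hz := lieDerivForm_smul_left (hP.smoothVFAt 0 x)
        (contMDiffAt_const (c := (0 : ℝ))) ((f.θ i).2.1 x)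
      induction S using Finset.induction_on with
      | empty =>
        simp only [Finset.sum_empty]
        refine ⟨contMDiff_zeroSection ℝ (TangentSpace I : M → Type _) x, ?_⟩
        simp only [zero_smul, mvfderiv_const, smul_zero, add_zero] at hz
        exact hz
      | insert a S ha ih =>
        simp only [Finset.sum_insert ha]
        have h1 := hP.smoothVFAt (f.e a) x
        refine ⟨(h1.smul (hc a x hx)).add ih.1, ?_⟩
        rw [lieDerivForm_add_left (h1.smul (hc a x hx)) ih.1 ((f.θ i).2.1 x), ih.2,
          lieDerivForm_smul_left h1 (hc a x hx) ((f.θ i).2.1 x), hc0, zero_smul, zero_add]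
    rw [← (hsm Finset.univ).2]
    exact lieDerivForm_congr (hsm Finset.univ).1 ((f.θ i).2.1 x) hX
      (Eventually.of_forall fun _ => rfl)
  have hT : derivationTrace f.θ (lieDerivSection _ (hP.smoothVFAt s)) x
      = ∑ j, P.act (f.e j) (c j) x := by
    have h1 : ∀ i, secVal (lieDerivSection _ (hP.smoothVFAt s) (f.θ i)) x
        = ∑ j, (f.θ i).1 x (P.anchorField (f.e j) x) •
          (⟨mvfderiv I (c j) x, Submodule.mem_top⟩ : cotanTop I x) := fun i => by
      refine Subtype.ext ((hlie i).trans ?_)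
      rw [AddSubmonoidClass.coe_finsetSum]
      rfl
    simp only [derivationTrace, familyTrace, h1, map_sum, map_smul, Finset.sum_apply,
      Pi.smul_apply, smul_eq_mul]
    rw [Finset.sum_comm]
    refine Finset.sum_congr rfl fun j _ => ?_
    have h2 := congrArg Subtype.val
      (hθ.sum_familyCoord (⟨mvfderiv I (c j) x, Submodule.mem_top⟩ : cotanTop I x))
    rw [AddSubmonoidClass.coe_finsetSum] at h2
    have h3 := congrArg (fun T : Cotan I x => T (P.anchorField (f.e j) x)) h2
    refine Eq.trans ?_ h3
    refine Eq.trans ?_ (sum_apply _ _ _).symm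
    exact Finset.sum_congr rfl fun i _ => mul_comm _ _
  rw [connForm, hE, hT, Finset.sum_neg_distrib]
  ring

/-- Flatness. By the Jacobi identity on `A`, and because the anchor preserves brackets on `T*M`,
both operators attached to `[s, t]` are commutators, so `trace_commutator` applies to each factor.
-/
theorem IsLieAlgebroid.connForm_bracket (hP : IsLieAlgebroid P) (s t : smoothSections I F A)
    (hx : x ∈ f.U) :
    hP.connForm f (P.bracket s t) x
      = P.act s (hP.connForm f t) x - P.act t (hP.connForm f s) x := by
  have h1 := (hP.isSectionDerivation_bracket s).trace_commutator
    (hP.isSectionDerivation_bracket t) (D'' := P.bracket (P.bracket s t)) (fun u => by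
      have := hP.jacobi s t u
      rw [hP.skew u (P.bracket s t), hP.skew u s,
        (hP.isSectionDerivation_bracket t).map_neg] at this
      rw [← sub_eq_zero]
      rw [← neg_eq_zero, ← this]
      abel) f.isOpen f.frame_e hx
  have h2 := (isSectionDerivation_lieDerivSection _ (hP.smoothVFAt s)).trace_commutator
    (isSectionDerivation_lieDerivSection _ (hP.smoothVFAt t))
    (D'' := lieDerivSection _ (hP.smoothVFAt (P.bracket s t))) (fun β => by
      refine Subtype.ext (funext fun y => ?_)
      refine Eq.trans ?_ (lieDerivForm_mlieBracket (Eventually.of_forall (hP.smoothVFAt s))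
        (Eventually.of_forall (hP.smoothVFAt t)) (Eventually.of_forall β.2.1))
      exact congrArg (fun X => lieDerivForm I X β.1 y) (funext (hP.anchor_bracket s t)))
    f.isOpen f.frame_θ hx
  have h3 : ∀ u v : smoothSections I F A, P.act v (hP.connForm f u) x
      = mvfderiv I (derivationTrace f.e (P.bracket u)) x (P.anchorField v x)
        + mvfderiv I (derivationTrace f.θ (lieDerivSection _ (hP.smoothVFAt u))) x
          (P.anchorField v x) := fun u v => by
    have := mvfderiv_add_of_smooth
      (f.frame_e.contMDiffAt_derivationTrace f.isOpen (P.bracket u) hx)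
      (f.frame_θ.contMDiffAt_derivationTrace f.isOpen
        (lieDerivSection _ (hP.smoothVFAt u)) hx)
    exact congrArg (fun T : Cotan I x => T (P.anchorField v x)) this
  rw [h3, h3, connForm, h1, h2]
  ring

end CanonicalFrames

/-! ### Existence and uniqueness of the modular class. -/

section ModularClass

variable {E : Type*} [NormedAddCommGroup E] [NormedSpace ℝ E] [FiniteDimensional ℝ E]
  {H : Type*} [TopologicalSpace H] {I : ModelWithCorners ℝ E H} [I.Boundaryless]
  {M : Type*} [TopologicalSpace M] [ChartedSpace H M] [IsManifold I ∞ M]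
  {F : Type*} [NormedAddCommGroup F] [NormedSpace ℝ F] [FiniteDimensional ℝ F] {V : M → Type*}
  [∀ x, AddCommGroup (V x)] [∀ x, Module ℝ (V x)] [∀ x, TopologicalSpace (V x)]
  [TopologicalSpace (TotalSpace F V)] [FiberBundle F V] [VectorBundle ℝ F V]
  {A : ∀ x : M, Submodule ℝ (V x)} {P : AlgebroidData I F A} {r : ℕ}

/-! ### A positive section of the square of the canonical line bundle -/

theorem contMDiffAt_log {f : M → ℝ} {x : M} (hf : ContMDiffAt I 𝓘(ℝ, ℝ) ∞ f x) (h : f x ≠ 0) :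
    ContMDiffAt I 𝓘(ℝ, ℝ) ∞ (fun y => Real.log (f y)) x :=
  (Real.contDiffAt_log.2 h).contMDiffAt.comp x hf

theorem contMDiffAt_exp {f : M → ℝ} {x : M} (hf : ContMDiffAt I 𝓘(ℝ, ℝ) ∞ f x) :
    ContMDiffAt I 𝓘(ℝ, ℝ) ∞ (fun y => Real.exp (f y)) x :=
  Real.contDiff_exp.contDiffAt.contMDiffAt.comp x hf

/-- `Real.log` is the logarithm of the absolute value, so no sign condition on `f` is needed. This
is what allows determinants of either sign below. -/
theorem mvfderiv_log_mul {f : M → ℝ} {x : M} (hf : ContMDiffAt I 𝓘(ℝ, ℝ) ∞ f x) (h : f x ≠ 0)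
    (v : TangentSpace I x) :
    f x * mvfderiv I (fun y => Real.log (f y)) x v = mvfderiv I f x v := by
  have h1 : ∀ w : ℝ, mvfderiv 𝓘(ℝ, ℝ) Real.log (f x) w = w * (f x)⁻¹ := fun w => by
    show mfderiv 𝓘(ℝ, ℝ) 𝓘(ℝ, ℝ) Real.log (f x) w = _
    rw [mfderiv_eq_fderiv, (Real.hasDerivAt_log h).hasFDerivAt.fderiv]
    rfl
  rw [mvfderiv_comp_smooth (J := 𝓘(ℝ, ℝ)) (f := Real.log) (ψ := f)
    (Real.contDiffAt_log.2 h).contMDiffAt hf]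
  refine (congrArg (f x * ·) (h1 (mvfderiv I f x v))).trans ?_
  field_simp

theorem mvfderiv_exp {f : M → ℝ} {x : M} (hf : ContMDiffAt I 𝓘(ℝ, ℝ) ∞ f x)
    (v : TangentSpace I x) :
    mvfderiv I (fun y => Real.exp (f y)) x v = Real.exp (f x) * mvfderiv I f x v := by
  have h1 := mvfderiv_log_mul (contMDiffAt_exp hf) (Real.exp_ne_zero _) v
  simp only [Real.log_exp] at h1
  exact h1.symm

variable (ρ : SmoothPartitionOfUnity (CanonicalFrame I F A r) I M)

/-- The logarithm of the density, in a local frame, of a section of the canonical line bundle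
(up to sign) glued from the local frames. -/
def logDensity (f : CanonicalFrame I F A r) (x : M) : ℝ :=
  ∑ᶠ g, ρ g x • Real.log (f.det g x)

variable {ρ} (f g : CanonicalFrame I F A r) {x : M}

theorem SmoothPartitionOfUnity.IsSubordinate.mem_of_ne_zero {ι : Type*} {S : Set M} {U : ι → Set M}
    {ρ : SmoothPartitionOfUnity ι I M S} (hρ : ρ.IsSubordinate U) {i : ι} {x : M} (h : ρ i x ≠ 0) :
    x ∈ U i := hρ i (subset_tsupport _ h)

theorem contMDiffAt_logDensity (hρ : ρ.IsSubordinate fun f => f.U) (hx : x ∈ f.U) :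
    ContMDiffAt I 𝓘(ℝ, ℝ) ∞ (logDensity ρ f) x :=
  ρ.contMDiffAt_finsum fun g hg =>
    contMDiffAt_log (f.contMDiffAt_det g hx) (f.det_ne_zero g hx (hρ g hg))

/-- Determinants of frame changes multiply, so their logarithms add; the common summand `log |f.det
g|` comes out of the average because the weights sum to one. -/
theorem logDensity_change (hρ : ρ.IsSubordinate fun f => f.U) (hf : x ∈ f.U) (hg : x ∈ g.U) :
    logDensity ρ f x = logDensity ρ g x + Real.log (f.det g x) := by
  have h1 : ∀ h, ρ h x • Real.log (f.det h x)
      = ρ h x • Real.log (g.det h x) + ρ h x • Real.log (f.det g x) := fun h => by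
    -- Outside the domain of the frame `h` the determinants carry no information, but there the
    -- weight is zero by subordination.
    by_cases h0 : ρ h x = 0
    · simp [h0]
    · rw [f.det_trans g h hf hg, Real.log_mul
        (g.det_ne_zero h hg (hρ.mem_of_ne_zero h0)) (f.det_ne_zero g hf hg), smul_add]
  have hfin : ∀ c : CanonicalFrame I F A r → ℝ,
      (Function.support fun h => ρ h x • c h).Finite := fun c =>
    (ρ.locallyFinite.point_finite x).subset fun h hh h0 => hh (by
      show ρ h x • c h = 0
      rw [h0, zero_smul])
  rw [logDensity, finsum_congr h1, finsum_add_distrib (hfin _) (hfin _), ← finsum_smul,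
    ρ.sum_eq_one (Set.mem_univ x), one_smul]
  rfl

/-- The value in a local frame of the connection form of the glued section. -/
def IsLieAlgebroid.gluedForm (hP : IsLieAlgebroid P)
    (ρ : SmoothPartitionOfUnity (CanonicalFrame I F A r) I M) (f : CanonicalFrame I F A r)
    (s : smoothSections I F A) (x : M) : ℝ :=
  hP.connForm f s x + P.act s (logDensity ρ f) x

variable [T2Space M]

/-- The change of the connection form and the change of the logarithmic density are the same
logarithmic derivative with opposite signs. -/
theorem IsLieAlgebroid.gluedForm_change (hP : IsLieAlgebroid P)
    (hρ : ρ.IsSubordinate fun f => f.U) (s : smoothSections I F A) (hf : x ∈ f.U) (hg : x ∈ g.U) :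
    hP.gluedForm ρ f s x = hP.gluedForm ρ g s x := by
  have h0 := f.det_ne_zero g hf hg
  have h1 := hP.connForm_change f g s hf hg
  have h2 : P.act s (logDensity ρ f) x
      = P.act s (logDensity ρ g) x + P.act s (fun y => Real.log (f.det g y)) x := by
    have e : ∀ᶠ y in 𝓝 x, logDensity ρ f y = logDensity ρ g y + Real.log (f.det g y) := by
      filter_upwards [f.isOpen.mem_nhds hf, g.isOpen.mem_nhds hg] with y h1 h2
      exact logDensity_change f g hρ h1 h2
    have e2 := (mvfderiv_congr (I := I) e).trans (mvfderiv_add_of_smooth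
      (contMDiffAt_logDensity g hρ hg) (contMDiffAt_log (f.contMDiffAt_det g hf) h0))
    exact congrArg (fun T : Cotan I x => T (P.anchorField s x)) e2
  have h3 : f.det g x * P.act s (fun y => Real.log (f.det g y)) x = P.act s (f.det g) x :=
    mvfderiv_log_mul (f.contMDiffAt_det g hf) h0 (P.anchorField s x)
  refine mul_left_cancel₀ h0 ?_
  rw [gluedForm, gluedForm, h2]
  linear_combination -h1 + h3

/-- The glued connection form depends on the value of the section only. -/
theorem IsLieAlgebroid.exists_gluedForm_eq (hP : IsLieAlgebroid P) (hx : x ∈ f.U) :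
    ∃ α : A x →ₗ[ℝ] ℝ, ∀ s, α (secVal s x) = hP.gluedForm ρ f s x := by
  let k : smoothSections I F A →ₗ[ℝ] ℝ :=
    { toFun := fun s => hP.gluedForm ρ f s x
      map_add' := fun s t => by
        rw [gluedForm, gluedForm, gluedForm, connForm_add f hP s t]
        simp only [AlgebroidData.act, P.anchorField_add, map_add]
        ring
      map_smul' := fun c s => by
        rw [gluedForm, gluedForm, connForm_smul f hP c s]
        simp only [AlgebroidData.act, P.anchorField_smul, map_smul, smul_eq_mul, RingHom.id_apply]
        ring }
  let ev : smoothSections I F A →ₗ[ℝ] A x :=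
    { toFun := fun s => secVal s x
      map_add' := fun _ _ => rfl
      map_smul' := fun _ _ => rfl }
  -- A linear choice of sections through the vectors of the fiber. The form defined with it has the
  -- right value on every section, since `gluedForm` vanishes on sections that are zero at `x`.
  obtain ⟨R, hR⟩ := ev.exists_rightInverse_of_surjective
    (LinearMap.range_eq_top.2 fun a => hP.subbundle.exists_section_eq a)
  refine ⟨k.comp R, fun s => ?_⟩
  have h0 : secVal (R (secVal s x) - s) x = 0 := by
    rw [secVal_sub, sub_eq_zero]
    exact congrArg (fun T => T (secVal s x)) hR
  have h1 : k (R (secVal s x) - s) = 0 := by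
    show hP.gluedForm ρ f _ x = 0
    rw [gluedForm, hP.connForm_eq_zero f hx h0, AlgebroidData.act, AlgebroidData.anchorField, h0,
      map_zero, map_zero, zero_add]
  rw [map_sub, sub_eq_zero] at h1
  exact h1

/-- In a fixed frame near `x` the form is the connection form plus `d_A` of the logarithmic density:
the first is closed by flatness, the second because the anchor preserves brackets. -/
theorem IsLieAlgebroid.mem_closedForms_of_eq_gluedForm (hP : IsLieAlgebroid P)
    (hρ : ρ.IsSubordinate fun f => f.U) (hcov : ∀ x, ∃ f : CanonicalFrame I F A r, x ∈ f.U)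
    {α : ∀ x, A x →ₗ[ℝ] ℝ} (hα : ∀ (g : CanonicalFrame I F A r) (x : M) (s : smoothSections I F A),
      x ∈ g.U → α x (secVal s x) = hP.gluedForm ρ g s x) : α ∈ P.closedForms := by
  choose f hf using hcov
  have hu : ∀ x, ContMDiffAt I 𝓘(ℝ, ℝ) ∞ (logDensity ρ (f x)) x := fun x =>
    contMDiffAt_logDensity (f x) hρ (hf x)
  have hαf : ∀ (x : M) (s : smoothSections I F A),
      ∀ᶠ y in 𝓝 x, α y (secVal s y) = hP.gluedForm ρ (f x) s y := fun x s =>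
    ((f x).isOpen.eventually_mem (hf x)).mono fun y hy => hα (f x) y s hy
  refine ⟨fun s x => ((hP.contMDiffAt_connForm (f x) s (hf x)).add
    (contMDiffAt_mvfderiv_apply (hP.smoothVFAt s x) (hu x))).congr_of_eventuallyEq (hαf x s), ?_⟩
  intro s t x
  have h1 : ∀ u v : smoothSections I F A, P.act v (fun y => α y (secVal u y)) x
      = P.act v (hP.connForm (f x) u) x + P.act v (P.act u (logDensity ρ (f x))) x := fun u v => by
    have e := (mvfderiv_congr (I := I) (hαf x u)).trans
      (mvfderiv_add_of_smooth (hP.contMDiffAt_connForm (f x) u (hf x))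
        (contMDiffAt_mvfderiv_apply (hP.smoothVFAt u x) (hu x)))
    exact congrArg (fun T : Cotan I x => T (P.anchorField v x)) e
  have h2 : P.act (P.bracket s t) (logDensity ρ (f x)) x
      = P.act s (P.act t (logDensity ρ (f x))) x - P.act t (P.act s (logDensity ρ (f x))) x := by
    rw [AlgebroidData.act, hP.anchor_bracket]
    exact mvfderiv_mlieBracket (hP.smoothVFAt s x) (hP.smoothVFAt t x) (hu x)
  rw [AlgebroidData.dOne, h1, h1, hα (f x) x _ (hf x), gluedForm,
    hP.connForm_bracket (f x) s t (hf x), h2]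
  ring

variable (ρ) in
/-- The glued section of the square of the canonical line bundle, in a local frame. -/
def gluedSection (f : CanonicalFrame I F A r) (x : M) : CanLine I A r x ⊗[ℝ] CanLine I A r x :=
  Real.exp (2 * logDensity ρ f x) • (f.elt x ⊗ₜ[ℝ] f.elt x)

theorem gluedSection_ne_zero (hf : x ∈ f.U) : gluedSection ρ f x ≠ 0 :=
  smul_ne_zero (Real.exp_ne_zero _)
    (tmul_ne_zero_of_ne_zero (f.elt_ne_zero hf) (f.elt_ne_zero hf))

/-- The density sees only the absolute value of the determinant, whereas the frame element sees its
sign. The sign disappears in the square, which is why the section lives in `L_A ⊗ L_A`. -/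
theorem gluedSection_change (hρ : ρ.IsSubordinate fun f => f.U) (hf : x ∈ f.U) (hg : x ∈ g.U) :
    gluedSection ρ f x = gluedSection ρ g x := by
  have h0 := f.det_ne_zero g hf hg
  rw [gluedSection, gluedSection, f.elt_eq g hf, logDensity_change f g hρ hf hg,
    TensorProduct.smul_tmul_smul, smul_smul]
  congr 1
  rw [mul_add, Real.exp_add, two_mul (Real.log _), Real.exp_add, Real.exp_log_eq_abs h0,
    abs_mul_abs_self]

/-- Differentiating the exponential gives twice the derivative of the density, and each of the two
tensor factors contributes the connection form once. -/
theorem IsLieAlgebroid.nabla_gluedSection (hP : IsLieAlgebroid P)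
    (hρ : ρ.IsSubordinate fun f => f.U) (s : smoothSections I F A) (hf : x ∈ f.U) :
    P.act s (fun y => Real.exp (2 * logDensity ρ f y)) x • (f.elt x ⊗ₜ[ℝ] f.elt x)
      + Real.exp (2 * logDensity ρ f x) •
        (P.nablaFrame s f.e (fun i => (f.θ i).1) x ⊗ₜ[ℝ] f.elt x
          + f.elt x ⊗ₜ[ℝ] P.nablaFrame s f.e (fun i => (f.θ i).1) x)
      = (2 * hP.gluedForm ρ f s x) • gluedSection ρ f x := by
  have hu := contMDiffAt_logDensity f hρ hf
  have h1 : P.act s (fun y => Real.exp (2 * logDensity ρ f y)) x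
      = Real.exp (2 * logDensity ρ f x) * (2 * P.act s (logDensity ρ f) x) := by
    refine (mvfderiv_exp (contMDiffAt_const.mul hu) _).trans ?_
    congr 1
    have e := mvfderiv_mul_of_smooth (f := fun _ : M => (2 : ℝ)) contMDiffAt_const hu
      (P.anchorField s x)
    rw [mvfderiv_const] at e
    refine e.trans ?_
    rw [zero_apply, zero_mul, zero_add]
    rfl
  rw [h1, hP.nablaFrame_eq f s hf, gluedSection, gluedForm, ← TensorProduct.smul_tmul',
    TensorProduct.tmul_smul, ← add_smul, smul_smul, ← add_smul, smul_smul]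
  congr 1
  ring

/-- A modular cocycle exists. -/
theorem IsLieAlgebroid.exists_isModularCocycle [SigmaCompactSpace M] (hP : IsLieAlgebroid P)
    (hr : ∀ x, Module.finrank ℝ (A x) = r) : ∃ α : P.closedForms, P.IsModularCocycle r α := by
  have hcov : ∀ x, ∃ f : CanonicalFrame I F A r, x ∈ f.U :=
    CanonicalFrame.exists_mem hP.subbundle hr
  obtain ⟨ρ, hρ⟩ := SmoothPartitionOfUnity.exists_isSubordinate I isClosed_univ
    (fun f : CanonicalFrame I F A r => f.U) (fun f => f.isOpen)
    fun x _ => Set.mem_iUnion.2 (hcov x)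
  have hcov' := hcov
  choose f hf using hcov'
  -- The form and the section are defined at each point by a frame chosen for that point;
  -- `gluedForm_change` and `gluedSection_change` make them agree with every other frame.
  choose α hα' using fun x => hP.exists_gluedForm_eq (ρ := ρ) (f x) (hf x)
  have hα : ∀ (g : CanonicalFrame I F A r) (x : M) (s : smoothSections I F A), x ∈ g.U →
      α x (secVal s x) = hP.gluedForm ρ g s x := fun g x s hx => by
    rw [hα', hP.gluedForm_change (f x) g hρ s (hf x) hx]
  refine ⟨⟨α, hP.mem_closedForms_of_eq_gluedForm hρ hcov hα⟩, fun x => gluedSection ρ (f x) x,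
    fun x => gluedSection_ne_zero (f x) (hf x), ?_⟩
  intro U e θ hU hfr
  -- The frame pair of the definition is itself one of the canonical frames, so the comparison of
  -- frames covers it.
  let g : CanonicalFrame I F A r := CanonicalFrame.ofFramePair hU hfr
  refine ⟨fun x => Real.exp (2 * logDensity ρ g x), fun x hx =>
    (contMDiffAt_exp (contMDiffAt_const.mul (contMDiffAt_logDensity g hρ hx))).contMDiffWithinAt,
    fun x hx => ?_⟩
  have hσ := gluedSection_change (f x) g hρ (hf x) hx
  refine ⟨hσ, fun s => ?_⟩
  have h1 : (2 * α x (secVal s x)) • gluedSection ρ (f x) x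
      = (2 * hP.gluedForm ρ g s x) • gluedSection ρ g x := by rw [hσ, hα g x s hx]
  exact (hP.nabla_gluedSection g hρ s hx).trans h1.symm

/-- The modular cocycle, in a local frame. -/
theorem IsLieAlgebroid.two_mul_modularCocycle (hP : IsLieAlgebroid P) {a c h : ℝ}
    {σ : CanLine I A r x ⊗[ℝ] CanLine I A r x} {s : smoothSections I F A} (hx : x ∈ f.U)
    (hσ : σ = h • (f.elt x ⊗ₜ[ℝ] f.elt x))
    (hs : c • (f.elt x ⊗ₜ[ℝ] f.elt x) + h • (P.nablaFrame s f.e (fun i => (f.θ i).1) x ⊗ₜ[ℝ] f.elt x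
      + f.elt x ⊗ₜ[ℝ] P.nablaFrame s f.e (fun i => (f.θ i).1) x) = (2 * a) • σ) :
    c + 2 * h * hP.connForm f s x = 2 * a * h := by
  have ht : f.elt x ⊗ₜ[ℝ] f.elt x ≠ 0 :=
    tmul_ne_zero_of_ne_zero (f.elt_ne_zero hx) (f.elt_ne_zero hx)
  rw [hσ, hP.nablaFrame_eq f s hx, ← TensorProduct.smul_tmul', TensorProduct.tmul_smul,
    ← add_smul, smul_smul, ← add_smul, smul_smul] at hs
  have := smul_left_injective ℝ ht hs
  linear_combination this

/-- Two modular cocycles are cohomologous. -/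
theorem IsLieAlgebroid.classOf_eq_of_isModularCocycle (hP : IsLieAlgebroid P)
    (hr : ∀ x, Module.finrank ℝ (A x) = r) {α β : P.closedForms} (hα : P.IsModularCocycle r α)
    (hβ : P.IsModularCocycle r β) : P.classOf α = P.classOf β := by
  obtain ⟨σ, hσ0, hσ⟩ := hα
  obtain ⟨τ, hτ0, hτ⟩ := hβ
  -- In a local frame both sections are multiples of the same element. Their ratio `q` is smooth and
  -- nonzero, and subtracting the two cocycle equations shows that `2 (α - β)` is its logarithmic
  -- derivative.
  have hloc : ∀ x, ∃ q : M → ℝ, (∀ᶠ y in 𝓝 x, σ y = q y • τ y) ∧ q x ≠ 0 ∧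
      ContMDiffAt I 𝓘(ℝ, ℝ) ∞ q x ∧
      ∀ s, 2 * q x * (α.1 x (secVal s x) - β.1 x (secVal s x)) = P.act s q x := by
    intro x
    obtain ⟨f, hx⟩ := CanonicalFrame.exists_mem hP.subbundle hr x
    obtain ⟨h, hh, h1⟩ := hσ f.U f.e _ f.isOpen f.isFramePair
    obtain ⟨k, hk, k1⟩ := hτ f.U f.e _ f.isOpen f.isFramePair
    have hh0 : ∀ y ∈ f.U, h y ≠ 0 := fun y hy h0 => hσ0 y (by rw [(h1 y hy).1, h0, zero_smul])
    have hk0 : ∀ y ∈ f.U, k y ≠ 0 := fun y hy h0 => hτ0 y (by rw [(k1 y hy).1, h0, zero_smul])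
    have hhx := hh.contMDiffAt (f.isOpen.mem_nhds hx)
    have hkx := hk.contMDiffAt (f.isOpen.mem_nhds hx)
    have hq : ContMDiffAt I 𝓘(ℝ, ℝ) ∞ (fun y => h y / k y) x := hhx.div₀ hkx (hk0 x hx)
    refine ⟨fun y => h y / k y, ?_, div_ne_zero (hh0 x hx) (hk0 x hx), hq, fun s => ?_⟩
    · filter_upwards [f.isOpen.mem_nhds hx] with y hy
      rw [(h1 y hy).1, (k1 y hy).1, smul_smul, div_mul_cancel₀ _ (hk0 y hy)]
    have e1 := hP.two_mul_modularCocycle f hx (h1 x hx).1 ((h1 x hx).2 s)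
    have e2 := hP.two_mul_modularCocycle f hx (k1 x hx).1 ((k1 x hx).2 s)
    have e3 : P.act s h x = P.act s (fun y => h y / k y) x * k x + h x / k x * P.act s k x := by
      have e4 : ∀ᶠ y in 𝓝 x, h y = h y / k y * k y := by
        filter_upwards [f.isOpen.mem_nhds hx] with y hy
        rw [div_mul_cancel₀ _ (hk0 y hy)]
      refine (congrArg (fun T : Cotan I x => T (P.anchorField s x)) (mvfderiv_congr e4)).trans ?_
      exact mvfderiv_mul_of_smooth hq hkx _
    have hkn := hk0 x hx
    have e5 : h x = h x / k x * k x := (div_mul_cancel₀ _ hkn).symm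
    refine mul_left_cancel₀ hkn ?_
    rw [e3] at e1
    show k x * (2 * (h x / k x) * (α.1 x (secVal s x) - β.1 x (secVal s x))) = _
    generalize h x / k x = q at *
    rw [e5] at e1
    linear_combination -e1 + q * e2
  have hex : ∀ x, ∃ c : ℝ, σ x = c • τ x := fun x => by
    obtain ⟨q, hq, -⟩ := hloc x
    exact ⟨q x, hq.self_of_nhds⟩
  choose G hG using hex
  have hGq : ∀ x, ContMDiffAt I 𝓘(ℝ, ℝ) ∞ G x ∧ G x ≠ 0 ∧
      ∀ s, 2 * G x * (α.1 x (secVal s x) - β.1 x (secVal s x)) = P.act s G x := by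
    intro x
    obtain ⟨q, hq, hq0, hqs, hqa⟩ := hloc x
    -- As `τ` vanishes nowhere the ratio is unique, so the pointwise choice `G` agrees with every
    -- local ratio and inherits its smoothness.
    have e : ∀ᶠ y in 𝓝 x, G y = q y := hq.mono fun y hy =>
      smul_left_injective ℝ (hτ0 y) ((hG y).symm.trans hy)
    refine ⟨hqs.congr_of_eventuallyEq e, e.self_of_nhds ▸ hq0, fun s => ?_⟩
    rw [e.self_of_nhds, hqa s, AlgebroidData.act, AlgebroidData.act, mvfderiv_congr e]
  refine (Submodule.Quotient.eq _).2 ?_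
  -- The one half matches the factor two in `∇_s σ = 2 α(s) σ`.
  refine ⟨fun x => (1 / 2 : ℝ) * Real.log (G x), fun x =>
    contMDiffAt_const.mul (contMDiffAt_log (hGq x).1 (hGq x).2.1), fun x a => ?_⟩
  obtain ⟨s, rfl⟩ := hP.subbundle.exists_section_eq a
  have e1 := (hGq x).2.2 s
  have e2 : G x * P.act s (fun y => Real.log (G y)) x = P.act s G x :=
    mvfderiv_log_mul (hGq x).1 (hGq x).2.1 _
  have e3 := mvfderiv_mul_of_smooth (f := fun _ : M => (1 / 2 : ℝ)) contMDiffAt_const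
    (contMDiffAt_log (hGq x).1 (hGq x).2.1) (P.anchorField s x)
  rw [mvfderiv_const, zero_apply, zero_mul, zero_add] at e3
  refine Eq.trans ?_ e3.symm
  refine mul_left_cancel₀ (hGq x).2.1 ?_
  show G x * (α.1 x (secVal s x) - β.1 x (secVal s x))
    = G x * (1 / 2 * P.act s (fun y => Real.log (G y)) x)
  linear_combination (1 / 2) * e1 - (1 / 2) * e2

theorem IsLieAlgebroid.existsUnique_modularClass [SigmaCompactSpace M] (hP : IsLieAlgebroid P)
    (hr : ∀ x, Module.finrank ℝ (A x) = r) : ∃! c : P.H1, P.IsModularClass r c := by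
  obtain ⟨α, hα⟩ := hP.exists_isModularCocycle hr
  refine ⟨P.classOf α, ⟨α, hα, rfl⟩, ?_⟩
  rintro _ ⟨β, hβ, rfl⟩
  exact hP.classOf_eq_of_isModularCocycle hr hβ hα

end ModularClass

end

/-! ### The proposition. -/

theorem mainTheorem5
    {E : Type*} [NormedAddCommGroup E] [NormedSpace ℝ E] [FiniteDimensional ℝ E]
    {H : Type*} [TopologicalSpace H] {I : ModelWithCorners ℝ E H} [I.Boundaryless]
    {M : Type*} [TopologicalSpace M] [ChartedSpace H M] [IsManifold I ∞ M]
    [T2Space M] [SigmaCompactSpace M]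
    {E' : Type*} [NormedAddCommGroup E'] [NormedSpace ℝ E'] [FiniteDimensional ℝ E']
    {H' : Type*} [TopologicalSpace H'] {J : ModelWithCorners ℝ E' H'} [J.Boundaryless]
    {N : Type*} [TopologicalSpace N] [ChartedSpace H' N] [IsManifold J ∞ N]
    [T2Space N] [SigmaCompactSpace N]
    (L : DiracStructure I M) (K : DiracStructure J N) (φ : C^∞⟮I, M; J, N⟯)
    (hφ : IsAdmissibleDiracMap L K φ) :
    GammaInvolutive φ ∧
    ∃ P : AlgebroidData I (GModel E × GModel E') (diracR L K φ),
      IsLieAlgebroid P ∧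
      IsInducedOnR L K φ P ∧
      (∀ P' : AlgebroidData I (GModel E × GModel E') (diracR L K φ),
        IsInducedOnR L K φ P' → P' = P) ∧
      IsLieAlgebroidMorphism P L.algebroid id (projL L K φ) ∧
      IsLieAlgebroidMorphism P K.algebroid φ (projK L K φ) ∧
      (∃! iT : L.algebroid.H1 →ₗ[ℝ] P.H1,
        IsCohomologyPullback P L.algebroid id (projL L K φ) iT) ∧
      (∃! jT : K.algebroid.H1 →ₗ[ℝ] P.H1,
        IsCohomologyPullback P K.algebroid φ (projK L K φ) jT) ∧
      (∃! cL : L.algebroid.H1, L.algebroid.IsModularClass (Module.finrank ℝ E) cL) ∧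
      (∃! cK : K.algebroid.H1, K.algebroid.IsModularClass (Module.finrank ℝ E') cK) ∧
      (∃! c : P.H1, IsModularClassOfDiracMap L K φ P c) := by
  have hP := isLieAlgebroid_graphAlgebroid hφ.subbundle
  have hi := isLieAlgebroidMorphism_projL hφ.subbundle
  have hj := isLieAlgebroidMorphism_projK hφ.subbundle
  have hiT := hi.existsUnique_cohomologyPullback
  have hjT := hj.existsUnique_cohomologyPullback
  have hcL := L.isLieAlgebroid.existsUnique_modularClass L.finrank_fiber
  have hcK := K.isLieAlgebroid.existsUnique_modularClass K.finrank_fiber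
  refine ⟨gammaInvolutive φ, graphAlgebroid L K φ, hP, isInducedOnR_graphAlgebroid,
    fun P' hP' => eq_graphAlgebroid hP', hi, hj, hiT, hjT, hcL, hcK, ?_⟩
  obtain ⟨iT, hiT, hiT'⟩ := hiT
  obtain ⟨jT, hjT, hjT'⟩ := hjT
  obtain ⟨cL, hcL, hcL'⟩ := hcL
  obtain ⟨cK, hcK, hcK'⟩ := hcK
  refine ⟨iT cL - jT cK, ⟨iT, jT, cL, cK, hiT, hjT, hcL, hcK, rfl⟩, ?_⟩
  -- All four ingredients of a modular class of `φ` are unique, so the difference is too.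
  rintro _ ⟨iT₁, jT₁, cL₁, cK₁, h1, h2, h3, h4, rfl⟩
  rw [hiT' _ h1, hjT' _ h2, hcL' _ h3, hcK' _ h4]
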